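/- **Setting.** For each even sample size $n$ let $(X_i,W_i,Y_i(0),Y_i(1))_{i=1}^n$ be i.i.d. from a law that may depend on $n$, with $X_i\in\mathbb{R}^p$, $p=p_n\to\infty$, $W_i\in\{0,1\}$, and let $Y_i=Y_i(W_i)$ be the observed outcome. Write $\mu_{(1)}=\mathbb{E}\,Y_i(1)$ and $q(z)=1+e^{-z}$. Suppose that for some $\theta=\theta_{(1)},\ \beta=\beta_{(1)}\in\mathbb{R}^p$ (depending on $n$) $$\mathbb{E}[Y_i(1)\mid X_i]=X_i'\beta,\qquad \mathbb{P}(W_i=1\mid X_i)=e(X_i):=\frac1{1+\exp(-X_i'\theta)},$$ and that $\varepsilon_i:=Y_i(1)-X_i'\beta$ and $v_i:=\mathbf 1\{W_i=1\}-e(X_i)$ are conditionally independent given $X_i$. Suppose moreover, with constants not depending on $n$, that: $X_i\in[a,b]^p$ almost surely; $\|\theta\|_1\le r$; the eigenvalues of $\mathbb{E}[X_iX_i']$ lie in $[m,M]$ with $m>0$; $\|v'X_i\|_{\psi_2}\le K_X$ for all unit vectors $v$; and $\|\varepsilon_i\|_{\psi_2}\le K_\varepsilon$, where $\|Z\|_{\psi_2}\le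 K$ means $\mathbb{E}\exp(Z^2/K^2)\le2$. **Estimator.** Split $\{1,\dots,n\}$ into $\mathcal J$ and $\mathcal J^c$ with $|\mathcal J|=|\mathcal J^c|=n/2$. Fix a constant $\kappa>\|\theta\|_1$ (the same $\kappa$ for all $n$) and tuning parameters $\lambda_\theta,\lambda_\beta$. For $F\in\{\mathcal J,\mathcal J^c\}$ let $$\check\theta_F\in\arg\min_t\Big\{\tfrac1{|F|}\sum_{i\in F}\big[(1-W_i)X_i't+W_i e^{-X_i't}\big]+\lambda_\theta\|t\|_1\Big\},$$ $$\tilde\theta_F\in\arg\min_t\Big\{\|t\|_1:\ \Big\|\tfrac1{|F|}\sum_{i\in F}\big[1-W_i\,q(X_i't)\big]X_i\Big\|_\infty\le\lambda_\theta\Big\},$$ $\hat\theta_F=\tilde\theta_F$ if $\|\check\theta_F\|_1>\kappa$ and $\hat\theta_F=\check\theta_F$ otherwise, and $$\hat\beta_F\in\arg\min_b\Big\{\tfrac1{|F|}\sum_{i\in F}W_ie^{-X_i'\hat\theta_F}(Y_i-X_i'b)^2+\lambda_\beta\|b\|_1\Big\}.$$ The minimizers are arbitrary measurable functions of the data in $F$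 that they are computed from (of $(X_i,W_i)_{i\in F}$ for $\check\theta_F,\tilde\theta_F$, of $(X_i,W_i,Y_i)_{i\in F}$ for $\hat\beta_F$), arbitrary where no minimizer exists. Let $$\hat\mu_F=\tfrac1{|F|}\sum_{i\in F}\Big(X_i'\hat\beta_{F^c}+q(X_i'\hat\theta_F)\,W_i\,(Y_i-X_i'\hat\beta_{F^c})\Big),\qquad \hat\mu_{(1)}=\tfrac12\big(\hat\mu_{\mathcal J}+\hat\mu_{\mathcal J^c}\big).$$ **Theorem 3 (ultra-sparse propensity model).** There is a constant $c_0>0$, depending only on $a,b,r,m,M,K_X,K_\varepsilon,\kappa$, such that the following holds in every such setting. Let $\lambda_\theta$ and $\lambda_\beta$ be of the exact order $\sqrt{\log(p)/n}$ with a large enough constant: $c_0\sqrt{\log(p)/n}\le\lambda_\theta,\lambda_\beta\le C\sqrt{\log(p)/n}$ for some finite $C$ and all large $n$. If $\|\theta_{(1)}\|_0=o(\sqrt n/\log p)$ and $\|\beta_{(1)}\|_0=O(n^{3/4}/\log p)$ as $n\to\infty$ along the even integers, then $$\sqrt n\,(\hat\mu_{(1)}-\mu_{(1)})=n^{-1/2}\sum_{i=1}^n\Big[W_i\,\varepsilon_i\,q(X_i'\theta_{(1)})+\big(X_i'\beta_{(1)}-\mu_{(1)}\big)\Big]+o_P(1).$$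 -/

import Mathlib

open MeasureTheory ProbabilityTheory Filter Topology Asymptotics

noncomputable section

namespace SparseDR

/-! ### Vectors -/

/-- The `ℓ₁` norm of a vector. -/
def l1 {p : ℕ} (v : Fin p → ℝ) : ℝ := ∑ j, |v j|

/-- The number of nonzero coordinates of a vector. -/
def l0 {p : ℕ} (v : Fin p → ℝ) : ℕ := {j | v j ≠ 0}.ncard

/-- The inverse-propensity function `q(z) = 1 + exp(-z)`. -/
def q (z : ℝ) : ℝ := 1 + Real.exp (-z)

/-! ### Observations -/

/-- What the propensity estimators see of a unit: `(X, W)`; `W = true` means treated. -/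
abbrev CovTreat (p : ℕ) : Type := (Fin p → ℝ) × Bool

/-- What the statistician sees of a unit: `(X, W, Y)`. -/
abbrev Observed (p : ℕ) : Type := (Fin p → ℝ) × Bool × ℝ

/-- A unit `(X, W, Y(0), Y(1))`: covariates, treatment and both potential outcomes. -/
abbrev FullUnit (p : ℕ) : Type := (Fin p → ℝ) × Bool × ℝ × ℝ

/-- The covariates `X`. -/
def cov {p : ℕ} (o : FullUnit p) : Fin p → ℝ := o.1

/-- The treatment indicator `W`. -/
def treat {p : ℕ} (o : FullUnit p) : Bool := o.2.1

/-- The treatment indicator `W` as a real number in `{0, 1}`. -/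
def wt {p : ℕ} (o : FullUnit p) : ℝ := if treat o then 1 else 0

/-- The potential outcome `Y(0)`. -/
def y0 {p : ℕ} (o : FullUnit p) : ℝ := o.2.2.1

/-- The potential outcome `Y(1)`. -/
def y1 {p : ℕ} (o : FullUnit p) : ℝ := o.2.2.2

/-- The observed outcome `Y = Y(W)`. -/
def yObs {p : ℕ} (o : FullUnit p) : ℝ := if treat o then y1 o else y0 o

/-- The pair `(X, W)`. -/
def covTreat {p : ℕ} (o : FullUnit p) : CovTreat p := (cov o, treat o)

/-- The observed triple `(X, W, Y)`. -/
def observed {p : ℕ} (o : FullUnit p) : Observed p := (cov o, treat o, yObs o)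

/-- The outcome error `ε₍₁₎ = Y(1) - X'β`. -/
def eps {p : ℕ} (β : Fin p → ℝ) (o : FullUnit p) : ℝ := y1 o - cov o ⬝ᵥ β

/-- The logistic propensity `e(x) = 1 / (1 + exp(-x'θ))`. -/
def propensity {p : ℕ} (θ x : Fin p → ℝ) : ℝ := 1 / (1 + Real.exp (-(x ⬝ᵥ θ)))

/-- The treatment error `v₍₁₎ = 1{W = 1} - e(X)`. -/
def vRes {p : ℕ} (θ : Fin p → ℝ) (o : FullUnit p) : ℝ := wt o - propensity θ (cov o)

theorem measurable_cov {p : ℕ} : Measurable (cov : FullUnit p → Fin p → ℝ) := measurable_fst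

/-- The σ-algebra generated by `X`. -/
abbrev sigmaX (p : ℕ) : MeasurableSpace (FullUnit p) := MeasurableSpace.comap cov inferInstance

theorem sigmaX_le (p : ℕ) : sigmaX p ≤ (inferInstance : MeasurableSpace (FullUnit p)) :=
  measurable_cov.comap_le

/-- The matrix `E[X X']`. -/
def secondMoment {p : ℕ} (P : Measure (FullUnit p)) : Matrix (Fin p) (Fin p) ℝ :=
  Matrix.of fun j k => ∫ o, cov o j * cov o k ∂P

/-- `f` has sub-Gaussian (`ψ₂`) norm at most `K`: `E exp(f² / K²) ≤ 2`. -/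
def Psi2LE {Ω : Type*} [MeasurableSpace Ω] (P : Measure Ω) (f : Ω → ℝ) (K : ℝ) : Prop :=
  ∫⁻ ω, ENNReal.ofReal (Real.exp ((f ω) ^ 2 / K ^ 2)) ∂P ≤ 2

/-- The numerical bounds that do not depend on the sample size. -/
structure Bounds where
  /-- Covariates lie in `[lo, hi]^p`. -/
  lo : ℝ
  hi : ℝ
  /-- The eigenvalues of `E[X X']` lie in `[eigMin, eigMax]`. -/
  eigMin : ℝ
  eigMax : ℝ
  /-- Bound on the sub-Gaussian norm of `X`. -/
  KX : ℝ
  /-- Bound on the sub-Gaussian norm of `ε₍₁₎`. -/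
  Keps : ℝ
  /-- Radius of the `ℓ₁` ball that contains `θ`. -/
  r : ℝ
  eigMin_pos : 0 < eigMin
  KX_pos : 0 < KX
  Keps_pos : 0 < Keps

/-- The law `P` of a unit `(X, W, Y(0), Y(1))` follows the linear-logistic model with parameters
`θ`, `β` (the treated arm), with the regularity quantified by `B`. -/
structure Model (B : Bounds) {p : ℕ} (P : Measure (FullUnit p)) [IsProbabilityMeasure P]
    (θ β : Fin p → ℝ) : Prop where
  cov_mem : ∀ᵐ o ∂P, ∀ j, cov o j ∈ Set.Icc B.lo B.hi
  theta_mem : l1 θ ≤ B.r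
  /-- All eigenvalues of `E[X X']` lie in a fixed interval away from zero. -/
  eigenvalues : spectrum ℝ (secondMoment P) ⊆ Set.Icc B.eigMin B.eigMax
  /-- `‖v'X‖_{ψ₂} ≤ KX` for every Euclidean unit vector `v`. -/
  cov_subgaussian : ∀ v : Fin p → ℝ, ∑ j, v j ^ 2 = 1 → Psi2LE P (fun o => cov o ⬝ᵥ v) B.KX
  eps_subgaussian : Psi2LE P (eps β) B.Keps
  /-- `E[Y(1) | X] = X'β`. -/
  outcome : P[y1 | sigmaX p] =ᵐ[P] fun o => cov o ⬝ᵥ β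
  /-- `P(W = 1 | X) = 1 / (1 + exp(-X'θ))`. -/
  treatment : P[wt | sigmaX p] =ᵐ[P] fun o => propensity θ (cov o)
  /-- `ε₍₁₎` and `v₍₁₎` are independent conditionally on `X`. -/
  unconfounded : CondIndepFun (sigmaX p) (sigmaX_le p) (eps β) (vRes θ) P

/-! ### Estimators from a training sample indexed by `ι` -/

section Estimators

variable {ι : Type*} [Fintype ι] {p : ℕ}

/-- The penalized covariate-balancing loss for `w = 1`. -/
def balanceObjective (lam : ℝ) (d : ι → CovTreat p) (t : Fin p → ℝ) : ℝ :=
  (1 / (Fintype.card ι : ℝ)) *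
      ∑ i, (if (d i).2 then Real.exp (-((d i).1 ⬝ᵥ t)) else (d i).1 ⬝ᵥ t)
    + lam * l1 t

/-- The vectors `t` with
`‖ |ι|⁻¹ ∑ᵢ [1 - 1{Wᵢ = 1} (1 + exp(-Xᵢ't))] Xᵢ ‖_∞ ≤ lam`. -/
def balanceFeasible (lam : ℝ) (d : ι → CovTreat p) : Set (Fin p → ℝ) :=
  {t | ∀ j, |(1 / (Fintype.card ι : ℝ)) *
      ∑ i, (1 - (if (d i).2 then q ((d i).1 ⬝ᵥ t) else 0)) * (d i).1 j| ≤ lam}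

/-- The weighted lasso objective for `w = 1`, given a propensity estimate `t`. -/
def outcomeObjective (lam : ℝ) (d : ι → Observed p) (t b : Fin p → ℝ) : ℝ :=
  (1 / (Fintype.card ι : ℝ)) *
      ∑ i, (if (d i).2.1 then
        Real.exp (-((d i).1 ⬝ᵥ t)) * ((d i).2.2 - (d i).1 ⬝ᵥ b) ^ 2 else 0)
    + lam * l1 b

/-- `t` is a minimizer of `f` over `s`. -/
def IsArgmin (f : (Fin p → ℝ) → ℝ) (s : Set (Fin p → ℝ)) (t : Fin p → ℝ) : Prop :=
  t ∈ s ∧ IsMinOn f s t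

/-- The covariates and treatments of a training sample. -/
def dropOutcome (d : ι → Observed p) : ι → CovTreat p := fun i => ((d i).1, (d i).2.1)

/-- The final propensity estimate: the lasso-type one, unless its `ℓ₁` norm exceeds `κ`, in which
case the Dantzig-type one. -/
def finalTheta (κ : ℝ) (check tilde : Fin p → ℝ) : Fin p → ℝ :=
  if κ < l1 check then tilde else check

variable (ι p) in
/-- The estimators for `w = 1` computed from a training sample indexed by `ι`. An `argmin` is a
measurable function of the training sample that returns some minimizer whenever there is one. -/
structure Estimator (lamθ lamβ κ : ℝ) where
  /-- The lasso-type estimator of `θ`. -/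
  thetaCheck : (ι → CovTreat p) → Fin p → ℝ
  /-- The Dantzig-type estimator of `θ`. -/
  thetaTilde : (ι → CovTreat p) → Fin p → ℝ
  /-- The estimator of `β`. -/
  betaHat : (ι → Observed p) → Fin p → ℝ
  measurable_thetaCheck : Measurable thetaCheck
  measurable_thetaTilde : Measurable thetaTilde
  measurable_betaHat : Measurable betaHat
  thetaCheck_argmin : ∀ d, (∃ t, IsArgmin (balanceObjective lamθ d) Set.univ t) →
    IsArgmin (balanceObjective lamθ d) Set.univ (thetaCheck d)
  thetaTilde_argmin : ∀ d, (∃ t, IsArgmin l1 (balanceFeasible lamθ d) t) →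
    IsArgmin l1 (balanceFeasible lamθ d) (thetaTilde d)
  /-- The weights in the objective of `betaHat` come from the final propensity estimate. -/
  betaHat_argmin : ∀ d,
    (∃ b, IsArgmin (outcomeObjective lamβ d (finalTheta κ (thetaCheck (dropOutcome d))
      (thetaTilde (dropOutcome d)))) Set.univ b) →
    IsArgmin (outcomeObjective lamβ d (finalTheta κ (thetaCheck (dropOutcome d))
      (thetaTilde (dropOutcome d)))) Set.univ (betaHat d)

/-- The final propensity estimator. -/
def Estimator.thetaHat {lamθ lamβ κ : ℝ} (E : Estimator ι p lamθ lamβ κ)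
    (d : ι → CovTreat p) : Fin p → ℝ :=
  finalTheta κ (E.thetaCheck d) (E.thetaTilde d)

end Estimators

/-! ### The cross-fitted estimator of `E Y(1)` -/

/-- The estimate of `E Y(1)` on the fold `F`: `θ̂` is trained on `F`, `β̂` on the complement. -/
def muHatFold {n p : ℕ} {lamθ lamβ κ : ℝ}
    (E : ∀ F : Finset (Fin n), Estimator F p lamθ lamβ κ)
    (F : Finset (Fin n)) (S : Fin n → FullUnit p) : ℝ :=
  let θh := (E F).thetaHat fun i => covTreat (S i)
  let βh := (E Fᶜ).betaHat fun i => observed (S i)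
  (1 / (F.card : ℝ)) * ∑ i ∈ F,
    (cov (S i) ⬝ᵥ βh
      + (1 + Real.exp (-(cov (S i) ⬝ᵥ θh))) * wt (S i) * (yObs (S i) - cov (S i) ⬝ᵥ βh))

/-- The estimate `μ̂₍₁₎`, with sample splitting into `J` and its complement. -/
def muHat {n p : ℕ} {lamθ lamβ κ : ℝ}
    (E : ∀ F : Finset (Fin n), Estimator F p lamθ lamβ κ)
    (J : Finset (Fin n)) (S : Fin n → FullUnit p) : ℝ :=
  (muHatFold E J S + muHatFold E Jᶜ S) / 2

/-- `μ₍₁₎ = E Y(1)`. -/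
def mu1 {p : ℕ} (P : Measure (FullUnit p)) : ℝ := ∫ o, y1 o ∂P

/-- The law of an i.i.d. sample of size `n` from `P`. -/
def sampleLaw (n : ℕ) {p : ℕ} (P : Measure (FullUnit p)) : Measure (Fin n → FullUnit p) :=
  Measure.pi fun _ => P

/-- The linear term
`n^{-1/2} ∑ᵢ [Wᵢ εᵢ q(Xᵢ'θ) + (Xᵢ'β - μ)]`. -/
def linearTerm {n p : ℕ} (P : Measure (FullUnit p)) (θ β : Fin p → ℝ)
    (S : Fin n → FullUnit p) : ℝ :=
  (1 / Real.sqrt n) *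
    ∑ i, (wt (S i) * eps β (S i) * q (cov (S i) ⬝ᵥ θ) + (cov (S i) ⬝ᵥ β - mu1 P))

end SparseDR

end

/-!
Write `Δ = θ̂ - θ` for the propensity error, estimated on the fold `F`, and `δ = β̂ - β` for the outcome
error, estimated on the complement. On `F`, the average of the doubly robust scores at the estimates
exceeds the average of the linear terms by (`foldError_eq`)
`avg (1 - W q(X'θ)) X'δ + avg W ε (q(X'θ̂) - q(X'θ)) + avg W exp(-X'θ) (1 - exp(-X'Δ)) X'δ`.
Each term is `o_P(n^{-1/2})`, and the two folds add up to the estimator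
(`sqrt_mul_muHat_sub_linearTerm`). Let `s = ‖θ‖₀`, `s' = ‖β‖₀` and `ρ² = log p / n`.

The first term is centred given the complement, and small since `δ` is. The second is centred given the
covariates and treatments of `F`, because the outcome error is centred given `(X, W)`
(`Model.setIntegral_eps_covTreat`), and small since `Δ` tends to zero in the `ℓ₁` norm.

The third, the interaction, is the reason for sample splitting (`abs_interaction_le`). The
Cauchy–Schwarz inequality would only give `√(s s') ρ²`. Its leading part is `δ'ĤΔ` with `Ĥ` the
empirical Hessian of the balancing loss on `F`. As `δ` does not depend on `F`, the vector `Ĥδ` is within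
`ρ ‖δ‖₂` of its expectation in the supremum norm; as `Δ` does not depend on the complement, `HΔ` is
likewise close to its empirical counterpart there (`CrossGood`, `Model.measure_not_crossGood_le`). So
`Ĥ` may be replaced by the Hessian on the complement at the cost of
`ρ ‖δ‖₂ ‖Δ‖₁ + ρ ‖Δ‖₂ ‖δ‖₁ ≲ ρ³ (√s' s + √s s')`, and on the complement the optimality conditions of the
weighted lasso bound `Ĥδ` by `ρ` in the supremum norm, up to a change of weights of third order. The
worst resulting term is `√n ρ³ √s s' = √(√n s ρ²) * (n^{1/4} s' ρ²)`: the first factor vanishes and the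
second is bounded, which is the trade-off between the two sparsity assumptions.

The rates of `θ̂` and `β̂` (`Estimator.thetaHat_rates`, `Estimator.betaHat_rates`) follow from the basic
inequalities of the penalized estimators and a restricted eigenvalue property of the treated units
(`Model.measure_not_restrictedEig_le`). The latter is proved by Maurey's empirical method
(`quadForm_nonneg_of_sums`) from the lower tail of a single quadratic form, which needs fourth moments
only. The deviation bounds for centred averages are self-normalised (`measure_abs_ge_inter_le`,
`lintegral_exp_sub_sq_le_one`): they hold for all `n` and `p` and need exponential moments only to
control a sum of squares.
-/

noncomputable section

namespace SparseDR

/-! ### Elementary inequalities for the exponential -/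

theorem exp_sub_sq_le (x : ℝ) : Real.exp (x - x ^ 2) ≤ 1 + x + x ^ 2 := by
  have h1 : 0 < 1 - x + x ^ 2 := by nlinarith [sq_nonneg (x - 1 / 2)]
  have h2 : 1 - x + x ^ 2 ≤ Real.exp (-(x - x ^ 2)) := by
    have := Real.add_one_le_exp (-(x - x ^ 2)); linarith
  rw [Real.exp_neg] at h2
  have h3 := Real.exp_pos (x - x ^ 2)
  have h4 : (1 - x + x ^ 2) * Real.exp (x - x ^ 2) ≤ 1 := by
    calc _ ≤ (Real.exp (x - x ^ 2))⁻¹ * Real.exp (x - x ^ 2) := by gcongr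
      _ = 1 := inv_mul_cancel₀ h3.ne'
  nlinarith [sq_nonneg x, sq_nonneg (x ^ 2)]

/-- The curvature of `x ↦ exp (-x)`, which governs the balancing loss, degrades only linearly in the
increment. -/
theorem exp_neg_sub_one_add_ge (x : ℝ) :
    x ^ 2 / (4 * (1 + |x|)) ≤ Real.exp (-x) - 1 + x := by
  have h0 := abs_nonneg x
  rw [div_le_iff₀ (by positivity)]
  rcases le_or_gt x 2 with h | h
  · have h1 : 1 - x / 2 ≤ Real.exp (-x / 2) := by
      have := Real.add_one_le_exp (-x / 2); linarith
    have h2 : Real.exp (-x) = Real.exp (-x / 2) ^ 2 := by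
      rw [sq, ← Real.exp_add]; ring_nf
    have h3 : (1 - x / 2) ^ 2 ≤ Real.exp (-x) := by
      rw [h2]; exact pow_le_pow_left₀ (by linarith) h1 2
    nlinarith [sq_nonneg x]
  · rw [abs_of_pos (by linarith)]
    have := Real.exp_pos (-x)
    nlinarith

/-- The monotonicity counterpart of `exp_neg_sub_one_add_ge`, for the gradient of the balancing loss. -/
theorem one_sub_exp_neg_mul_ge (x : ℝ) :
    x ^ 2 / (4 * (1 + |x|)) ≤ (1 - Real.exp (-x)) * x := by
  have h0 := abs_nonneg x
  rw [div_le_iff₀ (by positivity)]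
  rcases le_or_gt 0 x with h | h
  · rw [abs_of_nonneg h]
    have h1 := Real.add_one_le_exp x
    have h2 : (1 - Real.exp (-x)) * (1 + x) ≥ x := by
      rw [Real.exp_neg]
      have h3 : (Real.exp x)⁻¹ * (1 + x) ≤ 1 := by
        rw [inv_mul_le_iff₀ (Real.exp_pos x)]; linarith
      linarith
    nlinarith
  · rw [abs_of_neg h]
    have h1 := Real.add_one_le_exp (-x)
    have h2 : x ^ 2 ≤ (1 - Real.exp (-x)) * x := by nlinarith
    nlinarith [sq_nonneg x]

theorem exp_neg_sub_one_add_nonneg (x : ℝ) : 0 ≤ Real.exp (-x) - 1 + x := by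
  have := Real.add_one_le_exp (-x); linarith

theorem abs_exp_neg_sub_one_le (x : ℝ) : |Real.exp (-x) - 1| ≤ |x| * Real.exp |x| := by
  have h1 := Real.add_one_le_exp (-x)
  have h2 := Real.add_one_le_exp x
  have h3 := le_abs_self x
  have h4 := neg_abs_le x
  have h5 : 1 ≤ Real.exp |x| := Real.one_le_exp (abs_nonneg x)
  have h6 := abs_nonneg x
  have h7 : Real.exp (-x) * Real.exp x = 1 := by rw [← Real.exp_add]; simp
  have h8 : Real.exp (-x) ≤ Real.exp |x| := Real.exp_le_exp.2 (neg_le_abs x)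
  have h9 := Real.exp_pos (-x)
  rw [abs_le]
  constructor
  · nlinarith
  · rcases le_or_gt 0 x with h | h
    · have : Real.exp (-x) ≤ 1 := Real.exp_le_one_iff.2 (by linarith)
      nlinarith
    · rw [abs_of_neg h] at *
      nlinarith

/-- The second-order Taylor remainder of `x ↦ exp (-x)`; it follows from
`exp (-x) - 1 + x ≤ x (1 - exp (-x))`. -/
theorem exp_neg_sub_one_add_le (x : ℝ) : Real.exp (-x) - 1 + x ≤ x ^ 2 * Real.exp |x| := by
  have h2 := Real.add_one_le_exp x
  have h7 : Real.exp (-x) * Real.exp x = 1 := by rw [← Real.exp_add]; simp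
  have h9 := Real.exp_pos (-x)
  have h1 : Real.exp (-x) - 1 + x ≤ x * (1 - Real.exp (-x)) := by nlinarith
  refine h1.trans ((le_abs_self _).trans ?_)
  rw [abs_mul, abs_sub_comm]
  calc |x| * |Real.exp (-x) - 1| ≤ |x| * (|x| * Real.exp |x|) := by
        gcongr; exact abs_exp_neg_sub_one_le x
    _ = x ^ 2 * Real.exp |x| := by rw [← mul_assoc, abs_mul_abs_self, sq]

/-! ### Self-normalised exponential inequalities -/

section SelfNormalised

variable {Ω : Type*} [MeasurableSpace Ω]

/-- A centred variable `U` compensated by `U² + E U²` has exponential moment at most one; this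
needs two moments only, because `exp (x - x²) ≤ 1 + x + x²`. -/
theorem lintegral_exp_sub_sq_le_one {ρ : Measure Ω} [IsProbabilityMeasure ρ] {U : Ω → ℝ} {v : ℝ}
    (hU : Integrable U ρ) (hU2 : Integrable (fun ω => U ω ^ 2) ρ) (h0 : ∫ ω, U ω ∂ρ = 0)
    (hv : ∫ ω, U ω ^ 2 ∂ρ ≤ v) (s : ℝ) :
    ∫⁻ ω, ENNReal.ofReal (Real.exp (s * U ω - s ^ 2 * (U ω ^ 2 + v))) ∂ρ ≤ 1 := by
  have hpt : ∀ ω, Real.exp (s * U ω - s ^ 2 * (U ω ^ 2 + v)) ≤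
      (1 + s * U ω + s ^ 2 * U ω ^ 2) * Real.exp (-(s ^ 2 * v)) := by
    intro ω
    have h1 : s * U ω - s ^ 2 * (U ω ^ 2 + v) = (s * U ω - (s * U ω) ^ 2) + -(s ^ 2 * v) := by ring
    rw [h1, Real.exp_add]
    have h2 := exp_sub_sq_le (s * U ω)
    rw [mul_pow] at h2 ⊢
    exact mul_le_mul_of_nonneg_right h2 (Real.exp_pos _).le
  have hint : Integrable (fun ω => (1 + s * U ω + s ^ 2 * U ω ^ 2) * Real.exp (-(s ^ 2 * v))) ρ :=
    (((integrable_const 1).add (hU.const_mul s)).add (hU2.const_mul (s ^ 2))).mul_const _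
  calc ∫⁻ ω, ENNReal.ofReal (Real.exp (s * U ω - s ^ 2 * (U ω ^ 2 + v))) ∂ρ
      ≤ ∫⁻ ω, ENNReal.ofReal ((1 + s * U ω + s ^ 2 * U ω ^ 2) * Real.exp (-(s ^ 2 * v))) ∂ρ :=
        lintegral_mono fun ω => ENNReal.ofReal_le_ofReal (hpt ω)
    _ = ENNReal.ofReal (∫ ω, (1 + s * U ω + s ^ 2 * U ω ^ 2) * Real.exp (-(s ^ 2 * v)) ∂ρ) :=
        (ofReal_integral_eq_lintegral_ofReal hint
          (Eventually.of_forall fun ω => (Real.exp_pos _).le.trans (hpt ω))).symm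
    _ ≤ 1 := by
        have hI : Integrable (fun ω => 1 + s * U ω) ρ := (integrable_const 1).add (hU.const_mul s)
        rw [integral_mul_const, integral_add hI (hU2.const_mul _),
          integral_add (integrable_const 1) (hU.const_mul s), integral_const_mul, integral_const_mul, h0]
        rw [ENNReal.ofReal_le_one]
        simp only [integral_const, probReal_univ, smul_eq_mul, mul_one, mul_zero, add_zero]
        have h2 : 1 + s ^ 2 * ∫ ω, U ω ^ 2 ∂ρ ≤ Real.exp (s ^ 2 * v) := by
          have := Real.add_one_le_exp (s ^ 2 * v)
          nlinarith [mul_le_mul_of_nonneg_left hv (sq_nonneg s)]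
        rw [Real.exp_neg, ← div_eq_mul_inv, div_le_one (Real.exp_pos _)]
        exact h2

/-- Chernoff's bound in self-normalised form. -/
theorem measure_abs_ge_inter_le {ρ : Measure Ω} {a v : Ω → ℝ} (ha : Measurable a)
    (hv : Measurable v)
    (h : ∀ s : ℝ, ∫⁻ ω, ENNReal.ofReal (Real.exp (s * a ω - s ^ 2 * v ω)) ∂ρ ≤ 1)
    {t V : ℝ} (ht : 0 ≤ t) (hV : 0 < V) :
    ρ {ω | t ≤ |a ω| ∧ v ω ≤ V} ≤ 2 * ENNReal.ofReal (Real.exp (-(t ^ 2 / (4 * V)))) := by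
  have key : ∀ s : ℝ, |s| = t / (2 * V) → ρ {ω | t * |s| ≤ s * a ω ∧ v ω ≤ V} ≤
      ENNReal.ofReal (Real.exp (-(t ^ 2 / (4 * V)))) := by
    intro s hs
    -- `|s| = t / (2 V)` maximises `|s| t - s² V`.
    have hs2 : s ^ 2 = (t / (2 * V)) ^ 2 := by rw [← sq_abs, hs]
    set E : ENNReal := ENNReal.ofReal (Real.exp (t ^ 2 / (4 * V))) with hE
    have hm : Measurable fun ω => ENNReal.ofReal (Real.exp (s * a ω - s ^ 2 * v ω)) := by fun_prop
    have hsub : {ω | t * |s| ≤ s * a ω ∧ v ω ≤ V} ⊆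
        {ω | E ≤ ENNReal.ofReal (Real.exp (s * a ω - s ^ 2 * v ω))} := by
      rintro ω ⟨h1, h2⟩
      refine ENNReal.ofReal_le_ofReal (Real.exp_le_exp.2 ?_)
      have h3 : s ^ 2 * v ω ≤ s ^ 2 * V := mul_le_mul_of_nonneg_left h2 (sq_nonneg s)
      have h4 : t ^ 2 / (4 * V) = t * |s| - s ^ 2 * V := by
        rw [hs, hs2]; field_simp; ring
      linarith
    have hmk := mul_meas_ge_le_lintegral (μ := ρ) hm E
    have hE0 : E ≠ 0 := by simp [hE, Real.exp_pos]
    have hEt : E ≠ ⊤ := ENNReal.ofReal_ne_top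
    have h5 : E * ρ {ω | t * |s| ≤ s * a ω ∧ v ω ≤ V} ≤ 1 :=
      (mul_le_mul_right (measure_mono hsub) E).trans (hmk.trans (h s))
    have h6 : ENNReal.ofReal (Real.exp (-(t ^ 2 / (4 * V)))) = E⁻¹ := by
      rw [Real.exp_neg, ENNReal.ofReal_inv_of_pos (Real.exp_pos _)]
    rw [h6, ← mul_one E⁻¹, ← ENNReal.div_eq_inv_mul]
    rw [ENNReal.le_div_iff_mul_le (Or.inl hE0) (Or.inl hEt), mul_comm]
    exact h5
  have hs0 : 0 ≤ t / (2 * V) := by positivity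
  have hsub : {ω | t ≤ |a ω| ∧ v ω ≤ V} ⊆
      {ω | t * |t / (2 * V)| ≤ t / (2 * V) * a ω ∧ v ω ≤ V} ∪
      {ω | t * |-(t / (2 * V))| ≤ -(t / (2 * V)) * a ω ∧ v ω ≤ V} := by
    rintro ω ⟨h1, h2⟩
    rcases le_total 0 (a ω) with h3 | h3
    · left
      rw [abs_of_nonneg h3] at h1
      refine ⟨?_, h2⟩
      rw [abs_of_nonneg hs0, mul_comm]
      exact mul_le_mul_of_nonneg_left h1 hs0
    · right
      rw [abs_of_nonpos h3] at h1
      refine ⟨?_, h2⟩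
      rw [abs_neg, abs_of_nonneg hs0, mul_comm, neg_mul, ← mul_neg]
      exact mul_le_mul_of_nonneg_left h1 hs0
  refine (measure_mono hsub).trans ((measure_union_le _ _).trans ?_)
  rw [two_mul (ENNReal.ofReal _)]
  exact add_le_add (key _ (abs_of_nonneg hs0)) (key _ (by rw [abs_neg, abs_of_nonneg hs0]))

variable {ι : Type*} [Fintype ι]

theorem lintegral_pi_prod_eval {ρ : ι → Measure Ω} [∀ i, IsProbabilityMeasure (ρ i)]
    {f : ι → Ω → ENNReal} (hf : ∀ i, Measurable (f i)) :
    ∫⁻ ω, ∏ i, f i (ω i) ∂(Measure.pi ρ) = ∏ i, ∫⁻ x, f i x ∂(ρ i) := by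
  rw [lintegral_prod_eq_prod_lintegral_of_indepFun (μ := Measure.pi ρ) Finset.univ
    (fun i (ω : ι → Ω) => f i (ω i)) (iIndepFun_pi fun i => (hf i).aemeasurable)
    fun i => (hf i).comp (measurable_pi_apply i)]
  refine Finset.prod_congr rfl fun i _ => ?_
  exact (measurePreserving_eval ρ i).lintegral_comp (hf i)

/-- Self-normalised tail bound for a sum of independent centred variables. -/
theorem measure_pi_abs_sum_ge_le {ρ : Measure Ω} [IsProbabilityMeasure ρ]
    {U : Ω → ℝ} (hm : Measurable U) (hU : Integrable U ρ)
    (hU2 : Integrable (fun ω => U ω ^ 2) ρ) (h0 : ∫ ω, U ω ∂ρ = 0) {v : ℝ}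
    (hv : ∫ ω, U ω ^ 2 ∂ρ ≤ v) {t V : ℝ} (ht : 0 ≤ t) (hV : 0 < V) :
    Measure.pi (fun _ : ι => ρ) {ω | t ≤ |∑ i, U (ω i)| ∧ ∑ i, (U (ω i) ^ 2 + v) ≤ V} ≤
      2 * ENNReal.ofReal (Real.exp (-(t ^ 2 / (4 * V)))) := by
  refine measure_abs_ge_inter_le (by fun_prop) (by fun_prop) (fun s => ?_) ht hV
  have h1 : ∀ ω : ι → Ω, ENNReal.ofReal (Real.exp (s * ∑ i, U (ω i) -
      s ^ 2 * ∑ i, (U (ω i) ^ 2 + v))) =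
      ∏ i, ENNReal.ofReal (Real.exp (s * U (ω i) - s ^ 2 * (U (ω i) ^ 2 + v))) := by
    intro ω
    rw [← ENNReal.ofReal_prod_of_nonneg fun i _ => (Real.exp_pos _).le, ← Real.exp_sum,
      Finset.sum_sub_distrib, Finset.mul_sum, Finset.mul_sum]
  simp_rw [h1]
  rw [lintegral_pi_prod_eval (ρ := fun _ : ι => ρ)
    (f := fun _ x => ENNReal.ofReal (Real.exp (s * U x - s ^ 2 * (U x ^ 2 + v))))
    (fun _ => by fun_prop)]
  exact Finset.prod_le_one' fun i _ => lintegral_exp_sub_sq_le_one hU hU2 h0 hv s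

/-- A sum of squares of variables with `ψ₂` norm at most `K` exceeds `card ι * K²` with
exponentially small probability. -/
theorem measure_pi_sum_sq_gt_le {ρ : Measure Ω} [IsProbabilityMeasure ρ] {Y : Ω → ℝ}
    (hY : Measurable Y) {K : ℝ} (hK : 0 < K) (h : Psi2LE ρ Y K) :
    Measure.pi (fun _ : ι => ρ) {ω | (Fintype.card ι : ℝ) * K ^ 2 ≤ ∑ i, Y (ω i) ^ 2} ≤
      ENNReal.ofReal ((2 / Real.exp 1) ^ Fintype.card ι) := by
  have hm : Measurable fun x => ENNReal.ofReal (Real.exp (Y x ^ 2 / K ^ 2)) := by fun_prop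
  have h1 : ∫⁻ ω : ι → Ω, ∏ i, ENNReal.ofReal (Real.exp (Y (ω i) ^ 2 / K ^ 2))
      ∂(Measure.pi fun _ : ι => ρ) ≤ 2 ^ Fintype.card ι := by
    rw [lintegral_pi_prod_eval (ρ := fun _ : ι => ρ)
      (f := fun _ x => ENNReal.ofReal (Real.exp (Y x ^ 2 / K ^ 2))) (fun _ => hm)]
    rw [Finset.prod_const, Finset.card_univ]
    exact pow_le_pow_left' h _
  set E : ENNReal := ENNReal.ofReal (Real.exp 1 ^ Fintype.card ι) with hE
  have hsub : {ω : ι → Ω | (Fintype.card ι : ℝ) * K ^ 2 ≤ ∑ i, Y (ω i) ^ 2} ⊆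
      {ω | E ≤ ∏ i, ENNReal.ofReal (Real.exp (Y (ω i) ^ 2 / K ^ 2))} := by
    intro ω hω
    simp only [Set.mem_ofPred_eq] at hω ⊢
    rw [← ENNReal.ofReal_prod_of_nonneg fun i _ => (Real.exp_pos _).le, ← Real.exp_sum, hE,
      ← Real.exp_nat_mul, mul_one, ← Finset.sum_div]
    refine ENNReal.ofReal_le_ofReal (Real.exp_le_exp.2 ?_)
    rw [le_div_iff₀ (by positivity)]; exact hω
  have hmk := mul_meas_ge_le_lintegral (μ := Measure.pi fun _ : ι => ρ)
    (f := fun ω => ∏ i, ENNReal.ofReal (Real.exp (Y (ω i) ^ 2 / K ^ 2)))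
    (Finset.measurable_prod _ fun i _ => hm.comp (measurable_pi_apply i)) E
  have hE0 : E ≠ 0 := by simp [hE, Real.exp_pos]
  have h5 := (mul_le_mul_right (measure_mono (μ := Measure.pi fun _ : ι => ρ) hsub) E).trans
    (hmk.trans h1)
  have h6 : ENNReal.ofReal ((2 / Real.exp 1) ^ Fintype.card ι) = 2 ^ Fintype.card ι / E := by
    rw [div_pow, ENNReal.ofReal_div_of_pos (by positivity), ENNReal.ofReal_pow (by norm_num),
      ENNReal.ofReal_ofNat]
  rw [h6, ENNReal.le_div_iff_mul_le (Or.inl hE0) (Or.inl ENNReal.ofReal_ne_top), mul_comm]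
  exact h5

end SelfNormalised

/-! ### Sums that are centred conditionally on the design -/

section Conditional

open scoped unitInterval

variable {Z E : Type*} [MeasurableSpace Z] [MeasurableSpace E] {ι : Type*} [Fintype ι]

/-- Conditionally on all the first coordinates of an i.i.d. sample from `ν ⊗ₘ k`, the second
coordinates are independent. To integrate them out, they are represented as a function of the
first coordinates and of independent uniform variables. -/
theorem lintegral_pi_compProd_prod_le_one [StandardBorelSpace E] [Nonempty E]
    {ν : Measure Z} [IsProbabilityMeasure ν] {k : Kernel Z E} [IsMarkovKernel k]
    {h : ι → (ι → Z) → E → ENNReal} (hm : ∀ i, Measurable (Function.uncurry (h i)))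
    (hle : ∀ᵐ z ∂(Measure.pi fun _ : ι => ν), ∀ i, ∫⁻ e, h i z e ∂(k (z i)) ≤ 1) :
    ∫⁻ S, ∏ i, h i (fun j => (S j).1) (S i).2 ∂(Measure.pi fun _ : ι => ν ⊗ₘ k) ≤ 1 := by
  obtain ⟨f, hf, hfk⟩ := k.exists_measurable_map_eq_unitInterval
  have hfz : ∀ z, Measurable (f z) := fun z => hf.comp measurable_prodMk_left
  set g : Z × I → Z × E := fun zu => (zu.1, f zu.1 zu.2) with hg
  have hgm : Measurable g := measurable_fst.prodMk hf
  have hmap : ν ⊗ₘ k = (ν.prod (volume : Measure I)).map g := by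
    refine Measure.ext fun s hs => ?_
    rw [Measure.compProd_apply hs, Measure.map_apply hgm hs, Measure.prod_apply (hgm hs)]
    refine lintegral_congr fun z => ?_
    rw [← hfk z, Measure.map_apply (hfz z) (measurable_prodMk_left hs)]
    rfl
  have hprob : IsProbabilityMeasure ((ν.prod (volume : Measure I)).map g) :=
    Measure.isProbabilityMeasure_map hgm.aemeasurable
  have hpi : (Measure.pi fun _ : ι => ν ⊗ₘ k) =
      (Measure.pi fun _ : ι => ν.prod (volume : Measure I)).map fun x i => g (x i) := by
    rw [hmap]
    exact (Measure.pi_map_pi fun _ => hgm.aemeasurable).symm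
  have hFm : Measurable fun S : ι → Z × E => ∏ i, h i (fun j => (S j).1) (S i).2 := by
    refine Finset.measurable_prod _ fun i _ => ?_
    have : Measurable fun S : ι → Z × E => ((fun j => (S j).1 : ι → Z), (S i).2) := by fun_prop
    exact (hm i).comp this
  rw [hpi, lintegral_map hFm (by fun_prop)]
  have hmp := (measurePreserving_arrowProdEquivProdArrow Z I ι (fun _ => ν)
    (fun _ => (volume : Measure I)))
  have hGm : Measurable fun zu : (ι → Z) × (ι → I) =>
      ∏ i, h i zu.1 (f (zu.1 i) (zu.2 i)) := by
    refine Finset.measurable_prod _ fun i _ => ?_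
    have h1 : Measurable fun zu : (ι → Z) × (ι → I) => (zu.1 i, zu.2 i) := by fun_prop
    have : Measurable fun zu : (ι → Z) × (ι → I) => (zu.1, f (zu.1 i) (zu.2 i)) :=
      measurable_fst.prodMk (hf.comp h1)
    exact (hm i).comp this
  calc ∫⁻ x : ι → Z × I, ∏ i, h i (fun j => (g (x j)).1) (g (x i)).2
        ∂(Measure.pi fun _ : ι => ν.prod (volume : Measure I))
      = ∫⁻ zu : (ι → Z) × (ι → I), ∏ i, h i zu.1 (f (zu.1 i) (zu.2 i))
        ∂((Measure.pi fun _ : ι => ν).prod (Measure.pi fun _ : ι => (volume : Measure I))) := by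
        rw [← hmp.lintegral_comp hGm]; rfl
    _ = ∫⁻ z, ∏ i, ∫⁻ e, h i z e ∂(k (z i)) ∂(Measure.pi fun _ : ι => ν) := by
        rw [lintegral_prod _ hGm.aemeasurable]
        refine lintegral_congr fun z => ?_
        have hzm : ∀ i, Measurable (h i z) := fun i => (hm i).comp measurable_prodMk_left
        rw [lintegral_pi_prod_eval (ρ := fun _ : ι => (volume : Measure I))
          (f := fun i u => h i z (f (z i) u)) (fun i => (hzm i).comp (hfz _))]
        refine Finset.prod_congr rfl fun i _ => ?_
        rw [← hfk (z i), lintegral_map (hzm i) (hfz _)]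
    _ ≤ ∫⁻ _, 1 ∂(Measure.pi fun _ : ι => ν) :=
        lintegral_mono_ae (hle.mono fun z hz => Finset.prod_le_one' fun i _ => hz i)
    _ = 1 := by simp

/-- Self-normalised tail bound for a weighted sum of errors that are centred conditionally on the
design; the weights may depend on the whole design. -/
theorem measure_pi_compProd_abs_sum_ge_le {ν : Measure Z} [IsProbabilityMeasure ν]
    {k : Kernel Z ℝ} [IsMarkovKernel k] (hk1 : ∀ᵐ z ∂ν, Integrable (fun e => e) (k z))
    (hk2 : ∀ᵐ z ∂ν, Integrable (fun e => e ^ 2) (k z)) (hk0 : ∀ᵐ z ∂ν, ∫ e, e ∂(k z) = 0)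
    {a : ι → (ι → Z) → ℝ} (ha : ∀ i, Measurable (a i)) {t V : ℝ} (ht : 0 ≤ t) (hV : 0 < V) :
    Measure.pi (fun _ : ι => ν ⊗ₘ k) {S | t ≤ |∑ i, a i (fun j => (S j).1) * (S i).2| ∧
      ∑ i, a i (fun j => (S j).1) ^ 2 * ((S i).2 ^ 2 + ∫ e, e ^ 2 ∂(k (S i).1)) ≤ V} ≤
      2 * ENNReal.ofReal (Real.exp (-(t ^ 2 / (4 * V)))) := by
  have hvm : Measurable fun z => ∫ e, e ^ 2 ∂(k z) :=
    (StronglyMeasurable.integral_kernel (κ := k) (f := fun e : ℝ => e ^ 2)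
      (by fun_prop : Measurable fun e : ℝ => e ^ 2).stronglyMeasurable).measurable
  have hz : Measurable fun S : ι → Z × ℝ => (fun j => (S j).1 : ι → Z) := by fun_prop
  have ham : ∀ i, Measurable fun S : ι → Z × ℝ => a i (fun j => (S j).1) :=
    fun i => (ha i).comp hz
  refine measure_abs_ge_inter_le (by fun_prop) ?_ (fun s => ?_) ht hV
  · refine Finset.measurable_sum _ fun i _ => ((ham i).pow_const 2).mul ?_
    exact (by fun_prop : Measurable fun S : ι → Z × ℝ => (S i).2 ^ 2).add
      (hvm.comp (by fun_prop))
  set h : ι → (ι → Z) → ℝ → ENNReal := fun i z e => ENNReal.ofReal (Real.exp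
    ((s * a i z) * e - (s * a i z) ^ 2 * (e ^ 2 + ∫ e, e ^ 2 ∂(k (z i))))) with hh
  have hhm : ∀ i, Measurable (Function.uncurry (h i)) := by
    intro i
    have h1 : Measurable fun p : (ι → Z) × ℝ => a i p.1 := (ha i).comp measurable_fst
    have h2 : Measurable fun p : (ι → Z) × ℝ => ∫ e, e ^ 2 ∂(k (p.1 i)) :=
      hvm.comp ((measurable_pi_apply i).comp measurable_fst)
    simp only [hh, Function.uncurry_def]
    fun_prop
  have hle : ∀ᵐ z ∂(Measure.pi fun _ : ι => ν), ∀ i, ∫⁻ e, h i z e ∂(k (z i)) ≤ 1 := by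
    rw [ae_all_iff]
    intro i
    have h1 : ∀ᵐ z ∂(Measure.pi fun _ : ι => ν), Integrable (fun e => e) (k (z i)) ∧
        Integrable (fun e => e ^ 2) (k (z i)) ∧ ∫ e, e ∂(k (z i)) = 0 :=
      (measurePreserving_eval (fun _ : ι => ν) i).quasiMeasurePreserving.ae
        (hk1.and (hk2.and hk0))
    filter_upwards [h1] with z hz
    exact lintegral_exp_sub_sq_le_one hz.1 hz.2.1 hz.2.2 le_rfl _
  refine le_trans (le_of_eq (lintegral_congr fun S => ?_))
    (lintegral_pi_compProd_prod_le_one hhm hle)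
  simp only [hh]
  rw [← ENNReal.ofReal_prod_of_nonneg fun i _ => (Real.exp_pos _).le, ← Real.exp_sum,
    Finset.sum_sub_distrib, Finset.mul_sum, Finset.mul_sum]
  congr 3
  · exact Finset.sum_congr rfl fun i _ => by ring
  · exact Finset.sum_congr rfl fun i _ => by ring

/-- The conditional variance inherits the exponential moment of the square, by Jensen's inequality. -/
theorem psi2LE_sqrt_integral_sq {ν : Measure Z} [IsProbabilityMeasure ν]
    {k : Kernel Z ℝ} [IsMarkovKernel k] {K : ℝ}
    (hk2 : ∀ᵐ z ∂ν, Integrable (fun e => e ^ 2) (k z))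
    (h : Psi2LE (ν ⊗ₘ k) Prod.snd K) :
    Psi2LE ν (fun z => √(∫ e, e ^ 2 ∂(k z))) K := by
  unfold Psi2LE at *
  have hm : Measurable fun x : Z × ℝ => ENNReal.ofReal (Real.exp (x.2 ^ 2 / K ^ 2)) := by fun_prop
  rw [Measure.lintegral_compProd hm] at h
  refine le_trans (lintegral_mono_ae ?_) h
  have hfin : ∀ᵐ z ∂ν, ∫⁻ e, ENNReal.ofReal (Real.exp (e ^ 2 / K ^ 2)) ∂(k z) < ⊤ :=
    ae_lt_top (Measurable.lintegral_kernel_prod_right' hm)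
      (ne_top_of_le_ne_top (by simp) h)
  filter_upwards [hk2, hfin] with z hz hz'
  rw [Real.sq_sqrt (integral_nonneg fun e => sq_nonneg e)]
  have hE : Integrable (fun e : ℝ => Real.exp (e ^ 2 / K ^ 2)) (k z) := by
    refine ⟨by fun_prop, ?_⟩
    rw [hasFiniteIntegral_iff_ofReal (Eventually.of_forall fun e => (Real.exp_pos _).le)]
    exact hz'
  rw [← ofReal_integral_eq_lintegral_ofReal hE (Eventually.of_forall fun e => (Real.exp_pos _).le)]
  refine ENNReal.ofReal_le_ofReal ?_
  have hJ := convexOn_exp.map_integral_le (μ := k z) (f := fun e : ℝ => e ^ 2 / K ^ 2)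
    Real.continuous_exp.continuousOn isClosed_univ (Eventually.of_forall fun _ => Set.mem_univ _)
    (hz.div_const _) hE
  rwa [integral_div] at hJ

/-- Uniform control of finitely many weighted sums of errors that are centred conditionally on the
design, outside an exponentially small event that does not depend on the sums. -/
theorem measure_pi_compProd_exists_abs_sum_ge_le {ν : Measure Z} [IsProbabilityMeasure ν]
    {k : Kernel Z ℝ} [IsMarkovKernel k] (hk1 : ∀ᵐ z ∂ν, Integrable (fun e => e) (k z))
    (hk2 : ∀ᵐ z ∂ν, Integrable (fun e => e ^ 2) (k z)) (hk0 : ∀ᵐ z ∂ν, ∫ e, e ∂(k z) = 0)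
    {K : ℝ} (hK : 0 < K) (hpsi : Psi2LE (ν ⊗ₘ k) Prod.snd K) [Nonempty ι]
    {J : Type*} [Fintype J] {a : J → ι → (ι → Z) → ℝ} (ha : ∀ j i, Measurable (a j i))
    {t α : ℝ} (ht : 0 ≤ t) (hα : 0 < α) :
    Measure.pi (fun _ : ι => ν ⊗ₘ k) {S | ∃ j, (∀ i, |a j i (fun l => (S l).1)| ≤ α) ∧
      t ≤ |∑ i, a j i (fun l => (S l).1) * (S i).2|} ≤
      Fintype.card J * (2 * ENNReal.ofReal
        (Real.exp (-(t ^ 2 / (8 * α ^ 2 * (Fintype.card ι * K ^ 2)))))) +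
      2 * ENNReal.ofReal ((2 / Real.exp 1) ^ Fintype.card ι) := by
  set b : ℝ := (Fintype.card ι : ℝ) with hb
  have hb0 : 0 < b := by rw [hb]; exact_mod_cast Fintype.card_pos
  -- One half is for the squares of the errors, the other for their conditional variances.
  set V : ℝ := α ^ 2 * (2 * (b * K ^ 2)) with hVd
  have hV : 0 < V := by positivity
  have hvm : Measurable fun z => ∫ e, e ^ 2 ∂(k z) :=
    (StronglyMeasurable.integral_kernel (κ := k) (f := fun e : ℝ => e ^ 2)
      (by fun_prop : Measurable fun e : ℝ => e ^ 2).stronglyMeasurable).measurable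
  set A : J → Set (ι → Z × ℝ) := fun j =>
    {S | t ≤ |∑ i, a j i (fun l => (S l).1) * (S i).2| ∧
      ∑ i, a j i (fun l => (S l).1) ^ 2 * ((S i).2 ^ 2 + ∫ e, e ^ 2 ∂(k (S i).1)) ≤ V}
  set B : Set (ι → Z × ℝ) := {S | b * K ^ 2 ≤ ∑ i, (S i).2 ^ 2}
  set C : Set (ι → Z × ℝ) := {S | b * K ^ 2 ≤ ∑ i, √(∫ e, e ^ 2 ∂(k (S i).1)) ^ 2}
  have hsub : {S : ι → Z × ℝ | ∃ j, (∀ i, |a j i (fun l => (S l).1)| ≤ α) ∧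
      t ≤ |∑ i, a j i (fun l => (S l).1) * (S i).2|} ⊆ (⋃ j, A j) ∪ (B ∪ C) := by
    rintro S ⟨j, hj, hjt⟩
    by_cases hB : S ∈ B
    · exact Or.inr (Or.inl hB)
    by_cases hC : S ∈ C
    · exact Or.inr (Or.inr hC)
    refine Or.inl (Set.mem_iUnion.2 ⟨j, hjt, ?_⟩)
    simp only [B, C, Set.mem_ofPred_eq, not_le] at hB hC
    have hsq : ∀ i, √(∫ e, e ^ 2 ∂(k (S i).1)) ^ 2 = ∫ e, e ^ 2 ∂(k (S i).1) :=
      fun i => Real.sq_sqrt (integral_nonneg fun e => sq_nonneg e)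
    simp_rw [hsq] at hC
    calc ∑ i, a j i (fun l => (S l).1) ^ 2 * ((S i).2 ^ 2 + ∫ e, e ^ 2 ∂(k (S i).1))
        ≤ ∑ i, α ^ 2 * ((S i).2 ^ 2 + ∫ e, e ^ 2 ∂(k (S i).1)) := by
          refine Finset.sum_le_sum fun i _ => mul_le_mul_of_nonneg_right ?_ ?_
          · rw [← sq_abs]; exact pow_le_pow_left₀ (abs_nonneg _) (hj i) 2
          · exact add_nonneg (sq_nonneg _) (integral_nonneg fun e => sq_nonneg e)
      _ = α ^ 2 * (∑ i, (S i).2 ^ 2 + ∑ i, ∫ e, e ^ 2 ∂(k (S i).1)) := by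
          rw [← Finset.mul_sum, Finset.sum_add_distrib]
      _ ≤ V := by rw [hVd]; gcongr; linarith
  refine (measure_mono hsub).trans ((measure_union_le _ _).trans (add_le_add ?_ ?_))
  · refine (measure_iUnion_fintype_le _ _).trans ?_
    refine (Finset.sum_le_card_nsmul Finset.univ _ _ fun j _ =>
      measure_pi_compProd_abs_sum_ge_le hk1 hk2 hk0 (ha j) ht hV).trans (le_of_eq ?_)
    rw [Finset.card_univ, nsmul_eq_mul, hVd]
    congr 5
    ring
  · refine (measure_union_le _ _).trans ?_
    rw [two_mul (ENNReal.ofReal _)]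
    refine add_le_add (measure_pi_sum_sq_gt_le measurable_snd hK hpsi) ?_
    have hps := psi2LE_sqrt_integral_sq hk2 hpsi
    have hps' : Psi2LE (ν ⊗ₘ k) (fun x : Z × ℝ => √(∫ e, e ^ 2 ∂(k x.1))) K := by
      unfold Psi2LE at *
      have hm : Measurable fun z => ENNReal.ofReal (Real.exp (√(∫ e, e ^ 2 ∂(k z)) ^ 2 / K ^ 2)) := by
        fun_prop
      rw [Measure.lintegral_compProd (f := fun x : Z × ℝ => ENNReal.ofReal
        (Real.exp (√(∫ e, e ^ 2 ∂(k x.1)) ^ 2 / K ^ 2))) (hm.comp measurable_fst)]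
      simpa using hps
    exact measure_pi_sum_sq_gt_le (hvm.sqrt.comp measurable_fst) hK hps'

end Conditional

/-! ### Norms -/

section Norms

variable {p : ℕ}

/-- The Euclidean norm of a vector. -/
def l2 (v : Fin p → ℝ) : ℝ := √(∑ j, v j ^ 2)

theorem l2_nonneg (v : Fin p → ℝ) : 0 ≤ l2 v := Real.sqrt_nonneg _

theorem l2_sq (v : Fin p → ℝ) : l2 v ^ 2 = ∑ j, v j ^ 2 :=
  Real.sq_sqrt (Finset.sum_nonneg fun _ _ => sq_nonneg _)

theorem l1_nonneg (v : Fin p → ℝ) : 0 ≤ l1 v := Finset.sum_nonneg fun _ _ => abs_nonneg _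

theorem l2_le_l1 (v : Fin p → ℝ) : l2 v ≤ l1 v := by
  unfold l2
  rw [Real.sqrt_le_left (l1_nonneg v)]
  calc ∑ j, v j ^ 2 = ∑ j, |v j| * |v j| := Finset.sum_congr rfl fun j _ => by
        rw [abs_mul_abs_self, sq]
    _ ≤ ∑ j, |v j| * l1 v := by
        gcongr with j
        exact Finset.single_le_sum (f := fun j => |v j|) (fun _ _ => abs_nonneg _)
          (Finset.mem_univ j)
    _ = l1 v ^ 2 := by rw [← Finset.sum_mul, sq]; rfl

theorem l1_sub_le (u v : Fin p → ℝ) : l1 (u - v) ≤ l1 u + l1 v := by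
  unfold l1
  rw [← Finset.sum_add_distrib]
  exact Finset.sum_le_sum fun j _ => abs_sub _ _

theorem eq_zero_of_l2_eq_zero {v : Fin p → ℝ} (h : l2 v = 0) : v = 0 := by
  have h1 : ∑ j, v j ^ 2 = 0 := by rw [← l2_sq, h]; simp
  rw [Finset.sum_eq_zero_iff_of_nonneg fun _ _ => sq_nonneg _] at h1
  ext j
  simpa using h1 j (Finset.mem_univ j)

/-- Hölder's inequality between the supremum and the `ℓ₁` norm. -/
theorem abs_dotProduct_le {x v : Fin p → ℝ} {A : ℝ} (h : ∀ j, |x j| ≤ A) :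
    |x ⬝ᵥ v| ≤ A * l1 v := by
  unfold l1 dotProduct
  rw [Finset.mul_sum]
  refine (Finset.abs_sum_le_sum_abs _ _).trans (Finset.sum_le_sum fun j _ => ?_)
  rw [abs_mul]
  exact mul_le_mul_of_nonneg_right (h j) (abs_nonneg _)

end Norms

/-! ### Moments of a unit under the model -/

section Measurability

variable {p : ℕ}

theorem measurable_treat : Measurable (treat : FullUnit p → Bool) :=
  measurable_fst.comp measurable_snd

theorem measurable_wt : Measurable (wt : FullUnit p → ℝ) :=
  Measurable.ite (measurable_treat (measurableSet_singleton true)) measurable_const measurable_const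

theorem measurable_y1 : Measurable (y1 : FullUnit p → ℝ) :=
  measurable_snd.comp (measurable_snd.comp measurable_snd)

theorem measurable_dotProduct_const (u : Fin p → ℝ) :
    Measurable fun x : Fin p → ℝ => x ⬝ᵥ u := by
  unfold dotProduct; fun_prop

theorem measurable_cov_dot (u : Fin p → ℝ) : Measurable fun o : FullUnit p => cov o ⬝ᵥ u :=
  (measurable_dotProduct_const u).comp measurable_cov

theorem measurable_cov_apply (j : Fin p) : Measurable fun o : FullUnit p => cov o j :=
  (measurable_pi_apply j).comp measurable_cov

theorem measurable_eps (β : Fin p → ℝ) : Measurable (eps β) :=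
  measurable_y1.sub (measurable_cov_dot β)

theorem measurable_covTreat : Measurable (covTreat : FullUnit p → CovTreat p) :=
  measurable_cov.prodMk measurable_treat

theorem measurable_propensity (θ : Fin p → ℝ) : Measurable (propensity θ) := by
  have := measurable_dotProduct_const θ
  unfold propensity; fun_prop

theorem measurable_vRes (θ : Fin p → ℝ) : Measurable (vRes θ) :=
  measurable_wt.sub ((measurable_propensity θ).comp measurable_cov)

theorem wt_nonneg (o : FullUnit p) : 0 ≤ wt o := by unfold wt; split_ifs <;> norm_num

theorem wt_le_one (o : FullUnit p) : wt o ≤ 1 := by unfold wt; split_ifs <;> norm_num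

theorem wt_sq (o : FullUnit p) : wt o ^ 2 = wt o := by unfold wt; split_ifs <;> norm_num

theorem propensity_pos (θ x : Fin p → ℝ) : 0 < propensity θ x := by
  unfold propensity; positivity

theorem propensity_lt_one (θ x : Fin p → ℝ) : propensity θ x < 1 := by
  unfold propensity
  rw [div_lt_one (by positivity)]
  have := Real.exp_pos (-(x ⬝ᵥ θ)); linarith

theorem propensity_mul_q (θ x : Fin p → ℝ) : propensity θ x * q (x ⬝ᵥ θ) = 1 := by
  unfold propensity q
  have : 0 < 1 + Real.exp (-(x ⬝ᵥ θ)) := by positivity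
  field_simp

end Measurability

section Psi2

variable {Ω : Type*} [MeasurableSpace Ω] {P : Measure Ω} {Y : Ω → ℝ} {K : ℝ}

theorem Psi2LE.integrable_exp (hY : Measurable Y) (h : Psi2LE P Y K) :
    Integrable (fun ω => Real.exp (Y ω ^ 2 / K ^ 2)) P := by
  refine ⟨by fun_prop, ?_⟩
  rw [hasFiniteIntegral_iff_ofReal (Eventually.of_forall fun e => (Real.exp_pos _).le)]
  exact lt_of_le_of_lt h (by simp)

theorem Psi2LE.integral_exp_le (hY : Measurable Y) (h : Psi2LE P Y K) :
    ∫ ω, Real.exp (Y ω ^ 2 / K ^ 2) ∂P ≤ 2 := by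
  rw [integral_eq_lintegral_of_nonneg_ae (Eventually.of_forall fun e => (Real.exp_pos _).le)
    (by fun_prop)]
  exact ENNReal.toReal_le_of_le_ofReal (by norm_num) (by simpa [Psi2LE] using h)

theorem Psi2LE.integrable_sq (hY : Measurable Y) (hK : 0 < K) (h : Psi2LE P Y K) :
    Integrable (fun ω => Y ω ^ 2) P := by
  refine ((h.integrable_exp hY).const_mul (K ^ 2)).mono' (by fun_prop)
    (Eventually.of_forall fun ω => ?_)
  rw [Real.norm_of_nonneg (sq_nonneg _)]
  have h1 := Real.add_one_le_exp (Y ω ^ 2 / K ^ 2)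
  have h2 : K ^ 2 * (Y ω ^ 2 / K ^ 2) = Y ω ^ 2 := by field_simp
  nlinarith [sq_pos_of_pos hK]

theorem Psi2LE.integrable [IsProbabilityMeasure P] (hY : Measurable Y) (hK : 0 < K)
    (h : Psi2LE P Y K) : Integrable Y P := by
  refine ((h.integrable_sq hY hK).add (integrable_const 1)).mono' (by fun_prop)
    (Eventually.of_forall fun ω => ?_)
  simp only [Real.norm_eq_abs, Pi.add_apply]
  nlinarith [sq_nonneg (|Y ω| - 1), sq_abs (Y ω)]

theorem Psi2LE.integral_sq_le [IsProbabilityMeasure P] (hY : Measurable Y) (hK : 0 < K)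
    (h : Psi2LE P Y K) : ∫ ω, Y ω ^ 2 ∂P ≤ K ^ 2 := by
  have h1 : ∫ ω, Y ω ^ 2 ∂P ≤ ∫ ω, K ^ 2 * (Real.exp (Y ω ^ 2 / K ^ 2) - 1) ∂P := by
    refine integral_mono (h.integrable_sq hY hK)
      (((h.integrable_exp hY).sub (integrable_const 1)).const_mul _) fun ω => ?_
    have h1 := Real.add_one_le_exp (Y ω ^ 2 / K ^ 2)
    have h2 : K ^ 2 * (Y ω ^ 2 / K ^ 2) = Y ω ^ 2 := by field_simp
    simp only
    nlinarith [sq_pos_of_pos hK]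
  refine h1.trans ?_
  rw [integral_const_mul, integral_sub (h.integrable_exp hY) (integrable_const 1)]
  have := h.integral_exp_le hY
  simp only [integral_const, probReal_univ, smul_eq_mul, mul_one]
  nlinarith [sq_pos_of_pos hK]

theorem Psi2LE.integrable_pow_four (hY : Measurable Y) (hK : 0 < K) (h : Psi2LE P Y K) :
    Integrable (fun ω => Y ω ^ 4) P := by
  refine ((h.integrable_exp hY).const_mul (2 * K ^ 4)).mono' (by fun_prop)
    (Eventually.of_forall fun ω => ?_)
  rw [Real.norm_of_nonneg (by positivity)]
  have h1 := Real.quadratic_le_exp_of_nonneg (x := Y ω ^ 2 / K ^ 2) (by positivity)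
  have h2 : 2 * K ^ 4 * ((Y ω ^ 2 / K ^ 2) ^ 2 / 2) = Y ω ^ 4 := by field_simp
  have h3 : 0 ≤ Y ω ^ 2 / K ^ 2 := by positivity
  have h4 : 0 < 2 * K ^ 4 := by positivity
  nlinarith

theorem Psi2LE.integral_pow_four_le (hY : Measurable Y) (hK : 0 < K) (h : Psi2LE P Y K) :
    ∫ ω, Y ω ^ 4 ∂P ≤ 4 * K ^ 4 := by
  have h1 : ∫ ω, Y ω ^ 4 ∂P ≤ ∫ ω, 2 * K ^ 4 * Real.exp (Y ω ^ 2 / K ^ 2) ∂P := by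
    refine integral_mono (h.integrable_pow_four hY hK) ((h.integrable_exp hY).const_mul _)
      fun ω => ?_
    have h1 := Real.quadratic_le_exp_of_nonneg (x := Y ω ^ 2 / K ^ 2) (by positivity)
    have h2 : 2 * K ^ 4 * ((Y ω ^ 2 / K ^ 2) ^ 2 / 2) = Y ω ^ 4 := by field_simp
    have h3 : 0 ≤ Y ω ^ 2 / K ^ 2 := by positivity
    have h4 : 0 < 2 * K ^ 4 := by positivity
    simp only
    nlinarith
  refine h1.trans ?_
  rw [integral_const_mul]
  have := h.integral_exp_le hY
  nlinarith [pow_pos hK 4]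

end Psi2

/-- A bound on all coordinates of the covariates; the summand `1` makes it at least one. -/
def Bounds.radius (B : Bounds) : ℝ := max |B.lo| |B.hi| + 1

theorem Bounds.one_le_radius (B : Bounds) : 1 ≤ B.radius := by
  have : 0 ≤ max |B.lo| |B.hi| := (abs_nonneg _).trans (le_max_left _ _)
  unfold Bounds.radius; linarith

section Model

variable {B : Bounds} {p : ℕ} {P : Measure (FullUnit p)} [IsProbabilityMeasure P]
  {θ β : Fin p → ℝ}

theorem Model.ae_abs_cov_le (h : Model B P θ β) : ∀ᵐ o ∂P, ∀ j, |cov o j| ≤ B.radius := by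
  filter_upwards [h.cov_mem] with o ho j
  have h1 := abs_le_max_abs_abs (ho j).1 (ho j).2
  unfold Bounds.radius; linarith

/-- A function of the unit that is bounded as long as the covariates are. -/
theorem Model.integrable_of_bound (h : Model B P θ β) {f : FullUnit p → ℝ} (hf : Measurable f)
    {c : ℝ} (hc : ∀ o, (∀ j, |cov o j| ≤ B.radius) → |f o| ≤ c) : Integrable f P :=
  Integrable.of_bound hf.aestronglyMeasurable c (h.ae_abs_cov_le.mono fun o ho => hc o ho)

theorem Model.integrable_cov_dot (h : Model B P θ β) (u : Fin p → ℝ) :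
    Integrable (fun o => cov o ⬝ᵥ u) P :=
  h.integrable_of_bound (measurable_cov_dot u) fun _ ho => abs_dotProduct_le ho

theorem measurable_sigmaX_comp {g : (Fin p → ℝ) → ℝ} (hg : Measurable g) :
    Measurable[sigmaX p] fun o : FullUnit p => g (cov o) :=
  hg.comp (comap_measurable cov)

/-- The treatment may be replaced by the propensity in expectations against functions of `X`. -/
theorem Model.integral_wt_mul (h : Model B P θ β) {g : (Fin p → ℝ) → ℝ} (hg : Measurable g)
    (hi : Integrable (fun o => g (cov o)) P) :
    ∫ o, wt o * g (cov o) ∂P = ∫ o, propensity θ (cov o) * g (cov o) ∂P := by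
  have hw : Integrable (wt : FullUnit p → ℝ) P :=
    Integrable.of_bound measurable_wt.aestronglyMeasurable 1 (Eventually.of_forall fun o => by
      rw [Real.norm_of_nonneg (wt_nonneg o)]; exact wt_le_one o)
  have hwg : Integrable (wt * fun o => g (cov o)) P :=
    hi.bdd_mul (c := 1) measurable_wt.aestronglyMeasurable (Eventually.of_forall fun o => by
      rw [Real.norm_of_nonneg (wt_nonneg o)]; exact wt_le_one o)
  have h1 := condExp_mul_of_stronglyMeasurable_right (m := sigmaX p) (μ := P)
    (measurable_sigmaX_comp hg).stronglyMeasurable hwg hw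
  rw [← integral_condExp (sigmaX_le p) (f := fun o => wt o * g (cov o))]
  refine integral_congr_ae ?_
  refine h1.trans ?_
  filter_upwards [h.treatment] with o ho
  simp [ho]

/-- The balancing equations hold in the population. -/
theorem Model.integral_one_sub_wt_mul_q (h : Model B P θ β) {g : (Fin p → ℝ) → ℝ}
    (hg : Measurable g) {c : ℝ} (hc : ∀ x : Fin p → ℝ, (∀ j, |x j| ≤ B.radius) → |g x| ≤ c) :
    ∫ o, (1 - wt o * q (cov o ⬝ᵥ θ)) * g (cov o) ∂P = 0 := by
  have hd := measurable_dotProduct_const θ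
  have hqm : Measurable fun x : Fin p → ℝ => q (x ⬝ᵥ θ) * g x := by unfold q; fun_prop
  have hqb : Integrable (fun o => q (cov o ⬝ᵥ θ) * g (cov o)) P := by
    refine h.integrable_of_bound (c := (1 + Real.exp (B.radius * l1 θ)) * c)
      (hqm.comp measurable_cov) fun o ho => ?_
    rw [abs_mul]
    refine mul_le_mul ?_ (hc _ ho) (abs_nonneg _) (by positivity)
    unfold q
    rw [abs_of_pos (by positivity)]
    gcongr
    exact (neg_le_abs _).trans (abs_dotProduct_le ho)
  have hgi : Integrable (fun o => g (cov o)) P :=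
    h.integrable_of_bound (hg.comp measurable_cov) fun o ho => hc _ ho
  have h1 := h.integral_wt_mul hqm hqb
  have hwi : Integrable (fun o => wt o * (q (cov o ⬝ᵥ θ) * g (cov o))) P :=
    hqb.bdd_mul (c := 1) measurable_wt.aestronglyMeasurable (Eventually.of_forall fun o => by
      rw [Real.norm_of_nonneg (wt_nonneg o)]; exact wt_le_one o)
  have h2 : ∀ o : FullUnit p, (1 - wt o * q (cov o ⬝ᵥ θ)) * g (cov o) =
      g (cov o) - wt o * (q (cov o ⬝ᵥ θ) * g (cov o)) := fun o => by ring
  simp_rw [h2]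
  rw [integral_sub hgi hwi, h1, sub_eq_zero]
  refine integral_congr_ae (Eventually.of_forall fun o => ?_)
  simp only
  rw [← mul_assoc, propensity_mul_q, one_mul]

/-- The lower bound on the spectrum of `E[XX']` as a bound on quadratic forms. -/
theorem Model.eigMin_mul_le (h : Model B P θ β) (v : Fin p → ℝ) :
    B.eigMin * l2 v ^ 2 ≤ ∫ o, (cov o ⬝ᵥ v) ^ 2 ∂P := by
  have hint : ∀ j k, Integrable (fun o => cov o j * cov o k) P := fun j k =>
    h.integrable_of_bound (c := B.radius * B.radius)
      ((measurable_cov_apply j).mul (measurable_cov_apply k)) fun o ho => by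
        rw [abs_mul]
        exact mul_le_mul (ho j) (ho k) (abs_nonneg _) (by linarith [B.one_le_radius])
  have hH : (secondMoment P).IsHermitian := by
    ext j k
    simp [secondMoment, mul_comm]
  have hS : (secondMoment P - B.eigMin • (1 : Matrix (Fin p) (Fin p) ℝ)).PosSemidef := by
    rw [Matrix.posSemidef_iff_isHermitian_and_spectrum_nonneg]
    refine ⟨hH.sub (by simp [Matrix.IsHermitian]), ?_⟩
    rintro x hx
    have h1 : x + B.eigMin ∈ spectrum ℝ (secondMoment P) := by
      rw [spectrum.mem_iff] at hx ⊢
      convert! hx using 2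
      rw [Algebra.algebraMap_eq_smul_one, Algebra.algebraMap_eq_smul_one, add_smul]
      abel
    have h2 := (h.eigenvalues h1).1
    simp only [Set.mem_ofPred_eq]
    linarith
  have h3 := hS.dotProduct_mulVec_nonneg v
  rw [Matrix.sub_mulVec, dotProduct_sub, Matrix.smul_mulVec, Matrix.one_mulVec,
    dotProduct_smul, sub_nonneg] at h3
  have h4 : star v ⬝ᵥ v = l2 v ^ 2 := by
    rw [l2_sq]; simp [dotProduct, sq]
  rw [h4, smul_eq_mul] at h3
  refine h3.trans (le_of_eq ?_)
  have h5 : ∀ o : FullUnit p, (cov o ⬝ᵥ v) ^ 2 = ∑ j, ∑ k, v j * (cov o j * cov o k) * v k := by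
    intro o
    rw [sq, dotProduct, Finset.sum_mul_sum]
    exact Finset.sum_congr rfl fun j _ => Finset.sum_congr rfl fun k _ => by ring
  simp_rw [h5]
  rw [integral_finsetSum _ fun j _ => integrable_finsetSum _ fun k _ =>
    ((hint j k).const_mul _).mul_const _]
  simp only [dotProduct, Matrix.mulVec, star_trivial]
  refine Finset.sum_congr rfl fun j _ => ?_
  rw [integral_finsetSum _ fun k _ => ((hint j k).const_mul _).mul_const _, Finset.mul_sum]
  refine Finset.sum_congr rfl fun k _ => ?_
  rw [integral_mul_const, integral_const_mul]
  simp [secondMoment, mul_assoc]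

theorem Model.psi2LE_cov_dot (h : Model B P θ β) {u : Fin p → ℝ} (hu : 0 < l2 u) :
    Psi2LE P (fun o => cov o ⬝ᵥ u) (B.KX * l2 u) := by
  have h1 := h.cov_subgaussian (fun j => u j / l2 u) (by
    simp_rw [div_pow]
    rw [← Finset.sum_div, ← l2_sq]
    field_simp)
  unfold Psi2LE at *
  refine le_trans (le_of_eq (lintegral_congr fun o => ?_)) h1
  congr 2
  have h2 : cov o ⬝ᵥ (fun j => u j / l2 u) = (cov o ⬝ᵥ u) / l2 u := by
    simp [dotProduct, Finset.sum_div, mul_div_assoc]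
  simp only
  rw [h2, div_pow, mul_pow, div_div, mul_comm (B.KX ^ 2)]

theorem Model.integral_cov_dot_pow_four_le (h : Model B P θ β) (u : Fin p → ℝ) :
    ∫ o, (cov o ⬝ᵥ u) ^ 4 ∂P ≤ 4 * B.KX ^ 4 * l2 u ^ 4 := by
  rcases (l2_nonneg u).eq_or_lt with h0 | h0
  · have := eq_zero_of_l2_eq_zero h0.symm
    subst this
    rw [← h0]; simp
  · rw [mul_assoc, ← mul_pow]
    exact (h.psi2LE_cov_dot h0).integral_pow_four_le (measurable_cov_dot u) (mul_pos B.KX_pos h0)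

theorem Model.integrable_cov_dot_pow (h : Model B P θ β) (u : Fin p → ℝ) (k : ℕ) :
    Integrable (fun o => (cov o ⬝ᵥ u) ^ k) P :=
  h.integrable_of_bound (c := (B.radius * l1 u) ^ k) ((measurable_cov_dot u).pow_const k)
    fun o ho => by
      rw [abs_pow]; exact pow_le_pow_left₀ (abs_nonneg _) (abs_dotProduct_le ho) k

/-- A lower bound on the propensity, `1 / (1 + exp (A r))`. -/
def Bounds.minPropensity (B : Bounds) : ℝ := 1 / (1 + Real.exp (B.radius * B.r))

theorem Bounds.minPropensity_pos (B : Bounds) : 0 < B.minPropensity := by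
  unfold Bounds.minPropensity; positivity

theorem Model.minPropensity_le (h : Model B P θ β) {x : Fin p → ℝ}
    (hx : ∀ j, |x j| ≤ B.radius) : B.minPropensity ≤ propensity θ x := by
  unfold Bounds.minPropensity propensity
  gcongr
  refine (neg_le_abs _).trans ((abs_dotProduct_le hx).trans ?_)
  exact mul_le_mul_of_nonneg_left h.theta_mem (by linarith [B.one_le_radius])

theorem Model.le_integral_wt_mul_sq (h : Model B P θ β) (v : Fin p → ℝ) :
    B.minPropensity * B.eigMin * l2 v ^ 2 ≤ ∫ o, wt o * (cov o ⬝ᵥ v) ^ 2 ∂P := by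
  have hi := h.integrable_cov_dot_pow v 2
  rw [h.integral_wt_mul (g := fun x => (x ⬝ᵥ v) ^ 2)
    ((measurable_dotProduct_const v).pow_const 2) hi]
  calc B.minPropensity * B.eigMin * l2 v ^ 2
      ≤ B.minPropensity * ∫ o, (cov o ⬝ᵥ v) ^ 2 ∂P := by
        rw [mul_assoc]
        exact mul_le_mul_of_nonneg_left (h.eigMin_mul_le v) B.minPropensity_pos.le
    _ = ∫ o, B.minPropensity * (cov o ⬝ᵥ v) ^ 2 ∂P := (integral_const_mul _ _).symm
    _ ≤ ∫ o, propensity θ (cov o) * (cov o ⬝ᵥ v) ^ 2 ∂P := by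
        refine integral_mono_ae (hi.const_mul _) ?_ ?_
        · refine hi.bdd_mul (c := 1)
            ((measurable_propensity θ).comp measurable_cov).aestronglyMeasurable
            (Eventually.of_forall fun o => ?_)
          rw [Real.norm_of_nonneg (propensity_pos _ _).le]
          exact (propensity_lt_one _ _).le
        · filter_upwards [h.ae_abs_cov_le] with o ho
          exact mul_le_mul_of_nonneg_right (h.minPropensity_le ho) (sq_nonneg _)

/-! ### The outcome error is centred given covariates and treatment -/

theorem Model.integrable_eps (h : Model B P θ β) : Integrable (eps β) P :=
  h.eps_subgaussian.integrable (measurable_eps β) B.Keps_pos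

theorem Model.condExp_eps (h : Model B P θ β) : P[eps β | sigmaX p] =ᵐ[P] 0 := by
  have hx := h.integrable_cov_dot β
  have hy : Integrable (y1 : FullUnit p → ℝ) P := by
    have := h.integrable_eps.add hx
    refine this.congr (Eventually.of_forall fun o => ?_)
    simp [eps]
  have h1 : (eps β : FullUnit p → ℝ) = y1 - fun o => cov o ⬝ᵥ β := rfl
  rw [h1]
  have h2 : P[fun o : FullUnit p => cov o ⬝ᵥ β | sigmaX p] = fun o => cov o ⬝ᵥ β :=
    condExp_of_stronglyMeasurable (sigmaX_le p)
      (measurable_sigmaX_comp (measurable_dotProduct_const β)).stronglyMeasurable hx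
  filter_upwards [condExp_sub hy hx (sigmaX p), h.outcome] with o h3 h4
  rw [h3, Pi.sub_apply, h4, h2]; simp

theorem Model.setIntegral_eps (h : Model B P θ β) {s : Set (Fin p → ℝ)} (hs : MeasurableSet s) :
    ∫ o in cov ⁻¹' s, eps β o ∂P = 0 := by
  rw [← setIntegral_condExp (sigmaX_le p) h.integrable_eps ⟨s, hs, rfl⟩]
  rw [setIntegral_congr_ae (g := fun _ => 0) ((sigmaX_le p) _ ⟨s, hs, rfl⟩)
    (h.condExp_eps.mono fun o ho _ => ho)]
  simp

/-- Since the propensity lies strictly between zero and one, the sign of `v = W - e(X)` determines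
the treatment. -/
theorem treated_eq_preimage (θ : Fin p → ℝ) :
    {o : FullUnit p | treat o = true} = vRes θ ⁻¹' Set.Ioi 0 := by
  ext o
  have h1 := propensity_pos θ (cov o)
  have h2 := propensity_lt_one θ (cov o)
  simp only [Set.mem_ofPred_eq, Set.mem_preimage, Set.mem_Ioi, vRes, wt]
  by_cases h : treat o = true
  · simp [h, h2]
  · simp [h, h1.le]

/-- Conditionally on `X`, the error and the treatment are independent, so on the treated units with
covariates in `s` the error has the same law as on all such units reweighted by the propensity. -/
theorem Model.map_eps_treated (h : Model B P θ β) {s : Set (Fin p → ℝ)} (hs : MeasurableSet s) :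
    (P.restrict ({o | treat o = true} ∩ cov ⁻¹' s)).map (eps β) =
      ((P.restrict (cov ⁻¹' s)).withDensity
        fun o => ENNReal.ofReal (propensity θ (cov o))).map (eps β) := by
  have hT : MeasurableSet {o : FullUnit p | treat o = true} :=
    measurable_treat (measurableSet_singleton true)
  have hD : MeasurableSet[sigmaX p] (cov ⁻¹' s : Set (FullUnit p)) := ⟨s, hs, rfl⟩
  have hpm : Measurable fun o : FullUnit p => propensity θ (cov o) :=
    (measurable_propensity θ).comp measurable_cov
  refine Measure.ext fun t ht => ?_
  have htm := measurable_eps β ht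
  rw [Measure.map_apply (measurable_eps β) ht, Measure.map_apply (measurable_eps β) ht,
    Measure.restrict_apply htm, withDensity_apply _ htm, Measure.restrict_restrict htm]
  have hci := (condIndepFun_iff_condExp_inter_preimage_eq_mul (measurable_eps β)
    (measurable_vRes θ)).1 h.unconfounded t (Set.Ioi 0) ht measurableSet_Ioi
  rw [← treated_eq_preimage] at hci
  have hwt : (Set.indicator {o : FullUnit p | treat o = true} fun _ => (1 : ℝ)) = wt := by
    ext o
    simp [Set.indicator_apply, wt]
  rw [hwt] at hci
  have hind : Integrable ((eps β ⁻¹' t).indicator fun _ => (1 : ℝ)) P :=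
    (integrable_const 1).indicator htm
  have hprod : Integrable (((eps β ⁻¹' t).indicator fun _ => (1 : ℝ)) *
      fun o => propensity θ (cov o)) P := by
    refine hind.mul_bdd (c := 1) hpm.aestronglyMeasurable (Eventually.of_forall fun o => ?_)
    rw [Real.norm_of_nonneg (propensity_pos _ _).le]
    exact (propensity_lt_one _ _).le
  have hpull := condExp_mul_of_stronglyMeasurable_right (m := sigmaX p) (μ := P)
    (measurable_sigmaX_comp (measurable_propensity θ)).stronglyMeasurable hprod hind
  have key : ∫ o in cov ⁻¹' s, (eps β ⁻¹' t ∩ {o | treat o = true}).indicator (fun _ => (1 : ℝ)) o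
      ∂P = ∫ o in cov ⁻¹' s, (eps β ⁻¹' t).indicator (fun _ => (1 : ℝ)) o *
        propensity θ (cov o) ∂P := by
    rw [← setIntegral_condExp (sigmaX_le p) ((integrable_const 1).indicator (htm.inter hT)) hD]
    have h2 := setIntegral_condExp (sigmaX_le p) hprod hD
    simp only [Pi.mul_apply] at h2
    rw [← h2]
    refine setIntegral_congr_ae (sigmaX_le p _ hD) ?_
    filter_upwards [hci, hpull, h.treatment] with o h3 h4 h5 _
    rw [h3, h4, h5]; rfl
  have hl : ∫ o in cov ⁻¹' s, (eps β ⁻¹' t ∩ {o | treat o = true}).indicator (fun _ => (1 : ℝ)) o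
      ∂P = P.real (eps β ⁻¹' t ∩ ({o | treat o = true} ∩ cov ⁻¹' s)) := by
    rw [integral_indicator_const _ (htm.inter hT), smul_eq_mul, mul_one,
      measureReal_restrict_apply (htm.inter hT), Set.inter_assoc]
  have hr : ∫ o in cov ⁻¹' s, (eps β ⁻¹' t).indicator (fun _ => (1 : ℝ)) o *
        propensity θ (cov o) ∂P = ∫ o in eps β ⁻¹' t ∩ cov ⁻¹' s, propensity θ (cov o) ∂P := by
    have : ∀ o : FullUnit p, (eps β ⁻¹' t).indicator (fun _ => (1 : ℝ)) o * propensity θ (cov o) =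
        (eps β ⁻¹' t).indicator (fun o => propensity θ (cov o)) o := by
      intro o
      by_cases ho : o ∈ eps β ⁻¹' t <;> simp [ho]
    simp_rw [this]
    rw [integral_indicator htm, Measure.restrict_restrict htm]
  rw [hl, hr] at key
  have hpi : Integrable (fun o => propensity θ (cov o)) P :=
    Integrable.of_bound hpm.aestronglyMeasurable 1 (Eventually.of_forall fun o => by
      rw [Real.norm_of_nonneg (propensity_pos _ _).le]; exact (propensity_lt_one _ _).le)
  rw [← ofReal_integral_eq_lintegral_ofReal hpi.integrableOn
    (Eventually.of_forall fun o => (propensity_pos _ _).le), ← key, ofReal_measureReal]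

theorem Model.setIntegral_eps_treated (h : Model B P θ β) {s : Set (Fin p → ℝ)}
    (hs : MeasurableSet s) :
    ∫ o in {o | treat o = true} ∩ cov ⁻¹' s, eps β o ∂P = 0 := by
  have hpm : Measurable fun o : FullUnit p => propensity θ (cov o) :=
    (measurable_propensity θ).comp measurable_cov
  have hD : MeasurableSet[sigmaX p] (cov ⁻¹' s : Set (FullUnit p)) := ⟨s, hs, rfl⟩
  have h1 := congrArg (fun μ : Measure ℝ => ∫ e, e ∂μ) (h.map_eps_treated hs)
  rw [integral_map (measurable_eps β).aemeasurable (by fun_prop),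
    integral_map (measurable_eps β).aemeasurable (by fun_prop),
    integral_withDensity_eq_integral_toReal_smul (by fun_prop)
      (Eventually.of_forall fun o => ENNReal.ofReal_lt_top)] at h1
  rw [h1]
  have hprod : Integrable ((fun o => propensity θ (cov o)) * eps β) P := by
    refine h.integrable_eps.bdd_mul (c := 1) hpm.aestronglyMeasurable
      (Eventually.of_forall fun o => ?_)
    rw [Real.norm_of_nonneg (propensity_pos _ _).le]
    exact (propensity_lt_one _ _).le
  have h2 := setIntegral_condExp (sigmaX_le p) hprod hD
  have hpull := condExp_mul_of_stronglyMeasurable_left (m := sigmaX p) (μ := P)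
    (measurable_sigmaX_comp (measurable_propensity θ)).stronglyMeasurable hprod h.integrable_eps
  have h3 : ∀ o : FullUnit p, (ENNReal.ofReal (propensity θ (cov o))).toReal • eps β o =
      ((fun o => propensity θ (cov o)) * eps β) o := fun o => by
    rw [ENNReal.toReal_ofReal (propensity_pos _ _).le]; rfl
  simp_rw [h3]
  rw [← h2, setIntegral_congr_ae (g := fun _ => 0) ((sigmaX_le p) _ hD)]
  · simp
  · filter_upwards [hpull, h.condExp_eps] with o h4 h5 _
    rw [h4, Pi.mul_apply, h5]; simp

/-- The error is centred given covariates and treatment; treated and untreated units are handled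
separately. -/
theorem Model.setIntegral_eps_covTreat (h : Model B P θ β) {s : Set (CovTreat p)}
    (hs : MeasurableSet s) : ∫ o in covTreat ⁻¹' s, eps β o ∂P = 0 := by
  set s1 : Set (Fin p → ℝ) := {x | (x, true) ∈ s}
  set s0 : Set (Fin p → ℝ) := {x | (x, false) ∈ s}
  have hs1 : MeasurableSet s1 := measurable_prodMk_right hs
  have hs0 : MeasurableSet s0 := measurable_prodMk_right hs
  have hT : MeasurableSet {o : FullUnit p | treat o = true} :=
    measurable_treat (measurableSet_singleton true)
  have h1 := integral_inter_add_sdiff (μ := P) (s := cov ⁻¹' s0) hT h.integrable_eps.integrableOn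
  rw [h.setIntegral_eps hs0, Set.inter_comm, h.setIntegral_eps_treated hs0, zero_add] at h1
  have h2 := integral_inter_add_sdiff (μ := P) (s := covTreat ⁻¹' s) hT
    h.integrable_eps.integrableOn
  have h3 : covTreat ⁻¹' s ∩ {o : FullUnit p | treat o = true} =
      {o | treat o = true} ∩ cov ⁻¹' s1 := by
    ext o
    simp only [covTreat, Set.mem_inter_iff, Set.mem_preimage, Set.mem_ofPred_eq, s1]
    constructor
    · rintro ⟨h, h'⟩; rw [h'] at h; exact ⟨h', h⟩
    · rintro ⟨h, h'⟩; rw [h]; exact ⟨h', rfl⟩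
  have h4 : covTreat ⁻¹' s \ {o : FullUnit p | treat o = true} =
      cov ⁻¹' s0 \ {o | treat o = true} := by
    ext o
    simp only [covTreat, Set.mem_sdiff, Set.mem_preimage, Set.mem_ofPred_eq, s0, Bool.not_eq_true]
    constructor
    · rintro ⟨h, h'⟩; rw [h'] at h; exact ⟨h, h'⟩
    · rintro ⟨h, h'⟩; rw [h']; exact ⟨h, rfl⟩
  rw [h3, h4, h.setIntegral_eps_treated hs1, h1, zero_add] at h2
  exact h2.symm

/-- Almost every conditional law of the error given `(X, W)` is centred and has a second moment. -/
theorem Model.ae_condDistrib_eps (h : Model B P θ β) :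
    ∀ᵐ z ∂(P.map covTreat), Integrable (fun e => e) (condDistrib (eps β) covTreat P z) ∧
      Integrable (fun e => e ^ 2) (condDistrib (eps β) covTreat P z) ∧
      ∫ e, e ∂(condDistrib (eps β) covTreat P z) = 0 := by
  set k := condDistrib (eps β) covTreat P with hk
  have hprob : IsProbabilityMeasure (P.map covTreat) :=
    Measure.isProbabilityMeasure_map measurable_covTreat.aemeasurable
  have hcomp : (P.map covTreat) ⊗ₘ k = P.map fun o => (covTreat o, eps β o) :=
    compProd_map_condDistrib (measurable_eps β).aemeasurable
  have hpm : Measurable fun o : FullUnit p => (covTreat o, eps β o) :=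
    measurable_covTreat.prodMk (measurable_eps β)
  have hi1 : Integrable (fun x : CovTreat p × ℝ => x.2) ((P.map covTreat) ⊗ₘ k) := by
    rw [hcomp, integrable_map_measure (by fun_prop) hpm.aemeasurable]
    exact h.integrable_eps
  have hi2 : Integrable (fun x : CovTreat p × ℝ => x.2 ^ 2) ((P.map covTreat) ⊗ₘ k) := by
    rw [hcomp, integrable_map_measure (by fun_prop) hpm.aemeasurable]
    exact h.eps_subgaussian.integrable_sq (measurable_eps β) B.Keps_pos
  have h1 := ((Measure.integrable_compProd_iff hi1.1).1 hi1).1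
  have h2 := ((Measure.integrable_compProd_iff hi2.1).1 hi2).1
  have h0 : (fun z => ∫ e, e ∂(k z)) =ᵐ[P.map covTreat] 0 := by
    have hint : Integrable (fun z => ∫ e, e ∂(k z)) (P.map covTreat) := by
      refine (((Measure.integrable_compProd_iff hi1.1).1 hi1).2).mono' ?_
        (Eventually.of_forall fun z => norm_integral_le_integral_norm _)
      exact (StronglyMeasurable.integral_kernel (κ := k) (f := fun e : ℝ => e)
        (by fun_prop : Measurable fun e : ℝ => e).stronglyMeasurable).aestronglyMeasurable
    refine Integrable.ae_eq_zero_of_forall_setIntegral_eq_zero hint ?_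
    intro s hs _
    have := Measure.setIntegral_compProd (μ := P.map covTreat) (κ := k)
      (f := fun x : CovTreat p × ℝ => x.2) hs MeasurableSet.univ hi1.integrableOn
    simp only [Measure.restrict_univ] at this
    rw [← this, hcomp, setIntegral_map (hs.prod MeasurableSet.univ) (by fun_prop)
      hpm.aemeasurable]
    have h5 : (fun o : FullUnit p => (covTreat o, eps β o)) ⁻¹' s ×ˢ Set.univ =
        covTreat ⁻¹' s := by ext o; simp
    rw [h5]
    exact h.setIntegral_eps_covTreat hs
  filter_upwards [h1, h2, h0] with z h3 h4 h5
  exact ⟨h3, h4, h5⟩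

/-- Uniform control of weighted sums of outcome errors; the weights may depend on the covariates and
treatments of the whole sample. -/
theorem Model.measure_exists_abs_sum_eps_ge_le (h : Model B P θ β) {ι : Type*} [Fintype ι]
    [Nonempty ι] {J : Type*} [Fintype J] {a : J → ι → (ι → CovTreat p) → ℝ}
    (ha : ∀ j i, Measurable (a j i)) {t α : ℝ} (ht : 0 ≤ t) (hα : 0 < α) :
    Measure.pi (fun _ : ι => P) {S | ∃ j, (∀ i, |a j i (fun l => covTreat (S l))| ≤ α) ∧
      t ≤ |∑ i, a j i (fun l => covTreat (S l)) * eps β (S i)|} ≤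
      Fintype.card J * (2 * ENNReal.ofReal
        (Real.exp (-(t ^ 2 / (8 * α ^ 2 * (Fintype.card ι * B.Keps ^ 2)))))) +
      2 * ENNReal.ofReal ((2 / Real.exp 1) ^ Fintype.card ι) := by
  set k := condDistrib (eps β) covTreat P with hk
  have hprob : IsProbabilityMeasure (P.map covTreat) :=
    Measure.isProbabilityMeasure_map measurable_covTreat.aemeasurable
  have hcomp : (P.map covTreat) ⊗ₘ k = P.map fun o => (covTreat o, eps β o) :=
    compProd_map_condDistrib (measurable_eps β).aemeasurable
  have hpm : Measurable fun o : FullUnit p => (covTreat o, eps β o) :=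
    measurable_covTreat.prodMk (measurable_eps β)
  have hprob2 : IsProbabilityMeasure (P.map fun o => (covTreat o, eps β o)) :=
    Measure.isProbabilityMeasure_map hpm.aemeasurable
  have hpsi : Psi2LE ((P.map covTreat) ⊗ₘ k) Prod.snd B.Keps := by
    have := h.eps_subgaussian
    unfold Psi2LE at *
    rw [hcomp, lintegral_map (by fun_prop) hpm]
    exact this
  have hae := h.ae_condDistrib_eps
  have key := measure_pi_compProd_exists_abs_sum_ge_le (ι := ι) (hae.mono fun z hz => hz.1)
    (hae.mono fun z hz => hz.2.1) (hae.mono fun z hz => hz.2.2) B.Keps_pos hpsi ha ht hα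
  rw [hcomp, ← Measure.pi_map_pi fun _ => hpm.aemeasurable] at key
  refine le_trans (le_of_eq ?_) key
  have hpim : Measurable fun (x : ι → FullUnit p) i => (covTreat (x i), eps β (x i)) :=
    measurable_pi_lambda _ fun i => hpm.comp (measurable_pi_apply i)
  rw [Measure.map_apply hpim]
  · rfl
  · have hz : Measurable fun S : ι → CovTreat p × ℝ => (fun j => (S j).1 : ι → CovTreat p) := by
      fun_prop
    have ham : ∀ j i, Measurable fun S : ι → CovTreat p × ℝ => a j i (fun j => (S j).1) :=
      fun j i => (ha j i).comp hz
    have h1 : ∀ j, MeasurableSet {S : ι → CovTreat p × ℝ | (∀ i, |a j i (fun l => (S l).1)| ≤ α) ∧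
      t ≤ |∑ i, a j i (fun l => (S l).1) * (S i).2|} := by
      intro j
      have hsum : Measurable fun S : ι → CovTreat p × ℝ =>
          |∑ i, a j i (fun l => (S l).1) * (S i).2| := by
        have := ham j
        exact measurable_norm.comp (Finset.measurable_sum _ fun i _ =>
          (this i).mul (measurable_snd.comp (measurable_pi_apply i)))
      have hI : MeasurableSet {S : ι → CovTreat p × ℝ | ∀ i, |a j i (fun l => (S l).1)| ≤ α} := by
        rw [Set.ofPred_forall]
        exact MeasurableSet.iInter fun i =>
          measurableSet_le (measurable_norm.comp (ham j i)) measurable_const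
      exact hI.inter (measurableSet_le measurable_const hsum)
    rw [Set.ofPred_exists]
    exact MeasurableSet.iUnion h1

end Model

/-! ### Concentration of functions of the covariates and treatments -/

section Concentration

variable {B : Bounds} {p : ℕ} {P : Measure (FullUnit p)} [IsProbabilityMeasure P]
  {θ β : Fin p → ℝ} {ι : Type*} [Fintype ι]

/-- All covariates of the sample are bounded by `A`. -/
def CovBounded (A : ℝ) (x : ι → FullUnit p) : Prop := ∀ i j, |cov (x i) j| ≤ A

theorem Model.ae_covBounded (h : Model B P θ β) :
    ∀ᵐ x ∂(Measure.pi fun _ : ι => P), CovBounded B.radius x :=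
  ae_all_iff.2 fun i =>
    (measurePreserving_eval (fun _ : ι => P) i).quasiMeasurePreserving.ae h.ae_abs_cov_le

/-- Finitely many empirical means of functions dominated by a sub-Gaussian envelope are uniformly
close to their expectations. -/
theorem Model.measure_exists_abs_sum_sub_ge_le (h : Model B P θ β) [Nonempty ι]
    {J : Type*} [Fintype J] {Y : FullUnit p → ℝ} (hY : Measurable Y) {K : ℝ} (hK : 0 < K)
    (hpsi : Psi2LE P Y K) {g : J → FullUnit p → ℝ} (hg : ∀ j, Measurable (g j)) {α : ℝ}
    (hα : 0 < α) (hle : ∀ j o, (∀ l, |cov o l| ≤ B.radius) → |g j o| ≤ α * |Y o|)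
    {t : ℝ} (ht : 0 ≤ t) :
    Measure.pi (fun _ : ι => P) {x | CovBounded B.radius x ∧
      ∃ j, t ≤ |∑ i, (g j (x i) - ∫ o, g j o ∂P)|} ≤
      Fintype.card J * (2 * ENNReal.ofReal
        (Real.exp (-(t ^ 2 / (20 * α ^ 2 * (Fintype.card ι * K ^ 2)))))) +
      ENNReal.ofReal ((2 / Real.exp 1) ^ Fintype.card ι) := by
  set b : ℝ := (Fintype.card ι : ℝ) with hb
  have hb0 : 0 < b := by rw [hb]; exact_mod_cast Fintype.card_pos
  -- The centred squares `(g - m)² ≤ 2 g² + 2 m²` take `4`, the compensator takes `1`.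
  set V : ℝ := 5 * α ^ 2 * (b * K ^ 2) with hVd
  have hV : 0 < V := by positivity
  have hYi := hpsi.integrable hY hK
  have hY2 := hpsi.integrable_sq hY hK
  have hgi : ∀ j, Integrable (g j) P := fun j =>
    (hYi.abs.const_mul α).mono' (hg j).aestronglyMeasurable
      (h.ae_abs_cov_le.mono fun o ho => hle j o ho)
  have hsqle : ∀ j o, (∀ l, |cov o l| ≤ B.radius) → g j o ^ 2 ≤ α ^ 2 * Y o ^ 2 := by
    intro j o ho
    rw [← sq_abs (g j o), ← sq_abs (Y o), ← mul_pow]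
    exact pow_le_pow_left₀ (abs_nonneg _) (hle j o ho) 2
  have hg2 : ∀ j, Integrable (fun o => g j o ^ 2) P := fun j =>
    (hY2.const_mul (α ^ 2)).mono' ((hg j).pow_const 2).aestronglyMeasurable
      (h.ae_abs_cov_le.mono fun o ho => by
        rw [Real.norm_of_nonneg (sq_nonneg _)]; exact hsqle j o ho)
  have hg2le : ∀ j, ∫ o, g j o ^ 2 ∂P ≤ α ^ 2 * K ^ 2 := fun j => by
    calc ∫ o, g j o ^ 2 ∂P ≤ ∫ o, α ^ 2 * Y o ^ 2 ∂P :=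
          integral_mono_ae (hg2 j) (hY2.const_mul _) (h.ae_abs_cov_le.mono fun o ho => hsqle j o ho)
      _ ≤ α ^ 2 * K ^ 2 := by
          rw [integral_const_mul]
          exact mul_le_mul_of_nonneg_left (hpsi.integral_sq_le hY hK) (sq_nonneg _)
  set m : J → ℝ := fun j => ∫ o, g j o ∂P with hm
  have hU2eq : ∀ j o, (g j o - m j) ^ 2 = g j o ^ 2 - 2 * m j * g j o + m j ^ 2 :=
    fun j o => by ring
  have hUi : ∀ j, Integrable (fun o => g j o - m j) P := fun j => (hgi j).sub (integrable_const _)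
  have hU2i : ∀ j, Integrable (fun o => (g j o - m j) ^ 2) P := fun j => by
    simp_rw [hU2eq]
    exact ((hg2 j).sub ((hgi j).const_mul _)).add (integrable_const _)
  have hvar : ∀ j, ∫ o, (g j o - m j) ^ 2 ∂P = ∫ o, g j o ^ 2 ∂P - m j ^ 2 := fun j => by
    simp_rw [hU2eq]
    have hi : Integrable (fun o => g j o ^ 2 - 2 * m j * g j o) P :=
      (hg2 j).sub ((hgi j).const_mul _)
    rw [integral_add hi (integrable_const _), integral_sub (hg2 j) ((hgi j).const_mul _),
      integral_const_mul]
    simp only [integral_const, probReal_univ, smul_eq_mul, one_mul]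
    simp only [hm]; ring
  have hm2 : ∀ j, m j ^ 2 ≤ α ^ 2 * K ^ 2 := fun j => by
    have h1 : 0 ≤ ∫ o, (g j o - m j) ^ 2 ∂P := integral_nonneg fun o => sq_nonneg _
    rw [hvar] at h1
    linarith [hg2le j]
  have hUv : ∀ j, ∫ o, (g j o - m j) ^ 2 ∂P ≤ α ^ 2 * K ^ 2 := fun j => by
    rw [hvar]; linarith [hg2le j, sq_nonneg (m j)]
  have hU0 : ∀ j, ∫ o, (g j o - m j) ∂P = 0 := fun j => by
    rw [integral_sub (hgi j) (integrable_const _)]; simp [hm]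
  set A : J → Set (ι → FullUnit p) := fun j => {x | t ≤ |∑ i, (g j (x i) - m j)| ∧
    ∑ i, ((g j (x i) - m j) ^ 2 + α ^ 2 * K ^ 2) ≤ V}
  set C : Set (ι → FullUnit p) := {x | b * K ^ 2 ≤ ∑ i, Y (x i) ^ 2}
  have hsub : {x : ι → FullUnit p | CovBounded B.radius x ∧
      ∃ j, t ≤ |∑ i, (g j (x i) - m j)|} ⊆ (⋃ j, A j) ∪ C := by
    rintro x ⟨hx, j, hj⟩
    by_cases hC : x ∈ C
    · exact Or.inr hC
    refine Or.inl (Set.mem_iUnion.2 ⟨j, hj, ?_⟩)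
    simp only [C, Set.mem_ofPred_eq, not_le] at hC
    calc ∑ i, ((g j (x i) - m j) ^ 2 + α ^ 2 * K ^ 2)
        ≤ ∑ i, (2 * α ^ 2 * Y (x i) ^ 2 + 3 * (α ^ 2 * K ^ 2)) := by
          refine Finset.sum_le_sum fun i _ => ?_
          have h1 := hsqle j (x i) (hx i)
          have h2 := hm2 j
          nlinarith [sq_nonneg (g j (x i) + m j)]
      _ = 2 * α ^ 2 * ∑ i, Y (x i) ^ 2 + b * (3 * (α ^ 2 * K ^ 2)) := by
          rw [Finset.sum_add_distrib, Finset.mul_sum]; simp [hb]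
      _ ≤ 2 * α ^ 2 * (b * K ^ 2) + b * (3 * (α ^ 2 * K ^ 2)) := by gcongr
      _ = V := by rw [hVd]; ring
  refine (measure_mono hsub).trans ((measure_union_le _ _).trans (add_le_add ?_ ?_))
  · refine (measure_iUnion_fintype_le _ _).trans ?_
    refine (Finset.sum_le_card_nsmul Finset.univ _ _ fun j _ =>
      measure_pi_abs_sum_ge_le ((hg j).sub_const _) (hUi j) (hU2i j) (hU0 j) (hUv j) ht
        hV).trans (le_of_eq ?_)
    rw [Finset.card_univ, nsmul_eq_mul, hVd]
    congr 5
    ring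
  · exact measure_pi_sum_sq_gt_le hY hK hpsi

/-- A maximal inequality for a fixed linear combination of the covariates. -/
theorem Model.measure_exists_abs_cov_dot_ge_le (h : Model B P θ β) {u : Fin p → ℝ}
    (hu : 0 < l2 u) {τ : ℝ} (hτ : 0 ≤ τ) :
    Measure.pi (fun _ : ι => P) {x | ∃ i, B.KX * l2 u * τ ≤ |cov (x i) ⬝ᵥ u|} ≤
      Fintype.card ι * (2 * ENNReal.ofReal (Real.exp (-τ ^ 2))) := by
  have hK : 0 < B.KX * l2 u := mul_pos B.KX_pos hu
  have hpsi := h.psi2LE_cov_dot hu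
  set E : ENNReal := ENNReal.ofReal (Real.exp (τ ^ 2)) with hE
  have h1 : P {o | B.KX * l2 u * τ ≤ |cov o ⬝ᵥ u|} ≤
      2 * ENNReal.ofReal (Real.exp (-τ ^ 2)) := by
    have hm : Measurable fun o : FullUnit p => ENNReal.ofReal
        (Real.exp ((cov o ⬝ᵥ u) ^ 2 / (B.KX * l2 u) ^ 2)) := by
      have := measurable_cov_dot u; fun_prop
    have hsub : {o : FullUnit p | B.KX * l2 u * τ ≤ |cov o ⬝ᵥ u|} ⊆ {o | E ≤ ENNReal.ofReal
        (Real.exp ((cov o ⬝ᵥ u) ^ 2 / (B.KX * l2 u) ^ 2))} := by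
      intro o ho
      refine ENNReal.ofReal_le_ofReal (Real.exp_le_exp.2 ?_)
      rw [le_div_iff₀ (by positivity), ← sq_abs (cov o ⬝ᵥ u), ← mul_pow, mul_comm τ]
      exact pow_le_pow_left₀ (by positivity) ho 2
    have hE0 : E ≠ 0 := by simp [hE, Real.exp_pos]
    have h5 := (mul_le_mul_right (measure_mono (μ := P) hsub) E).trans
      ((mul_meas_ge_le_lintegral (μ := P) hm E).trans hpsi)
    rw [Real.exp_neg, ENNReal.ofReal_inv_of_pos (Real.exp_pos _), ← hE, ← div_eq_mul_inv,
      ENNReal.le_div_iff_mul_le (Or.inl hE0) (Or.inl ENNReal.ofReal_ne_top), mul_comm]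
    exact h5
  have hsub : {x : ι → FullUnit p | ∃ i, B.KX * l2 u * τ ≤ |cov (x i) ⬝ᵥ u|} ⊆
      ⋃ i, (fun x : ι → FullUnit p => x i) ⁻¹' {o | B.KX * l2 u * τ ≤ |cov o ⬝ᵥ u|} := by
    rintro x ⟨i, hi⟩
    exact Set.mem_iUnion.2 ⟨i, hi⟩
  refine (measure_mono hsub).trans ((measure_iUnion_fintype_le _ _).trans ?_)
  refine (Finset.sum_le_card_nsmul Finset.univ _
    (2 * ENNReal.ofReal (Real.exp (-τ ^ 2))) fun i _ => ?_).trans (le_of_eq ?_)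
  · have hms : MeasurableSet {o : FullUnit p | B.KX * l2 u * τ ≤ |cov o ⬝ᵥ u|} :=
      measurableSet_le measurable_const (measurable_norm.comp (measurable_cov_dot u))
    exact ((measurePreserving_eval (fun _ : ι => P) i).measure_preimage
      hms.nullMeasurableSet).trans_le h1
  · rw [Finset.card_univ, nsmul_eq_mul]

end Concentration

/-! ### Restricted eigenvalues -/

section Maurey

variable {p : ℕ} {K : Type*} [Fintype K]

/-- The quadratic form `∑ₖ τₖ (yₖ'v)²`. -/
def quadForm (τ : K → ℝ) (y : K → Fin p → ℝ) (v : Fin p → ℝ) : ℝ := ∑ k, τ k * (y k ⬝ᵥ v) ^ 2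

variable {A : Type*} [Fintype A]

theorem sum_mul_quadForm_add (τ : K → ℝ) (y : K → Fin p → ℝ) {w : A → ℝ} {a : A → Fin p → ℝ}
    (hw1 : ∑ j, w j = 1) (u : Fin p → ℝ) :
    ∑ j, w j * quadForm τ y (u + a j) = quadForm τ y (u + ∑ j, w j • a j) -
      quadForm τ y (∑ j, w j • a j) + ∑ j, w j * quadForm τ y (a j) := by
  unfold quadForm
  simp_rw [Finset.mul_sum]
  rw [Finset.sum_comm, Finset.sum_comm (f := fun j k => w j * (τ k * (y k ⬝ᵥ a j) ^ 2)),
    ← Finset.sum_sub_distrib, ← Finset.sum_add_distrib]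
  refine Finset.sum_congr rfl fun k _ => ?_
  have h1 : y k ⬝ᵥ ∑ j, w j • a j = ∑ j, w j * (y k ⬝ᵥ a j) := by
    rw [dotProduct_sum]; simp
  rw [dotProduct_add, h1]
  have h2 : ∀ j, w j * (τ k * (y k ⬝ᵥ (u + a j)) ^ 2) = τ k * (y k ⬝ᵥ u) ^ 2 * w j +
      2 * τ k * (y k ⬝ᵥ u) * (w j * (y k ⬝ᵥ a j)) + w j * (τ k * (y k ⬝ᵥ a j) ^ 2) := by
    intro j; rw [dotProduct_add]; ring
  simp_rw [h2]
  rw [Finset.sum_add_distrib, Finset.sum_add_distrib, ← Finset.mul_sum, ← Finset.mul_sum, hw1]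
  ring

/-- Maurey's empirical method: if the quadratic form is nonnegative at all sums of `k` atoms, then it
is nearly nonnegative at every convex combination of the atoms. The proof replaces the atoms by their
mean one at a time. -/
theorem quadForm_nonneg_of_sums (τ : K → ℝ) (y : K → Fin p → ℝ) {w : A → ℝ}
    {a : A → Fin p → ℝ} (hw : ∀ j, 0 ≤ w j) (hw1 : ∑ j, w j = 1) (k : ℕ) (u : Fin p → ℝ)
    (h : ∀ f : Fin k → A, 0 ≤ quadForm τ y (u + ∑ i, a (f i))) :
    0 ≤ quadForm τ y (u + (k : ℝ) • ∑ j, w j • a j) +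
      k * (∑ j, w j * quadForm τ y (a j) - quadForm τ y (∑ j, w j • a j)) := by
  induction k generalizing u with
  | zero => simpa using h Fin.elim0
  | succ k ih =>
    have h1 : ∀ j, 0 ≤ quadForm τ y ((u + (k : ℝ) • ∑ j, w j • a j) + a j) +
        k * (∑ j, w j * quadForm τ y (a j) - quadForm τ y (∑ j, w j • a j)) := by
      intro j
      have h2 := ih (u + a j) fun f => by
        have := h (Fin.cons j f)
        rw [Fin.sum_univ_succ] at this
        simpa [add_assoc] using this
      rwa [add_right_comm] at h2
    have h2 := Finset.sum_nonneg fun j (_ : j ∈ Finset.univ) => mul_nonneg (hw j) (h1 j)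
    simp_rw [mul_add] at h2
    rw [Finset.sum_add_distrib, sum_mul_quadForm_add τ y hw1, ← Finset.sum_mul, hw1] at h2
    have h3 : u + (k : ℝ) • ∑ j, w j • a j + ∑ j, w j • a j =
        u + ((k + 1 : ℕ) : ℝ) • ∑ j, w j • a j := by
      push_cast; rw [add_smul, one_smul, add_assoc]
    rw [h3] at h2
    push_cast at h2 ⊢
    linarith

/-- The vertices of the `ℓ₁` ball. -/
def signedUnit (a : Fin p × Bool) : Fin p → ℝ := Pi.single a.1 (if a.2 then 1 else -1)

/-- A quadratic form that is nonnegative at all sums of `N` vertices of the `ℓ₁` ball and at most `D`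
at the vertices is bounded below by `-(2 D / N) ‖v‖₁²`. -/
theorem quadForm_ge_of_sums (τ : K → ℝ) (y : K → Fin p → ℝ) {D : ℝ} (hD : 0 ≤ D)
    (hD' : ∀ a, quadForm τ y (signedUnit a) ≤ D) {N : ℕ} (hN : 2 ≤ N)
    (h : ∀ f : Fin N → Fin p × Bool, 0 ≤ quadForm τ y (∑ i, signedUnit (f i)))
    (v : Fin p → ℝ) : -(2 * D / N * l1 v ^ 2) ≤ quadForm τ y v := by
  rcases (l1_nonneg v).eq_or_lt with h0 | h0
  · have : v = 0 := by
      apply eq_zero_of_l2_eq_zero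
      exact le_antisymm (h0 ▸ l2_le_l1 v) (l2_nonneg v)
    subst this
    rw [← h0]; simp [quadForm]
  -- `v / ‖v‖₁` is the convex combination of vertices weighted by the positive and negative parts.
  set w : Fin p × Bool → ℝ := fun a => max (if a.2 then v a.1 else -v a.1) 0 / l1 v with hwd
  have hw : ∀ a, 0 ≤ w a := fun a => div_nonneg (le_max_right _ _) h0.le
  have hpm : ∀ x : ℝ, max x 0 + max (-x) 0 = |x| := fun x => by
    rcases le_total 0 x with hx | hx
    · rw [max_eq_left hx, max_eq_right (by linarith), abs_of_nonneg hx, add_zero]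
    · rw [max_eq_right hx, max_eq_left (by linarith), abs_of_nonpos hx, zero_add]
  have hpm' : ∀ x : ℝ, max x 0 - max (-x) 0 = x := fun x => by
    rcases le_total 0 x with hx | hx
    · rw [max_eq_left hx, max_eq_right (by linarith), sub_zero]
    · rw [max_eq_right hx, max_eq_left (by linarith)]; ring
  have hw1 : ∑ a, w a = 1 := by
    rw [Fintype.sum_prod_type]
    simp only [hwd, Fintype.sum_bool, if_true, Bool.false_eq_true, if_false]
    simp_rw [← add_div, hpm]
    rw [← Finset.sum_div]
    exact div_self h0.ne'
  have hwv : ∑ a, w a • signedUnit a = (l1 v)⁻¹ • v := by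
    rw [Fintype.sum_prod_type]
    ext l
    simp only [hwd, signedUnit, Fintype.sum_bool, if_true, Bool.false_eq_true, if_false,
      Finset.sum_apply, Pi.add_apply, Pi.smul_apply, smul_eq_mul]
    rw [Finset.sum_eq_single l]
    · simp only [Pi.single_eq_same]
      rw [inv_mul_eq_div]
      nth_rewrite 3 [← hpm' (v l)]
      ring
    · intro j _ hj
      rw [Pi.single_eq_of_ne hj.symm, Pi.single_eq_of_ne hj.symm]; simp
    · simp
  have key := quadForm_nonneg_of_sums τ y hw hw1 N 0 (by simpa using h)
  rw [hwv, zero_add] at key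
  have hsm : ∀ (c : ℝ) (z : Fin p → ℝ), quadForm τ y (c • z) = c ^ 2 * quadForm τ y z := by
    intro c z
    unfold quadForm
    rw [Finset.mul_sum]
    refine Finset.sum_congr rfl fun k _ => ?_
    rw [dotProduct_smul, smul_eq_mul]; ring
  rw [hsm] at key
  have hDs : ∑ a, w a * quadForm τ y (signedUnit a) ≤ D := by
    calc ∑ a, w a * quadForm τ y (signedUnit a) ≤ ∑ a, w a * D :=
          Finset.sum_le_sum fun a _ => mul_le_mul_of_nonneg_left (hD' a) (hw a)
      _ = D := by rw [← Finset.sum_mul, hw1, one_mul]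
  have hQ : quadForm τ y v = l1 v ^ 2 * quadForm τ y ((l1 v)⁻¹ • v) := by
    rw [hsm]; field_simp
  set q0 := quadForm τ y ((l1 v)⁻¹ • v) with hq0
  have hN' : (2 : ℝ) ≤ N := by exact_mod_cast hN
  have h4 : -(2 * D / N) ≤ q0 := by
    rw [← neg_div, div_le_iff₀ (by linarith)]
    by_contra! hc
    have h5 : q0 < 0 := by
      by_contra! h5
      nlinarith
    nlinarith
  rw [hQ]
  nlinarith [sq_nonneg (l1 v)]

end Maurey

section RestrictedEigenvalue

variable {B : Bounds} {p : ℕ} {P : Measure (FullUnit p)} [IsProbabilityMeasure P]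
  {θ β : Fin p → ℝ} {ι : Type*} [Fintype ι]

/-- The average of a function over a finite index type. -/
def avg (f : ι → ℝ) : ℝ := (1 / (Fintype.card ι : ℝ)) * ∑ i, f i

/-- The rate at which the lower tails of `n⁻¹ ∑ᵢ Wᵢ (Xᵢ'v)²` decay. -/
def Bounds.lowerTailRate (B : Bounds) : ℝ :=
  (B.minPropensity * B.eigMin) ^ 2 / (64 * B.KX ^ 4)

theorem Bounds.lowerTailRate_pos (B : Bounds) : 0 < B.lowerTailRate := by
  have := B.minPropensity_pos
  have := B.eigMin_pos
  have := B.KX_pos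
  unfold Bounds.lowerTailRate; positivity

/-- Lower tails of sums of nonnegative variables need two moments only; the fourth moment of `X'v`
suffices for a single `v`. -/
theorem Model.measure_sum_wt_mul_sq_lt_le (h : Model B P θ β) (v : Fin p → ℝ) :
    Measure.pi (fun _ : ι => P) {x | ∑ i, wt (x i) * (cov (x i) ⬝ᵥ v) ^ 2 <
      Fintype.card ι * (B.minPropensity * B.eigMin / 2 * l2 v ^ 2)} ≤
      ENNReal.ofReal (Real.exp (-(B.lowerTailRate * Fintype.card ι))) := by
  rcases (l2_nonneg v).eq_or_lt with h0 | h0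
  · have h1 : {x : ι → FullUnit p | ∑ i, wt (x i) * (cov (x i) ⬝ᵥ v) ^ 2 <
      Fintype.card ι * (B.minPropensity * B.eigMin / 2 * l2 v ^ 2)} = ∅ := by
      ext x
      have h2 : 0 ≤ ∑ i, wt (x i) * (cov (x i) ⬝ᵥ v) ^ 2 :=
        Finset.sum_nonneg fun i _ => mul_nonneg (wt_nonneg _) (sq_nonneg _)
      simpa [← h0] using h2
    rw [h1]; simp
  set c := B.minPropensity * B.eigMin with hc
  have hc0 : 0 < c := mul_pos B.minPropensity_pos B.eigMin_pos
  have hK := B.KX_pos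
  set C4 := 4 * B.KX ^ 4 with hC4
  have hC40 : 0 < C4 := mul_pos (by norm_num) (pow_pos hK 4)
  -- Up to scaling by `‖v‖²`, the exponent `-s c / 2 + s² C4` is minimal at this value of `s`.
  set σ := c / (4 * C4) with hσ
  have hσ0 : 0 < σ := div_pos hc0 (by positivity)
  set s := σ / l2 v ^ 2 with hs
  have hs0 : 0 < s := div_pos hσ0 (pow_pos h0 2)
  set Z : FullUnit p → ℝ := fun o => wt o * (cov o ⬝ᵥ v) ^ 2 with hZ
  have hZm : Measurable Z := measurable_wt.mul ((measurable_cov_dot v).pow_const 2)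
  have hZ0 : ∀ o, 0 ≤ Z o := fun o => mul_nonneg (wt_nonneg o) (sq_nonneg _)
  have hZi : Integrable Z P := (h.integrable_cov_dot_pow v 2).bdd_mul (c := 1)
    measurable_wt.aestronglyMeasurable (Eventually.of_forall fun o => by
      rw [Real.norm_of_nonneg (wt_nonneg o)]; exact wt_le_one o)
  have hZ2le : ∀ o, Z o ^ 2 ≤ (cov o ⬝ᵥ v) ^ 4 := fun o => by
    simp only [hZ]
    rw [mul_pow, wt_sq, ← pow_mul, show 2 * 2 = 4 from rfl]
    exact mul_le_of_le_one_left (by positivity) (wt_le_one o)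
  have hZ2i : Integrable (fun o => Z o ^ 2) P :=
    (h.integrable_cov_dot_pow v 4).mono' (hZm.pow_const 2).aestronglyMeasurable
      (Eventually.of_forall fun o => by rw [Real.norm_of_nonneg (sq_nonneg _)]; exact hZ2le o)
  have hZ2 : ∫ o, Z o ^ 2 ∂P ≤ C4 * l2 v ^ 4 :=
    (integral_mono hZ2i (h.integrable_cov_dot_pow v 4) hZ2le).trans
      (h.integral_cov_dot_pow_four_le v)
  have hZ1 : c * l2 v ^ 2 ≤ ∫ o, Z o ∂P := h.le_integral_wt_mul_sq v
  have hexpm : Measurable fun o => ENNReal.ofReal (Real.exp (-(s * Z o))) := by fun_prop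
  have hmom : ∫⁻ o, ENNReal.ofReal (Real.exp (-(s * Z o))) ∂P ≤
      ENNReal.ofReal (Real.exp (-(σ * c) + σ ^ 2 * C4)) := by
    have hpt : ∀ o, Real.exp (-(s * Z o)) ≤ 1 - s * Z o + s ^ 2 * Z o ^ 2 := fun o => by
      have h1 := Real.add_one_le_exp (s * Z o)
      have h2 := Real.add_one_le_exp (-(s * Z o))
      have h3 : Real.exp (-(s * Z o)) * Real.exp (s * Z o) = 1 := by rw [← Real.exp_add]; simp
      have h4 : 0 ≤ s * Z o := mul_nonneg hs0.le (hZ0 o)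
      have h5 := Real.exp_pos (-(s * Z o))
      nlinarith
    have hi1 : Integrable (fun o => 1 - s * Z o) P := (integrable_const 1).sub (hZi.const_mul s)
    have hi : Integrable (fun o => 1 - s * Z o + s ^ 2 * Z o ^ 2) P := hi1.add (hZ2i.const_mul _)
    calc _ ≤ ∫⁻ o, ENNReal.ofReal (1 - s * Z o + s ^ 2 * Z o ^ 2) ∂P :=
          lintegral_mono fun o => ENNReal.ofReal_le_ofReal (hpt o)
      _ = ENNReal.ofReal (∫ o, (1 - s * Z o + s ^ 2 * Z o ^ 2) ∂P) :=
          (ofReal_integral_eq_lintegral_ofReal hi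
            (Eventually.of_forall fun o => (Real.exp_pos _).le.trans (hpt o))).symm
      _ ≤ _ := by
          refine ENNReal.ofReal_le_ofReal ?_
          rw [integral_add hi1 (hZ2i.const_mul _), integral_sub (integrable_const 1)
            (hZi.const_mul s), integral_const_mul, integral_const_mul]
          simp only [integral_const, probReal_univ, smul_eq_mul, mul_one]
          have h1 : σ * c ≤ s * ∫ o, Z o ∂P := by
            calc σ * c = s * (c * l2 v ^ 2) := by rw [hs]; field_simp
              _ ≤ _ := mul_le_mul_of_nonneg_left hZ1 hs0.le
          have h2 : s ^ 2 * ∫ o, Z o ^ 2 ∂P ≤ σ ^ 2 * C4 := by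
            calc _ ≤ s ^ 2 * (C4 * l2 v ^ 4) := mul_le_mul_of_nonneg_left hZ2 (sq_nonneg _)
              _ = σ ^ 2 * C4 := by rw [hs]; field_simp
          have h3 := Real.add_one_le_exp (-(σ * c) + σ ^ 2 * C4)
          linarith
  set b := Fintype.card ι with hb
  set E : ENNReal := ENNReal.ofReal (Real.exp (-(b * (σ * c / 2)))) with hE
  have hsub : {x : ι → FullUnit p | ∑ i, wt (x i) * (cov (x i) ⬝ᵥ v) ^ 2 <
      b * (c / 2 * l2 v ^ 2)} ⊆ {x | E ≤ ∏ i, ENNReal.ofReal (Real.exp (-(s * Z (x i))))} := by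
    intro x hx
    simp only [Set.mem_ofPred_eq] at hx ⊢
    rw [← ENNReal.ofReal_prod_of_nonneg fun i _ => (Real.exp_pos _).le, ← Real.exp_sum, hE]
    refine ENNReal.ofReal_le_ofReal (Real.exp_le_exp.2 ?_)
    rw [Finset.sum_neg_distrib, ← Finset.mul_sum, neg_le_neg_iff]
    calc s * ∑ i, Z (x i) ≤ s * (b * (c / 2 * l2 v ^ 2)) :=
          mul_le_mul_of_nonneg_left hx.le hs0.le
      _ = b * (σ * c / 2) := by rw [hs]; field_simp
  have hprod : ∫⁻ x : ι → FullUnit p, ∏ i, ENNReal.ofReal (Real.exp (-(s * Z (x i))))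
      ∂(Measure.pi fun _ : ι => P) ≤ ENNReal.ofReal (Real.exp (b * (-(σ * c) + σ ^ 2 * C4))) := by
    rw [lintegral_pi_prod_eval (ρ := fun _ : ι => P)
      (f := fun _ o => ENNReal.ofReal (Real.exp (-(s * Z o)))) (fun _ => hexpm),
      Finset.prod_const, Finset.card_univ, Real.exp_nat_mul,
      ENNReal.ofReal_pow (Real.exp_pos _).le]
    exact pow_le_pow_left' hmom _
  have hmk := mul_meas_ge_le_lintegral (μ := Measure.pi fun _ : ι => P)
    (f := fun x => ∏ i, ENNReal.ofReal (Real.exp (-(s * Z (x i)))))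
    (Finset.measurable_prod _ fun i _ => hexpm.comp (measurable_pi_apply i)) E
  have hE0 : E ≠ 0 := by simp [hE, Real.exp_pos]
  have h5 := (mul_le_mul_right (measure_mono (μ := Measure.pi fun _ : ι => P) hsub) E).trans
    (hmk.trans hprod)
  have h6 : ENNReal.ofReal (Real.exp (-(B.lowerTailRate * b))) =
      ENNReal.ofReal (Real.exp (b * (-(σ * c) + σ ^ 2 * C4))) / E := by
    rw [hE, ← ENNReal.ofReal_div_of_pos (Real.exp_pos _), ← Real.exp_sub]
    congr 2
    rw [Bounds.lowerTailRate, ← hc, hσ, hC4]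
    field_simp
    ring
  rw [h6, ENNReal.le_div_iff_mul_le (Or.inl hE0) (Or.inl ENNReal.ofReal_ne_top), mul_comm]
  exact h5

/-- The restricted eigenvalue property of a sample with constants `c` and `d`. -/
def RestrictedEig (c d : ℝ) (x : ι → FullUnit p) : Prop :=
  ∀ v : Fin p → ℝ, c * l2 v ^ 2 - d * l1 v ^ 2 ≤ avg fun i => wt (x i) * (cov (x i) ⬝ᵥ v) ^ 2

/-- The curvature constant in the restricted eigenvalue property. -/
def Bounds.curv (B : Bounds) : ℝ := B.minPropensity * B.eigMin / 2

theorem Bounds.curv_pos (B : Bounds) : 0 < B.curv :=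
  half_pos (mul_pos B.minPropensity_pos B.eigMin_pos)

/-- The tolerance constant in the restricted eigenvalue property. -/
def Bounds.tol (B : Bounds) : ℝ := (16 * B.radius ^ 2 + 8 * B.curv) / B.lowerTailRate

theorem Bounds.tol_pos (B : Bounds) : 0 < B.tol := by
  have := B.curv_pos
  have := B.lowerTailRate_pos
  have := B.one_le_radius
  unfold Bounds.tol; positivity

/-- The restricted eigenvalue property holds with exponentially high probability: by the union bound
the quadratic form is nonnegative at the `(2 p) ^ N` sums of `N` signed unit vectors, with `N` of order
`n / log p`, and Maurey's method extends this to all vectors. -/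
theorem Model.measure_not_restrictedEig_le (h : Model B P θ β) [Nonempty ι] (hp : 2 ≤ p) :
    Measure.pi (fun _ : ι => P) {x | CovBounded B.radius x ∧
      ¬ RestrictedEig B.curv (B.tol * (Real.log p / Fintype.card ι)) x} ≤
      ENNReal.ofReal (Real.exp (-(B.lowerTailRate / 2 * Fintype.card ι))) := by
  have hc := B.curv_pos
  have hr := B.lowerTailRate_pos
  have hA := B.one_le_radius
  set b : ℝ := (Fintype.card ι : ℝ) with hb
  have hb0 : 0 < b := by rw [hb]; exact_mod_cast Fintype.card_pos
  have hp' : (2 : ℝ) ≤ p := by exact_mod_cast hp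
  have hlog2 : Real.log (2 * p) ≤ 2 * Real.log p := by
    rw [← Real.log_rpow (by linarith)]
    refine Real.log_le_log (by linarith) ?_
    norm_num
    nlinarith
  have hl0 : 0 < Real.log (2 * p) := Real.log_pos (by linarith)
  have hlp : 0 < Real.log p := Real.log_pos (by linarith)
  -- With this `N` the union bound over `(2 p) ^ N` vectors costs half of the exponent.
  set N : ℕ := ⌊B.lowerTailRate * b / (2 * Real.log (2 * p))⌋₊ with hN
  rcases lt_or_ge N 2 with hN2 | hN2
  · -- Too few observations: the asserted lower bound is nonpositive.
    have h1 : B.lowerTailRate * b / (2 * Real.log (2 * p)) < 2 := by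
      have := (Nat.floor_lt' (by norm_num)).1 hN2
      exact_mod_cast this
    have h2 : {x : ι → FullUnit p | CovBounded B.radius x ∧
        ¬ RestrictedEig B.curv (B.tol * (Real.log p / b)) x} = ∅ := by
      rw [Set.eq_empty_iff_forall_notMem]
      rintro x ⟨-, hx⟩
      refine hx fun v => ?_
      have h3 : B.curv ≤ B.tol * (Real.log p / b) := by
        rw [div_lt_iff₀ (by positivity)] at h1
        rw [Bounds.tol, div_mul_div_comm, le_div_iff₀ (by positivity)]
        have h4 : B.curv * (B.lowerTailRate * b) ≤ B.curv * (8 * Real.log p) :=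
          mul_le_mul_of_nonneg_left (by linarith) hc.le
        nlinarith [mul_pos (pow_pos (lt_of_lt_of_le one_pos hA) 2) hlp]
      have h4 : 0 ≤ avg fun i => wt (x i) * (cov (x i) ⬝ᵥ v) ^ 2 :=
        mul_nonneg (by positivity)
          (Finset.sum_nonneg fun i _ => mul_nonneg (wt_nonneg _) (sq_nonneg _))
      have h5 : l2 v ^ 2 ≤ l1 v ^ 2 := pow_le_pow_left₀ (l2_nonneg v) (l2_le_l1 v) 2
      have h6 : B.curv * l2 v ^ 2 ≤ B.tol * (Real.log p / b) * l1 v ^ 2 :=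
        mul_le_mul h3 h5 (sq_nonneg _) (hc.le.trans h3)
      linarith
    rw [h2]; simp
  · have hNle : (N : ℝ) ≤ B.lowerTailRate * b / (2 * Real.log (2 * p)) :=
      Nat.floor_le (by positivity)
    have hNge : B.lowerTailRate * b / (2 * Real.log (2 * p)) ≤ 2 * N := by
      have h1 := Nat.lt_floor_add_one (B.lowerTailRate * b / (2 * Real.log (2 * p)))
      have h2 : (2 : ℝ) ≤ N := by exact_mod_cast hN2
      rw [← hN] at h1
      linarith
    have hN0 : (0 : ℝ) < N := by
      have h2 : (2 : ℝ) ≤ N := by exact_mod_cast hN2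
      linarith
    set bad : (Fin N → Fin p × Bool) → Set (ι → FullUnit p) := fun f =>
      {x | ∑ i, wt (x i) * (cov (x i) ⬝ᵥ (∑ k, signedUnit (f k))) ^ 2 <
        b * (B.minPropensity * B.eigMin / 2 * l2 (∑ k, signedUnit (f k)) ^ 2)} with hbad
    have hsub : {x : ι → FullUnit p | CovBounded B.radius x ∧
        ¬ RestrictedEig B.curv (B.tol * (Real.log p / b)) x} ⊆ ⋃ f, bad f := by
      rintro x ⟨hx, hre⟩
      by_contra hnot
      simp only [Set.mem_iUnion, not_exists, hbad, Set.mem_ofPred_eq, not_lt] at hnot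
      refine hre fun v => ?_
      -- The term `-curv ‖v‖₂²` enters the quadratic form as further units with negative weights.
      set τ : ι ⊕ Fin p → ℝ := Sum.elim (fun i => wt (x i) / b) fun _ => -B.curv with hτ
      set y : ι ⊕ Fin p → Fin p → ℝ := Sum.elim (fun i => cov (x i)) fun j => Pi.single j 1 with hy
      have hQ : ∀ u, quadForm τ y u =
          1 / b * ∑ i, wt (x i) * (cov (x i) ⬝ᵥ u) ^ 2 - B.curv * l2 u ^ 2 := by
        intro u
        rw [quadForm, Fintype.sum_sum_type, l2_sq]
        simp only [hτ, hy, Sum.elim_inl, Sum.elim_inr, single_one_dotProduct]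
        rw [← Finset.mul_sum Finset.univ (fun j => u j ^ 2), Finset.mul_sum _ _ (1 / b), neg_mul,
          sub_eq_add_neg]
        congr 1
        exact Finset.sum_congr rfl fun i _ => by ring
      have hD : ∀ a : Fin p × Bool, quadForm τ y (signedUnit a) ≤ B.radius ^ 2 := by
        intro a
        rw [hQ]
        have h1 : ∀ i, wt (x i) * (cov (x i) ⬝ᵥ signedUnit a) ^ 2 ≤ B.radius ^ 2 := by
          intro i
          have h2 : (cov (x i) ⬝ᵥ signedUnit a) ^ 2 = |cov (x i) a.1| ^ 2 := by
            unfold signedUnit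
            rw [dotProduct_single, sq_abs]
            split_ifs <;> ring
          rw [h2]
          refine (mul_le_of_le_one_left (by positivity) (wt_le_one _)).trans ?_
          exact pow_le_pow_left₀ (abs_nonneg _) (hx i a.1) 2
        have h3 : ∑ i, wt (x i) * (cov (x i) ⬝ᵥ signedUnit a) ^ 2 ≤ b * B.radius ^ 2 := by
          refine (Finset.sum_le_card_nsmul _ _ _ fun i _ => h1 i).trans (le_of_eq ?_)
          rw [Finset.card_univ, nsmul_eq_mul]
        have h4 : 1 / b * ∑ i, wt (x i) * (cov (x i) ⬝ᵥ signedUnit a) ^ 2 ≤ B.radius ^ 2 := by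
          rw [one_div, inv_mul_le_iff₀ hb0]; exact h3
        have h5 : 0 ≤ B.curv * l2 (signedUnit a) ^ 2 := by positivity
        linarith
      have hsum : ∀ f : Fin N → Fin p × Bool, 0 ≤ quadForm τ y (∑ k, signedUnit (f k)) := by
        intro f
        rw [hQ, sub_nonneg, one_div, ← div_eq_inv_mul, le_div_iff₀ hb0]
        refine le_trans (le_of_eq ?_) (hnot f)
        rw [Bounds.curv]; ring
      have key := quadForm_ge_of_sums τ y (by positivity) hD hN2 hsum v
      rw [hQ] at key
      have h7 : 2 * B.radius ^ 2 / N ≤ B.tol * (Real.log p / b) := by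
        rw [div_le_iff₀ hN0]
        rw [div_le_iff₀ (by positivity)] at hNge
        have h8 : B.lowerTailRate * b ≤ N * (8 * Real.log p) := by nlinarith
        have h9 : 16 * B.radius ^ 2 / B.lowerTailRate ≤ B.tol := by
          unfold Bounds.tol; gcongr; linarith
        have h10 : 16 * B.radius ^ 2 / B.lowerTailRate * (Real.log p / b) * N ≤
            B.tol * (Real.log p / b) * N := by gcongr
        refine le_trans ?_ h10
        rw [div_mul_div_comm, div_mul_eq_mul_div, le_div_iff₀ (by positivity)]
        have h11 : 0 ≤ 2 * B.radius ^ 2 := by positivity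
        nlinarith [mul_le_mul_of_nonneg_left h8 h11]
      have h12 : 2 * B.radius ^ 2 / N * l1 v ^ 2 ≤ B.tol * (Real.log p / b) * l1 v ^ 2 := by gcongr
      unfold avg
      rw [← hb]
      linarith
    refine (measure_mono hsub).trans ((measure_iUnion_fintype_le _ _).trans ?_)
    refine (Finset.sum_le_card_nsmul Finset.univ _ _ fun f _ =>
      h.measure_sum_wt_mul_sq_lt_le (ι := ι) (∑ k, signedUnit (f k))).trans ?_
    rw [Finset.card_univ, Fintype.card_fun, Fintype.card_fin, Fintype.card_prod, Fintype.card_fin,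
      Fintype.card_bool, nsmul_eq_mul]
    have h13 : (((p * 2) ^ N : ℕ) : ENNReal) = ENNReal.ofReal (Real.exp (N * Real.log (2 * p))) := by
      rw [Real.exp_nat_mul, Real.exp_log (by positivity), mul_comm (2 : ℝ)]
      rw [← ENNReal.ofReal_natCast]; push_cast; rfl
    rw [h13, ← ENNReal.ofReal_mul (Real.exp_pos _).le, ← Real.exp_add]
    refine ENNReal.ofReal_le_ofReal (Real.exp_le_exp.2 ?_)
    rw [le_div_iff₀ (by positivity)] at hNle
    rw [← hb]
    nlinarith

end RestrictedEigenvalue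

/-! ### Averages -/

section Avg

variable {ι : Type*} [Fintype ι] {p : ℕ}

theorem avg_add (f g : ι → ℝ) : avg (fun i => f i + g i) = avg f + avg g := by
  unfold avg; rw [Finset.sum_add_distrib, mul_add]

theorem avg_sub (f g : ι → ℝ) : avg (fun i => f i - g i) = avg f - avg g := by
  unfold avg; rw [Finset.sum_sub_distrib, mul_sub]

theorem avg_const_mul (c : ℝ) (f : ι → ℝ) : avg (fun i => c * f i) = c * avg f := by
  unfold avg; rw [← Finset.mul_sum]; ring

theorem avg_mono {f g : ι → ℝ} (h : ∀ i, f i ≤ g i) : avg f ≤ avg g := by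
  unfold avg
  exact mul_le_mul_of_nonneg_left (Finset.sum_le_sum fun i _ => h i) (by positivity)

theorem avg_nonneg {f : ι → ℝ} (h : ∀ i, 0 ≤ f i) : 0 ≤ avg f :=
  mul_nonneg (by positivity) (Finset.sum_nonneg fun i _ => h i)

theorem abs_avg_le (f : ι → ℝ) : |avg f| ≤ avg fun i => |f i| := by
  unfold avg
  rw [abs_mul, abs_of_nonneg (by positivity : (0 : ℝ) ≤ 1 / (Fintype.card ι : ℝ))]
  exact mul_le_mul_of_nonneg_left (Finset.abs_sum_le_sum_abs _ _) (by positivity)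

/-- The Cauchy–Schwarz inequality for averages. -/
theorem avg_mul_le_sqrt (f g : ι → ℝ) :
    avg (fun i => f i * g i) ≤ √(avg fun i => f i ^ 2) * √(avg fun i => g i ^ 2) := by
  have h := Real.sum_mul_le_sqrt_mul_sqrt Finset.univ f g
  unfold avg
  rw [Real.sqrt_mul (by positivity), Real.sqrt_mul (by positivity)]
  calc _ ≤ 1 / (Fintype.card ι : ℝ) * (√(∑ i, f i ^ 2) * √(∑ i, g i ^ 2)) := by gcongr
    _ = (√(1 / (Fintype.card ι : ℝ)) * √(1 / (Fintype.card ι : ℝ))) *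
        (√(∑ i, f i ^ 2) * √(∑ i, g i ^ 2)) := by
        rw [Real.mul_self_sqrt (by positivity)]
    _ = _ := by ring

theorem sum_mul_avg (f : ι → ℝ) (X : ι → Fin p → ℝ) (u : Fin p → ℝ) :
    ∑ j, u j * avg (fun i => f i * X i j) = avg fun i => f i * (X i ⬝ᵥ u) := by
  unfold avg dotProduct
  simp_rw [Finset.mul_sum]
  rw [Finset.sum_comm]
  exact Finset.sum_congr rfl fun i _ => Finset.sum_congr rfl fun j _ => by ring

theorem abs_sum_mul_le {u g : Fin p → ℝ} {c : ℝ} (h : ∀ j, |g j| ≤ c) :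
    |∑ j, u j * g j| ≤ c * l1 u := by
  have := abs_dotProduct_le (v := u) h
  rwa [dotProduct_comm] at this

end Avg

/-! ### Deterministic bounds for the estimators -/

section Cone

variable {p : ℕ}

theorem l1_add_le (u v : Fin p → ℝ) : l1 (u + v) ≤ l1 u + l1 v := by
  unfold l1
  rw [← Finset.sum_add_distrib]
  exact Finset.sum_le_sum fun j _ => abs_add_le _ _

/-- Let `a` be the `ℓ₁` norm of the increment on the support of `θ`. Off the support the increment
adds its full `ℓ₁` norm. -/
theorem exists_support_bound (θ Δ : Fin p → ℝ) :
    ∃ a, 0 ≤ a ∧ a ≤ l1 Δ ∧ a ^ 2 ≤ l0 θ * l2 Δ ^ 2 ∧ l1 θ - l1 (θ + Δ) ≤ 2 * a - l1 Δ := by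
  classical
  set S : Finset (Fin p) := Finset.univ.filter fun j => θ j ≠ 0 with hS
  have hcard : (l0 θ : ℝ) = S.card := by
    unfold l0
    rw [← Set.ncard_coe_finset]
    congr 2
    ext j; simp [hS]
  refine ⟨∑ j ∈ S, |Δ j|, Finset.sum_nonneg fun _ _ => abs_nonneg _, ?_, ?_, ?_⟩
  · exact Finset.sum_le_sum_of_subset_of_nonneg (Finset.subset_univ _) fun _ _ _ => abs_nonneg _
  · rw [hcard, l2_sq]
    refine (sq_sum_le_card_mul_sum_sq (s := S) (f := fun j => |Δ j|)).trans ?_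
    refine mul_le_mul_of_nonneg_left ?_ (by positivity)
    simp only [sq_abs]
    exact Finset.sum_le_sum_of_subset_of_nonneg (Finset.subset_univ _) fun _ _ _ => sq_nonneg _
  · unfold l1
    rw [hS, Finset.sum_filter, Finset.mul_sum, ← Finset.sum_sub_distrib, ← Finset.sum_sub_distrib]
    refine Finset.sum_le_sum fun j _ => ?_
    simp only [Pi.add_apply]
    by_cases h : θ j = 0
    · simp [h]
    · simp only [ne_eq, h, not_false_eq_true, if_true]
      have := abs_sub_abs_le_abs_sub (θ j) (θ j + Δ j)
      rw [sub_add_cancel_left, abs_neg] at this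
      linarith

/-- The constant in the rates of convergence that come from curvature `c` and noise factor `M`. -/
def rateConst (c M : ℝ) : ℝ := 64 / c * M * (1 + 2 * M) * (1 + 2 / c)

theorem rateConst_nonneg {c M : ℝ} (hc : 0 < c) (hM : 0 ≤ M) : 0 ≤ rateConst c M := by
  unfold rateConst; positivity

/-- The cone condition, restricted curvature and an upper bound on the curvature term give the usual
rates in terms of the sparsity `s` and the penalty level `lam`. Here `L`, `e` and `Q` are the `ℓ₁` norm,
the squared Euclidean norm and the empirical quadratic form of the estimation error. The factor
`1 + A * L` allows for curvature that degrades linearly. -/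
theorem rates_of_cone {c d s M A lam L e Q : ℝ} (hc : 0 < c) (hd : 0 ≤ d) (hs : 0 ≤ s)
    (hM : 0 ≤ M) (hlam : 0 ≤ lam) (hA : 0 ≤ A) (hL : 0 ≤ L)
    (hcone : L ^ 2 ≤ 16 * s * e) (hRE : c * e - d * L ^ 2 ≤ Q) (hsd : 16 * s * d ≤ c / 2)
    (hQ : Q ≤ M * (1 + A * L) * lam * L) (hsm : 64 / c * M * s * lam * A ≤ 1) (he : 0 ≤ e) :
    L ≤ rateConst c M * s * lam ∧ Q ≤ rateConst c M * s * lam ^ 2 ∧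
      e ≤ rateConst c M * s * lam ^ 2 := by
  have h1 : c / 2 * e ≤ Q := by
    have h2 : d * L ^ 2 ≤ c / 2 * e := by
      calc d * L ^ 2 ≤ d * (16 * s * e) := by gcongr
        _ = 16 * s * d * e := by ring
        _ ≤ c / 2 * e := by gcongr
    linarith
  have he2 : e ≤ 2 / c * Q := by
    rw [div_mul_eq_mul_div, le_div_iff₀ hc]; linarith
  set C1 := 64 / c * M * s * lam with hC1
  have hC10 : 0 ≤ C1 := by positivity
  have hL1 : L ≤ C1 := by
    rcases hL.eq_or_lt with h0 | h0
    · rw [← h0]; exact hC10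
    have h3 : L ^ 2 ≤ C1 / 2 * (1 + A * L) * L := by
      calc L ^ 2 ≤ 16 * s * e := hcone
        _ ≤ 16 * s * (2 / c * Q) := by gcongr
        _ ≤ 16 * s * (2 / c * (M * (1 + A * L) * lam * L)) := by gcongr
        _ = C1 / 2 * (1 + A * L) * L := by rw [hC1]; ring
    have h4 : L ≤ C1 / 2 * (1 + A * L) := by
      rw [sq] at h3
      exact le_of_mul_le_mul_right h3 h0
    have h5 : C1 * A * L ≤ 1 * L := by gcongr
    linarith
  have hAL : A * L ≤ 1 := by
    calc A * L ≤ A * C1 := by gcongr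
      _ = C1 * A := mul_comm _ _
      _ ≤ 1 := hsm
  have hQ2 : Q ≤ 2 * M * lam * C1 := by
    calc Q ≤ M * (1 + A * L) * lam * L := hQ
      _ ≤ M * (1 + 1) * lam * C1 := by gcongr
      _ = _ := by ring
  have hK : 0 ≤ 64 / c * M := by positivity
  have hM2 : 0 ≤ 2 / c := by positivity
  have hsl : 0 ≤ s * lam := by positivity
  have hsl2 : 0 ≤ s * lam ^ 2 := by positivity
  refine ⟨hL1.trans ?_, hQ2.trans ?_, (he2.trans (mul_le_mul_of_nonneg_left hQ2 hM2)).trans ?_⟩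
  · have h6 : 1 ≤ (1 + 2 * M) * (1 + 2 / c) := by nlinarith [mul_nonneg hM hM2]
    calc C1 = 64 / c * M * (s * lam) * 1 := by rw [hC1]; ring
      _ ≤ 64 / c * M * (s * lam) * ((1 + 2 * M) * (1 + 2 / c)) := by gcongr
      _ = _ := by unfold rateConst; ring
  · have h6 : 2 * M ≤ (1 + 2 * M) * (1 + 2 / c) := by nlinarith [mul_nonneg hM hM2]
    calc 2 * M * lam * C1 = 64 / c * M * (s * lam ^ 2) * (2 * M) := by rw [hC1]; ring
      _ ≤ 64 / c * M * (s * lam ^ 2) * ((1 + 2 * M) * (1 + 2 / c)) := by gcongr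
      _ = _ := by unfold rateConst; ring
  · have h6 : 2 / c * (2 * M) ≤ (1 + 2 * M) * (1 + 2 / c) := by nlinarith [mul_nonneg hM hM2]
    calc 2 / c * (2 * M * lam * C1) = 64 / c * M * (s * lam ^ 2) * (2 / c * (2 * M)) := by
          rw [hC1]; ring
      _ ≤ 64 / c * M * (s * lam ^ 2) * ((1 + 2 * M) * (1 + 2 / c)) := by gcongr
      _ = _ := by unfold rateConst; ring

theorem continuous_l1 : Continuous (l1 : (Fin p → ℝ) → ℝ) := by unfold l1; fun_prop

theorem norm_le_l1 (t : Fin p → ℝ) : ‖t‖ ≤ l1 t :=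
  (pi_norm_le_iff_of_nonneg (l1_nonneg t)).2 fun j =>
    Finset.single_le_sum (f := fun j => |t j|) (fun _ _ => abs_nonneg _) (Finset.mem_univ j)

/-- A continuous function that grows at least linearly attains its minimum on a nonempty closed
set. -/
theorem exists_isArgmin {f : (Fin p → ℝ) → ℝ} (hf : Continuous f) {s : Set (Fin p → ℝ)}
    (hs : IsClosed s) (hne : s.Nonempty) {c C : ℝ} (hc : 0 < c) (h : ∀ t, c * l1 t - C ≤ f t) :
    ∃ t, IsArgmin f s t := by
  obtain ⟨t0, ht0⟩ := hne
  obtain ⟨t, ht, hmin⟩ := hf.continuousOn.exists_isMinOn' hs ht0 (by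
    refine Filter.Eventually.filter_mono inf_le_left ?_
    filter_upwards [(tendsto_norm_cocompact_atTop (E := Fin p → ℝ)).eventually_ge_atTop
      ((f t0 + C) / c)] with t ht
    rw [div_le_iff₀ hc] at ht
    have := mul_le_mul_of_nonneg_left (norm_le_l1 t) hc.le
    linarith [h t])
  exact ⟨t, ht, hmin⟩

end Cone

section Propensity

variable {p : ℕ} {ι : Type*} [Fintype ι]

/-- The gradient of the covariate-balancing loss. -/
def balanceGrad (x : ι → FullUnit p) (t : Fin p → ℝ) (j : Fin p) : ℝ :=
  avg fun i => (1 - wt (x i) * q (cov (x i) ⬝ᵥ t)) * cov (x i) j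

/-- The covariate-balancing loss. -/
def balanceLoss (x : ι → FullUnit p) (t : Fin p → ℝ) : ℝ :=
  avg fun i => wt (x i) * Real.exp (-(cov (x i) ⬝ᵥ t)) + (1 - wt (x i)) * (cov (x i) ⬝ᵥ t)

theorem balanceObjective_eq (lam : ℝ) (x : ι → FullUnit p) (t : Fin p → ℝ) :
    balanceObjective lam (fun i => covTreat (x i)) t = balanceLoss x t + lam * l1 t := by
  unfold balanceObjective balanceLoss avg covTreat
  congr 2
  refine Finset.sum_congr rfl fun i _ => ?_
  unfold wt
  by_cases h : treat (x i) = true <;> simp [h]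

theorem mem_balanceFeasible_iff (lam : ℝ) (x : ι → FullUnit p) (t : Fin p → ℝ) :
    t ∈ balanceFeasible lam (fun i => covTreat (x i)) ↔ ∀ j, |balanceGrad x t j| ≤ lam := by
  unfold balanceFeasible balanceGrad avg covTreat
  simp only [Set.mem_ofPred_eq]
  refine forall_congr' fun j => ?_
  have : ∀ i, (1 - if treat (x i) = true then q (cov (x i) ⬝ᵥ t) else 0) * cov (x i) j =
      (1 - wt (x i) * q (cov (x i) ⬝ᵥ t)) * cov (x i) j := by
    intro i
    unfold wt
    by_cases h : treat (x i) = true <;> simp [h]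
  simp_rw [this]

theorem continuous_dotProduct_left (y : Fin p → ℝ) : Continuous fun t : Fin p → ℝ => y ⬝ᵥ t := by
  unfold dotProduct; fun_prop

theorem continuous_balanceLoss (x : ι → FullUnit p) : Continuous (balanceLoss x) := by
  have := fun i => continuous_dotProduct_left (cov (x i))
  unfold balanceLoss avg
  fun_prop

theorem continuous_balanceGrad (x : ι → FullUnit p) (j : Fin p) :
    Continuous fun t => balanceGrad x t j := by
  have := fun i => continuous_dotProduct_left (cov (x i))
  unfold balanceGrad avg q
  fun_prop

theorem balanceLoss_add (x : ι → FullUnit p) (θ Δ : Fin p → ℝ) :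
    balanceLoss x (θ + Δ) - balanceLoss x θ = ∑ j, Δ j * balanceGrad x θ j +
      avg fun i => wt (x i) * Real.exp (-(cov (x i) ⬝ᵥ θ)) *
        (Real.exp (-(cov (x i) ⬝ᵥ Δ)) - 1 + cov (x i) ⬝ᵥ Δ) := by
  unfold balanceLoss balanceGrad
  rw [sum_mul_avg, ← avg_sub, ← avg_add]
  congr 1
  ext i
  rw [dotProduct_add, neg_add, Real.exp_add, q]
  ring

theorem sum_mul_balanceGrad_sub (x : ι → FullUnit p) (θ Δ : Fin p → ℝ) :
    ∑ j, Δ j * (balanceGrad x (θ + Δ) j - balanceGrad x θ j) =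
      avg fun i => wt (x i) * Real.exp (-(cov (x i) ⬝ᵥ θ)) *
        ((1 - Real.exp (-(cov (x i) ⬝ᵥ Δ))) * (cov (x i) ⬝ᵥ Δ)) := by
  simp_rw [mul_sub]
  rw [Finset.sum_sub_distrib]
  unfold balanceGrad
  rw [sum_mul_avg, sum_mul_avg, ← avg_sub]
  congr 1
  ext i
  rw [dotProduct_add, q, q, neg_add, Real.exp_add]
  ring

/-- The final propensity estimate converges at the usual sparse rates. If the first estimate violates
the `ℓ₁` constraint the second one, a Dantzig selector, satisfies it since `θ` is feasible. -/
theorem Estimator.thetaHat_rates {lamθ lamβ κ A r c d : ℝ} (E : Estimator ι p lamθ lamβ κ)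
    (x : ι → FullUnit p) {θ : Fin p → ℝ} (hA : 0 ≤ A) (hx : CovBounded A x) (hr : l1 θ ≤ r)
    (hκ : l1 θ < κ) (hlam : 0 < lamθ) (hgrad : ∀ j, |balanceGrad x θ j| ≤ lamθ / 2)
    (hc : 0 < c) (hd : 0 ≤ d) (hRE : RestrictedEig c d x) (hsd : 16 * l0 θ * d ≤ c / 2)
    (hsm : 64 / c * (6 * Real.exp (A * r)) * l0 θ * lamθ * A ≤ 1) :
    l1 (E.thetaHat fun i => covTreat (x i)) ≤ κ ∧
    l1 ((E.thetaHat fun i => covTreat (x i)) - θ) ≤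
      rateConst c (6 * Real.exp (A * r)) * l0 θ * lamθ ∧
    (avg fun i => wt (x i) * (cov (x i) ⬝ᵥ ((E.thetaHat fun i => covTreat (x i)) - θ)) ^ 2) ≤
      rateConst c (6 * Real.exp (A * r)) * l0 θ * lamθ ^ 2 ∧
    l2 ((E.thetaHat fun i => covTreat (x i)) - θ) ^ 2 ≤
      rateConst c (6 * Real.exp (A * r)) * l0 θ * lamθ ^ 2 := by
  set z : ι → CovTreat p := fun i => covTreat (x i) with hz
  -- Both estimators satisfy the cone condition and an upper bound on the curvature term, with the
  -- Bregman divergence of the loss for one and its symmetrised version for the other.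
  have suff : ∀ (Δ : Fin p → ℝ) (φ : ℝ → ℝ), (∀ y, y ^ 2 / (4 * (1 + |y|)) ≤ φ y) →
      (∃ a, a ^ 2 ≤ l0 θ * l2 Δ ^ 2 ∧ 0 ≤ a ∧ l1 Δ ≤ 4 * a) →
      (avg fun i => wt (x i) * Real.exp (-(cov (x i) ⬝ᵥ θ)) * φ (cov (x i) ⬝ᵥ Δ)) ≤
        3 / 2 * lamθ * l1 Δ →
      l1 Δ ≤ rateConst c (6 * Real.exp (A * r)) * l0 θ * lamθ ∧
      (avg fun i => wt (x i) * (cov (x i) ⬝ᵥ Δ) ^ 2) ≤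
        rateConst c (6 * Real.exp (A * r)) * l0 θ * lamθ ^ 2 ∧
      l2 Δ ^ 2 ≤ rateConst c (6 * Real.exp (A * r)) * l0 θ * lamθ ^ 2 := by
    rintro Δ φ hφ ⟨a, ha, ha0, haL⟩ hD
    have hL := l1_nonneg Δ
    refine rates_of_cone (A := A) hc hd (Nat.cast_nonneg _) (by positivity) hlam.le hA hL ?_
      (hRE Δ) hsd ?_ hsm (sq_nonneg _)
    · calc l1 Δ ^ 2 ≤ (4 * a) ^ 2 := pow_le_pow_left₀ hL haL 2
        _ = 16 * a ^ 2 := by ring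
        _ ≤ 16 * (l0 θ * l2 Δ ^ 2) := by gcongr
        _ = _ := by ring
    · have hAL : 0 < 4 * (1 + A * l1 Δ) := by positivity
      have h1 : Real.exp (-(A * r)) / (4 * (1 + A * l1 Δ)) *
          (avg fun i => wt (x i) * (cov (x i) ⬝ᵥ Δ) ^ 2) ≤ 3 / 2 * lamθ * l1 Δ := by
        rw [← avg_const_mul]
        refine (avg_mono fun i => ?_).trans hD
        have h2 : Real.exp (-(A * r)) ≤ Real.exp (-(cov (x i) ⬝ᵥ θ)) := by
          refine Real.exp_le_exp.2 (neg_le_neg ?_)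
          exact (le_abs_self _).trans ((abs_dotProduct_le (hx i)).trans (by gcongr))
        have h3 : (cov (x i) ⬝ᵥ Δ) ^ 2 / (4 * (1 + A * l1 Δ)) ≤ φ (cov (x i) ⬝ᵥ Δ) := by
          refine le_trans ?_ (hφ _)
          have := abs_dotProduct_le (v := Δ) (hx i)
          gcongr
        calc _ = wt (x i) * Real.exp (-(A * r)) *
              ((cov (x i) ⬝ᵥ Δ) ^ 2 / (4 * (1 + A * l1 Δ))) := by ring
          _ ≤ wt (x i) * Real.exp (-(cov (x i) ⬝ᵥ θ)) *
              ((cov (x i) ⬝ᵥ Δ) ^ 2 / (4 * (1 + A * l1 Δ))) := by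
            have := wt_nonneg (x i)
            gcongr
          _ ≤ _ := mul_le_mul_of_nonneg_left h3 (mul_nonneg (wt_nonneg _) (Real.exp_pos _).le)
      rw [div_mul_eq_mul_div, div_le_iff₀ hAL, Real.exp_neg, inv_mul_le_iff₀ (Real.exp_pos _)] at h1
      refine h1.trans (le_of_eq ?_)
      ring
  have hgradD : ∀ Δ : Fin p → ℝ, |∑ j, Δ j * balanceGrad x θ j| ≤ lamθ / 2 * l1 Δ :=
    fun Δ => abs_sum_mul_le hgrad
  -- By convexity of the loss the objective grows at least like `lamθ / 2` times the `ℓ₁` norm, so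
  -- that a minimizer exists.
  have hθcheck := E.thetaCheck_argmin z (by
    refine exists_isArgmin (c := lamθ / 2) (C := lamθ / 2 * l1 θ - balanceLoss x θ) ?_ isClosed_univ
      Set.univ_nonempty (by positivity) fun t => ?_
    · have h1 : balanceObjective lamθ z = fun t => balanceLoss x t + lamθ * l1 t :=
        funext fun t => balanceObjective_eq lamθ x t
      rw [h1]
      exact (continuous_balanceLoss x).add (continuous_const.mul continuous_l1)
    · rw [balanceObjective_eq]
      have h1 := balanceLoss_add x θ (t - θ)
      rw [add_sub_cancel] at h1
      have h2 := (abs_le.1 (hgradD (t - θ))).1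
      have h3 : 0 ≤ avg fun i => wt (x i) * Real.exp (-(cov (x i) ⬝ᵥ θ)) *
          (Real.exp (-(cov (x i) ⬝ᵥ (t - θ))) - 1 + cov (x i) ⬝ᵥ (t - θ)) :=
        avg_nonneg fun i => mul_nonneg (mul_nonneg (wt_nonneg _) (Real.exp_pos _).le)
          (exp_neg_sub_one_add_nonneg _)
      have h4 := l1_sub_le t θ
      nlinarith)
  have hθtilde := E.thetaTilde_argmin z (by
    refine exists_isArgmin (c := 1) (C := 0) continuous_l1 ?_ ⟨θ, ?_⟩ one_pos fun t => by simp
    · have h1 : balanceFeasible lamθ z = ⋂ j, {t | |balanceGrad x t j| ≤ lamθ} := by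
        ext t
        rw [mem_balanceFeasible_iff, Set.mem_iInter]; rfl
      rw [h1]
      exact isClosed_iInter fun j =>
        isClosed_le (continuous_balanceGrad x j).abs continuous_const
    · rw [mem_balanceFeasible_iff]
      exact fun j => (hgrad j).trans (by linarith))
  unfold Estimator.thetaHat finalTheta
  split_ifs with hcase
  · set t := E.thetaTilde z with ht
    have hfeas := (mem_balanceFeasible_iff lamθ x t).1 hθtilde.1
    have hmin : l1 t ≤ l1 θ := hθtilde.2 ((mem_balanceFeasible_iff lamθ x θ).2
      fun j => (hgrad j).trans (by linarith))
    refine ⟨hmin.trans hκ.le, suff (t - θ) (fun y => (1 - Real.exp (-y)) * y)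
      one_sub_exp_neg_mul_ge ?_ ?_⟩
    · obtain ⟨a, ha0, -, ha2, ha3⟩ := exists_support_bound θ (t - θ)
      rw [add_sub_cancel] at ha3
      exact ⟨a, ha2, ha0, by linarith⟩
    · rw [← sum_mul_balanceGrad_sub, add_sub_cancel]
      refine (le_abs_self _).trans (abs_sum_mul_le fun j => ?_)
      refine (abs_sub _ _).trans ?_
      linarith [hfeas j, hgrad j]
  · set t := E.thetaCheck z with ht
    refine ⟨not_lt.1 hcase, suff (t - θ) (fun y => Real.exp (-y) - 1 + y)
      exp_neg_sub_one_add_ge ?_ ?_⟩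
    all_goals
      obtain ⟨a, ha0, haL, ha2, ha3⟩ := exists_support_bound θ (t - θ)
      rw [add_sub_cancel] at ha3
      have hmin : balanceObjective lamθ z t ≤ balanceObjective lamθ z θ :=
        hθcheck.2 (Set.mem_univ θ)
      rw [balanceObjective_eq, balanceObjective_eq] at hmin
      have h1 := balanceLoss_add x θ (t - θ)
      rw [add_sub_cancel] at h1
      have h2 := (abs_le.1 (hgradD (t - θ))).1
      have h5 : lamθ * (l1 θ - l1 t) ≤ lamθ * (2 * a - l1 (t - θ)) := by gcongr
    · have h3 : 0 ≤ avg fun i => wt (x i) * Real.exp (-(cov (x i) ⬝ᵥ θ)) *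
          (Real.exp (-(cov (x i) ⬝ᵥ (t - θ))) - 1 + cov (x i) ⬝ᵥ (t - θ)) :=
        avg_nonneg fun i => mul_nonneg (mul_nonneg (wt_nonneg _) (Real.exp_pos _).le)
          (exp_neg_sub_one_add_nonneg _)
      refine ⟨a, ha2, ha0, ?_⟩
      have h6 : lamθ * l1 (t - θ) ≤ lamθ * (4 * a) := by linarith
      exact le_of_mul_le_mul_left h6 hlam
    · have h7 : lamθ * (2 * a - l1 (t - θ)) ≤ lamθ * l1 (t - θ) := by gcongr; linarith
      linarith

end Propensity

section Outcome

variable {p : ℕ} {ι : Type*} [Fintype ι]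

/-- The outcome loss at `b`, with weights from the propensity estimate `t`. It is written in terms of
the errors `ε = Y(1) - X'β`, since only treated units have positive weight. -/
def outcomeLoss (x : ι → FullUnit p) (t β b : Fin p → ℝ) : ℝ :=
  avg fun i => wt (x i) * Real.exp (-(cov (x i) ⬝ᵥ t)) * (eps β (x i) - cov (x i) ⬝ᵥ (b - β)) ^ 2

theorem outcomeObjective_eq (lam : ℝ) (x : ι → FullUnit p) (t β b : Fin p → ℝ) :
    outcomeObjective lam (fun i => observed (x i)) t b = outcomeLoss x t β b + lam * l1 b := by
  unfold outcomeObjective outcomeLoss avg observed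
  congr 2
  refine Finset.sum_congr rfl fun i _ => ?_
  unfold wt eps yObs
  by_cases h : treat (x i) = true
  · simp only [h, if_true, dotProduct_sub, one_mul]
    congr 2; ring
  · simp [h]

/-- The first-order condition for a quadratic plus `lam |y|` to be minimal at zero. -/
theorem abs_le_half_of_quadratic {g G lam : ℝ} (hG : 0 ≤ G)
    (h : ∀ y : ℝ, 0 ≤ -2 * y * g + y ^ 2 * G + lam * |y|) : |g| ≤ lam / 2 := by
  by_contra! hc
  set D := 2 * |g| - lam with hD
  have hD0 : 0 < D := by rw [hD]; linarith
  set η := D / (G + 1) with hη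
  have hη0 : 0 < η := by positivity
  have h1 : η * (D - η * G) ≤ 0 := by
    rcases abs_cases g with ⟨h2, -⟩ | ⟨h2, -⟩
    · have := h η
      rw [abs_of_pos hη0] at this
      rw [hD, h2]; nlinarith
    · have := h (-η)
      rw [abs_neg, abs_of_pos hη0] at this
      rw [hD, h2]; nlinarith
  have h2 : η * G < D := by
    rw [hη, div_mul_eq_mul_div, div_lt_iff₀ (by linarith)]; nlinarith
  nlinarith

/-- The weighted lasso for the outcome converges at the usual sparse rates; the last statement comes
from its optimality conditions. -/
theorem Estimator.betaHat_rates {lamθ lamβ κ A c d : ℝ} (E : Estimator ι p lamθ lamβ κ)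
    (x : ι → FullUnit p) {β : Fin p → ℝ} (hA : 0 ≤ A) (hx : CovBounded A x) (hlam : 0 < lamβ)
    (hκ : l1 (E.thetaHat fun i => covTreat (x i)) ≤ κ)
    (hnoise : ∀ j, |avg fun i => wt (x i) *
      Real.exp (-(cov (x i) ⬝ᵥ E.thetaHat fun i => covTreat (x i))) * eps β (x i) * cov (x i) j| ≤
        lamβ / 4)
    (hc : 0 < c) (hd : 0 ≤ d) (hRE : RestrictedEig c d x) (hsd : 16 * l0 β * d ≤ c / 2) :
    l1 ((E.betaHat fun i => observed (x i)) - β) ≤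
      rateConst c (3 / 2 * Real.exp (A * κ)) * l0 β * lamβ ∧
    (avg fun i => wt (x i) * (cov (x i) ⬝ᵥ ((E.betaHat fun i => observed (x i)) - β)) ^ 2) ≤
      rateConst c (3 / 2 * Real.exp (A * κ)) * l0 β * lamβ ^ 2 ∧
    l2 ((E.betaHat fun i => observed (x i)) - β) ^ 2 ≤
      rateConst c (3 / 2 * Real.exp (A * κ)) * l0 β * lamβ ^ 2 ∧
    ∀ j, |avg fun i => wt (x i) *
      Real.exp (-(cov (x i) ⬝ᵥ E.thetaHat fun i => covTreat (x i))) *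
        (cov (x i) ⬝ᵥ ((E.betaHat fun i => observed (x i)) - β)) * cov (x i) j| ≤ lamβ := by
  set t : Fin p → ℝ := E.thetaHat fun i => covTreat (x i) with ht
  have hbeta := E.betaHat_argmin (fun i => observed (x i))
  change (∃ b, IsArgmin (outcomeObjective lamβ (fun i => observed (x i)) t) Set.univ b) →
    IsArgmin (outcomeObjective lamβ (fun i => observed (x i)) t) Set.univ
      (E.betaHat fun i => observed (x i)) at hbeta
  set b := E.betaHat fun i => observed (x i) with hb
  set w : ι → ℝ := fun i => wt (x i) * Real.exp (-(cov (x i) ⬝ᵥ t)) with hw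
  have hw0 : ∀ i, 0 ≤ w i := fun i => mul_nonneg (wt_nonneg _) (Real.exp_pos _).le
  have hmin := hbeta (by
    refine exists_isArgmin (c := lamβ) (C := 0) ?_ isClosed_univ Set.univ_nonempty hlam fun b => ?_
    · have h1 : outcomeObjective lamβ (fun i => observed (x i)) t =
          fun b => outcomeLoss x t β b + lamβ * l1 b :=
        funext fun b => outcomeObjective_eq lamβ x t β b
      have h2 := fun i => continuous_dotProduct_left (cov (x i))
      have h3 : ∀ i, Continuous fun b : Fin p → ℝ => cov (x i) ⬝ᵥ (b - β) :=
        fun i => (h2 i).comp (continuous_id.sub continuous_const)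
      rw [h1]
      refine Continuous.add ?_ (continuous_const.mul continuous_l1)
      unfold outcomeLoss avg
      fun_prop
    · rw [outcomeObjective_eq lamβ x t β b, sub_zero]
      exact le_add_of_nonneg_left (avg_nonneg fun i => mul_nonneg (hw0 i) (sq_nonneg _)))
  have hmin' : ∀ b', outcomeLoss x t β b + lamβ * l1 b ≤ outcomeLoss x t β b' + lamβ * l1 b' := by
    intro b'
    have := hmin.2 (Set.mem_univ b')
    simp only at this
    rwa [Set.mem_ofPred_eq, outcomeObjective_eq lamβ x t β b,
      outcomeObjective_eq lamβ x t β b'] at this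
  set δ := b - β with hδ
  have hKKT : ∀ j, |avg fun i => w i * (eps β (x i) - cov (x i) ⬝ᵥ δ) * cov (x i) j| ≤ lamβ / 2 := by
    intro j
    refine abs_le_half_of_quadratic (G := avg fun i => w i * cov (x i) j ^ 2)
      (avg_nonneg fun i => mul_nonneg (hw0 i) (sq_nonneg _)) fun y => ?_
    have h1 := hmin' (b + Pi.single j y)
    have h2 : outcomeLoss x t β (b + Pi.single j y) = outcomeLoss x t β b +
        (-2 * y * (avg fun i => w i * (eps β (x i) - cov (x i) ⬝ᵥ δ) * cov (x i) j) +
          y ^ 2 * avg fun i => w i * cov (x i) j ^ 2) := by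
      unfold outcomeLoss
      rw [← avg_const_mul, ← avg_const_mul, ← avg_add, ← avg_add]
      congr 1
      ext i
      have h3 : cov (x i) ⬝ᵥ (b + Pi.single j y - β) = cov (x i) ⬝ᵥ δ + cov (x i) j * y := by
        rw [add_sub_right_comm, dotProduct_add, dotProduct_single]
      rw [h3]
      simp only [hw]
      ring
    have h4 : l1 (b + Pi.single j y) ≤ l1 b + |y| := by
      refine (l1_add_le _ _).trans ?_
      gcongr
      unfold l1
      rw [Finset.sum_eq_single j]
      · simp
      · intro k _ hk; simp [hk]
      · simp
    have h5 : lamβ * l1 (b + Pi.single j y) ≤ lamβ * (l1 b + |y|) := by gcongr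
    linarith
  have hlin : |∑ j, δ j * avg (fun i => w i * eps β (x i) * cov (x i) j)| ≤ lamβ / 4 * l1 δ :=
    abs_sum_mul_le hnoise
  rw [sum_mul_avg] at hlin
  have hbasic : (avg fun i => w i * (cov (x i) ⬝ᵥ δ) ^ 2) ≤
      lamβ / 2 * l1 δ + lamβ * (l1 β - l1 b) := by
    have h1 := hmin' β
    have h2 : outcomeLoss x t β b = outcomeLoss x t β β -
        2 * (avg fun i => w i * eps β (x i) * (cov (x i) ⬝ᵥ δ)) +
          avg fun i => w i * (cov (x i) ⬝ᵥ δ) ^ 2 := by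
      unfold outcomeLoss
      rw [← avg_const_mul, ← avg_sub, ← avg_add]
      congr 1
      ext i
      rw [sub_self, dotProduct_zero]
      simp only [hw, ← hδ]
      ring
    have h3 := (abs_le.1 hlin).2
    linarith
  obtain ⟨a, ha0, haL, ha2, ha3⟩ := exists_support_bound β δ
  rw [hδ, add_sub_cancel, ← hδ] at ha3
  have h5 : lamβ * (l1 β - l1 b) ≤ lamβ * (2 * a - l1 δ) := by gcongr
  have hq0 : 0 ≤ avg fun i => w i * (cov (x i) ⬝ᵥ δ) ^ 2 :=
    avg_nonneg fun i => mul_nonneg (hw0 i) (sq_nonneg _)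
  have hL := l1_nonneg δ
  have hLa : l1 δ ≤ 4 * a := by
    have h6 : lamβ * l1 δ ≤ lamβ * (4 * a) := by linarith
    exact le_of_mul_le_mul_left h6 hlam
  have hup : (avg fun i => w i * (cov (x i) ⬝ᵥ δ) ^ 2) ≤ 3 / 2 * lamβ * l1 δ := by
    have h7 : lamβ * (2 * a - l1 δ) ≤ lamβ * l1 δ := by gcongr; linarith
    linarith
  have hlow : Real.exp (-(A * κ)) * (avg fun i => wt (x i) * (cov (x i) ⬝ᵥ δ) ^ 2) ≤
      avg fun i => w i * (cov (x i) ⬝ᵥ δ) ^ 2 := by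
    rw [← avg_const_mul]
    refine avg_mono fun i => ?_
    have h2 : Real.exp (-(A * κ)) ≤ Real.exp (-(cov (x i) ⬝ᵥ t)) := by
      refine Real.exp_le_exp.2 (neg_le_neg ?_)
      exact (le_abs_self _).trans ((abs_dotProduct_le (hx i)).trans (by gcongr))
    have h3 := wt_nonneg (x i)
    calc _ = wt (x i) * Real.exp (-(A * κ)) * (cov (x i) ⬝ᵥ δ) ^ 2 := by ring
      _ ≤ _ := by simp only [hw]; gcongr
  -- The outcome loss is quadratic: its curvature does not degrade.
  have hrates := rates_of_cone (A := 0) (s := (l0 β : ℝ)) (M := 3 / 2 * Real.exp (A * κ))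
    (lam := lamβ) hc hd (Nat.cast_nonneg _) (by positivity) hlam.le le_rfl hL
    (by
      calc l1 δ ^ 2 ≤ (4 * a) ^ 2 := pow_le_pow_left₀ hL hLa 2
        _ = 16 * a ^ 2 := by ring
        _ ≤ 16 * (l0 β * l2 δ ^ 2) := by gcongr
        _ = _ := by ring) (hRE δ) hsd
    (by
      have h8 := hlow.trans hup
      rw [Real.exp_neg, inv_mul_le_iff₀ (Real.exp_pos _)] at h8
      refine h8.trans (le_of_eq ?_)
      ring) (by simp) (sq_nonneg _)
  refine ⟨hrates.1, hrates.2.1, hrates.2.2, fun j => ?_⟩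
  have h9 : (avg fun i => w i * (cov (x i) ⬝ᵥ δ) * cov (x i) j) =
      (avg fun i => w i * eps β (x i) * cov (x i) j) -
        avg fun i => w i * (eps β (x i) - cov (x i) ⬝ᵥ δ) * cov (x i) j := by
    rw [← avg_sub]; congr 1; ext i; ring
  rw [h9]
  refine (abs_sub _ _).trans ?_
  have h10 := hnoise j
  have h11 := hKKT j
  simp only [hw] at h11 ⊢
  linarith

end Outcome

/-! ### Decomposition of the estimation error on a fold -/

section Decomposition

variable {p : ℕ} {ι ι' : Type*} [Fintype ι] [Fintype ι']

/-- The population counterpart of `avg (W exp (-X'θ) (X'u) Xⱼ)`, the Hessian of the balancing loss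
at `θ` applied to `u`. -/
def hessian (P : Measure (FullUnit p)) (θ u : Fin p → ℝ) (j : Fin p) : ℝ :=
  ∫ o, wt o * Real.exp (-(cov o ⬝ᵥ θ)) * (cov o ⬝ᵥ u) * cov o j ∂P

/-- The difference between the fold average of the doubly robust scores at the estimates `t` and `b`
and the one at the true parameters. -/
def foldError (x : ι → FullUnit p) (θ β t b : Fin p → ℝ) : ℝ :=
  avg (fun i => cov (x i) ⬝ᵥ b + (1 + Real.exp (-(cov (x i) ⬝ᵥ t))) * wt (x i) *
    (yObs (x i) - cov (x i) ⬝ᵥ b)) -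
  avg (fun i => wt (x i) * eps β (x i) * q (cov (x i) ⬝ᵥ θ) + cov (x i) ⬝ᵥ β)

/-- The error consists of two terms that are centred, one given the other fold and one given the
design, and of an interaction of the two estimation errors. -/
theorem foldError_eq (x : ι → FullUnit p) (θ β t b : Fin p → ℝ) :
    foldError x θ β t b =
      avg (fun i => (1 - wt (x i) * q (cov (x i) ⬝ᵥ θ)) * (cov (x i) ⬝ᵥ (b - β))) +
      avg (fun i => wt (x i) * (q (cov (x i) ⬝ᵥ t) - q (cov (x i) ⬝ᵥ θ)) * eps β (x i)) +
      avg (fun i => wt (x i) * Real.exp (-(cov (x i) ⬝ᵥ θ)) *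
        (1 - Real.exp (-(cov (x i) ⬝ᵥ (t - θ)))) * (cov (x i) ⬝ᵥ (b - β))) := by
  unfold foldError
  rw [← avg_sub, ← avg_add, ← avg_add]
  congr 1
  ext i
  have h1 : wt (x i) * yObs (x i) = wt (x i) * (eps β (x i) + cov (x i) ⬝ᵥ β) := by
    unfold wt yObs eps
    by_cases h : treat (x i) = true <;> simp [h]
  have h2 : Real.exp (-(cov (x i) ⬝ᵥ t)) =
      Real.exp (-(cov (x i) ⬝ᵥ θ)) * Real.exp (-(cov (x i) ⬝ᵥ (t - θ))) := by
    rw [← Real.exp_add, dotProduct_sub]; congr 1; ring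
  unfold q
  rw [dotProduct_sub (cov (x i)) b β]
  have h3 : (1 + Real.exp (-(cov (x i) ⬝ᵥ t))) * wt (x i) * (yObs (x i) - cov (x i) ⬝ᵥ b) =
      (1 + Real.exp (-(cov (x i) ⬝ᵥ t))) *
        (wt (x i) * (eps β (x i) + cov (x i) ⬝ᵥ β) - wt (x i) * (cov (x i) ⬝ᵥ b)) := by
    rw [← h1]; ring
  rw [h3, h2]
  ring

/-- The interaction of the two estimation errors. Its leading part is `δ'ĤΔ` with the Hessian of the
fold `x`. Because `δ` is independent of `x` and `Δ` of `y`, it may be replaced by the Hessian of the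
fold `y`, and there the optimality conditions of the outcome lasso bound `Ĥδ`. -/
theorem abs_interaction_le {P : Measure (FullUnit p)} {x : ι → FullUnit p} {y : ι' → FullUnit p}
    {θ t t' δ : Fin p → ℝ} {A κ mδ mΔ cx cy lam : ℝ} (hA : 0 ≤ A) (hx : CovBounded A x)
    (hy : CovBounded A y) (hθ : l1 θ ≤ κ) (ht : l1 t ≤ κ) (ht' : l1 t' ≤ κ)
    (hmδ : ∀ i, |cov (x i) ⬝ᵥ δ| ≤ mδ) (hmΔ : ∀ i, |cov (y i) ⬝ᵥ (t - θ)| ≤ mΔ)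
    (hmΔ0 : 0 ≤ mΔ)
    (hcx : ∀ j, |avg (fun i => wt (x i) * Real.exp (-(cov (x i) ⬝ᵥ θ)) * (cov (x i) ⬝ᵥ δ) *
      cov (x i) j) - hessian P θ δ j| ≤ cx)
    (hcy : ∀ j, |avg (fun i => wt (y i) * Real.exp (-(cov (y i) ⬝ᵥ θ)) * (cov (y i) ⬝ᵥ (t - θ)) *
      cov (y i) j) - hessian P θ (t - θ) j| ≤ cy)
    (hsymm : ∑ j, (t - θ) j * hessian P θ δ j = ∑ j, δ j * hessian P θ (t - θ) j)
    (hKKT : ∀ j, |avg fun i => wt (y i) * Real.exp (-(cov (y i) ⬝ᵥ t')) * (cov (y i) ⬝ᵥ δ) *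
      cov (y i) j| ≤ lam) :
    |avg fun i => wt (x i) * Real.exp (-(cov (x i) ⬝ᵥ θ)) *
        (1 - Real.exp (-(cov (x i) ⬝ᵥ (t - θ)))) * (cov (x i) ⬝ᵥ δ)| ≤
      cx * l1 (t - θ) + cy * l1 δ + lam * l1 (t - θ) +
      Real.exp (3 * (A * κ)) * mΔ * (√(avg fun i => wt (y i) * (cov (y i) ⬝ᵥ (t' - θ)) ^ 2) *
        √(avg fun i => wt (y i) * (cov (y i) ⬝ᵥ δ) ^ 2)) +
      Real.exp (3 * (A * κ)) * mδ * avg fun i => wt (x i) * (cov (x i) ⬝ᵥ (t - θ)) ^ 2 := by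
  set Δ := t - θ with hΔ
  set Δ' := t' - θ with hΔ'
  have hκ2 : ∀ u, l1 u ≤ κ → l1 (u - θ) ≤ 2 * κ := fun u hu => by
    linarith [l1_sub_le u θ]
  have hexpθ : ∀ z : Fin p → ℝ, (∀ j, |z j| ≤ A) → Real.exp (-(z ⬝ᵥ θ)) ≤ Real.exp (A * κ) := by
    intro z hz
    refine Real.exp_le_exp.2 ((neg_le_abs _).trans ((abs_dotProduct_le hz).trans ?_))
    gcongr
  have hexpΔ : ∀ z : Fin p → ℝ, (∀ j, |z j| ≤ A) → ∀ u, l1 u ≤ κ →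
      Real.exp |z ⬝ᵥ (u - θ)| ≤ Real.exp (2 * (A * κ)) := by
    intro z hz u hu
    refine Real.exp_le_exp.2 ((abs_dotProduct_le hz).trans ?_)
    calc A * l1 (u - θ) ≤ A * (2 * κ) := by gcongr; exact hκ2 u hu
      _ = _ := by ring
  have hexp3 : Real.exp (A * κ) * Real.exp (2 * (A * κ)) = Real.exp (3 * (A * κ)) := by
    rw [← Real.exp_add]; congr 1; ring
  set Hx : (Fin p → ℝ) → Fin p → ℝ := fun u j => avg fun i =>
    wt (x i) * Real.exp (-(cov (x i) ⬝ᵥ θ)) * (cov (x i) ⬝ᵥ u) * cov (x i) j with hHx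
  set Hy : (Fin p → ℝ) → Fin p → ℝ := fun u j => avg fun i =>
    wt (y i) * Real.exp (-(cov (y i) ⬝ᵥ θ)) * (cov (y i) ⬝ᵥ u) * cov (y i) j with hHy
  set Gy : Fin p → ℝ := fun j => avg fun i =>
    wt (y i) * Real.exp (-(cov (y i) ⬝ᵥ t')) * (cov (y i) ⬝ᵥ δ) * cov (y i) j with hGy
  -- Linearise the exponential on `x`, then pass from the Hessian of `x` to that of `y` through the
  -- population Hessian, and on `y` from the weights at `θ` to those at `t'`.
  have hsplit : (avg fun i => wt (x i) * Real.exp (-(cov (x i) ⬝ᵥ θ)) *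
        (1 - Real.exp (-(cov (x i) ⬝ᵥ Δ))) * (cov (x i) ⬝ᵥ δ)) =
      ∑ j, Δ j * (Hx δ j - hessian P θ δ j) - ∑ j, δ j * (Hy Δ j - hessian P θ Δ j) +
      ∑ j, Δ j * Gy j +
      (avg fun i => wt (y i) * Real.exp (-(cov (y i) ⬝ᵥ θ)) *
        (1 - Real.exp (-(cov (y i) ⬝ᵥ Δ'))) * (cov (y i) ⬝ᵥ Δ) * (cov (y i) ⬝ᵥ δ)) -
      avg fun i => wt (x i) * Real.exp (-(cov (x i) ⬝ᵥ θ)) *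
        (Real.exp (-(cov (x i) ⬝ᵥ Δ)) - 1 + cov (x i) ⬝ᵥ Δ) * (cov (x i) ⬝ᵥ δ) := by
    simp_rw [mul_sub]
    rw [Finset.sum_sub_distrib, Finset.sum_sub_distrib, hsymm]
    simp only [hHx, hHy, hGy]
    rw [sum_mul_avg, sum_mul_avg, sum_mul_avg]
    have h1 : (avg fun i => wt (x i) * Real.exp (-(cov (x i) ⬝ᵥ θ)) * (cov (x i) ⬝ᵥ δ) *
        (cov (x i) ⬝ᵥ Δ)) - (avg fun i => wt (x i) * Real.exp (-(cov (x i) ⬝ᵥ θ)) *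
        (Real.exp (-(cov (x i) ⬝ᵥ Δ)) - 1 + cov (x i) ⬝ᵥ Δ) * (cov (x i) ⬝ᵥ δ)) =
        avg fun i => (wt (x i) * Real.exp (-(cov (x i) ⬝ᵥ θ)) * 1 -
        wt (x i) * Real.exp (-(cov (x i) ⬝ᵥ θ)) * Real.exp (-(cov (x i) ⬝ᵥ Δ))) *
          (cov (x i) ⬝ᵥ δ) := by
      rw [← avg_sub]; congr 1; ext i; ring
    have h2 : (avg fun i => wt (y i) * Real.exp (-(cov (y i) ⬝ᵥ t')) * (cov (y i) ⬝ᵥ δ) *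
        (cov (y i) ⬝ᵥ Δ)) + (avg fun i => (wt (y i) * Real.exp (-(cov (y i) ⬝ᵥ θ)) * 1 -
        wt (y i) * Real.exp (-(cov (y i) ⬝ᵥ θ)) * Real.exp (-(cov (y i) ⬝ᵥ Δ'))) *
          (cov (y i) ⬝ᵥ Δ) * (cov (y i) ⬝ᵥ δ)) =
        avg fun i => wt (y i) * Real.exp (-(cov (y i) ⬝ᵥ θ)) * (cov (y i) ⬝ᵥ Δ) *
          (cov (y i) ⬝ᵥ δ) := by
      rw [← avg_add]; congr 1; ext i
      have h3 : Real.exp (-(cov (y i) ⬝ᵥ t')) =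
          Real.exp (-(cov (y i) ⬝ᵥ θ)) * Real.exp (-(cov (y i) ⬝ᵥ Δ')) := by
        rw [← Real.exp_add, hΔ', dotProduct_sub]; congr 1; ring
      rw [h3]; ring
    linarith
  have hb1 : |∑ j, Δ j * (Hx δ j - hessian P θ δ j)| ≤ cx * l1 Δ := abs_sum_mul_le hcx
  have hb2 : |∑ j, δ j * (Hy Δ j - hessian P θ Δ j)| ≤ cy * l1 δ := abs_sum_mul_le hcy
  have hb3 : |∑ j, Δ j * Gy j| ≤ lam * l1 Δ := abs_sum_mul_le hKKT
  have hb4 : |avg fun i => wt (y i) * Real.exp (-(cov (y i) ⬝ᵥ θ)) *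
        (1 - Real.exp (-(cov (y i) ⬝ᵥ Δ'))) * (cov (y i) ⬝ᵥ Δ) * (cov (y i) ⬝ᵥ δ)| ≤
      Real.exp (3 * (A * κ)) * mΔ * (√(avg fun i => wt (y i) * (cov (y i) ⬝ᵥ Δ') ^ 2) *
        √(avg fun i => wt (y i) * (cov (y i) ⬝ᵥ δ) ^ 2)) := by
    have h1 : ∀ u : Fin p → ℝ, (avg fun i => wt (y i) * (cov (y i) ⬝ᵥ u) ^ 2) =
        avg fun i => (wt (y i) * |cov (y i) ⬝ᵥ u|) ^ 2 := fun u => by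
      congr 1; ext i; rw [mul_pow, wt_sq, sq_abs]
    rw [h1, h1]
    refine le_trans ?_ (mul_le_mul_of_nonneg_left (avg_mul_le_sqrt _ _) (by positivity))
    rw [← avg_const_mul]
    refine (abs_avg_le _).trans (avg_mono fun i => ?_)
    rw [abs_mul, abs_mul, abs_mul, abs_mul, abs_of_nonneg (wt_nonneg _), Real.abs_exp,
      abs_sub_comm]
    have h2 := abs_exp_neg_sub_one_le (cov (y i) ⬝ᵥ Δ')
    have h3 := hexpθ _ (hy i)
    have h4 := hexpΔ _ (hy i) t' ht'
    have h5 := wt_nonneg (y i)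
    have h6 := hmΔ i
    calc wt (y i) * Real.exp (-(cov (y i) ⬝ᵥ θ)) * |Real.exp (-(cov (y i) ⬝ᵥ Δ')) - 1| *
          |cov (y i) ⬝ᵥ Δ| * |cov (y i) ⬝ᵥ δ|
        ≤ wt (y i) * Real.exp (A * κ) * (|cov (y i) ⬝ᵥ Δ'| * Real.exp (2 * (A * κ))) *
          mΔ * |cov (y i) ⬝ᵥ δ| := by
          gcongr
          exact h2.trans (by gcongr)
      _ = Real.exp (3 * (A * κ)) * mΔ * (wt (y i) * |cov (y i) ⬝ᵥ Δ'| * |cov (y i) ⬝ᵥ δ|) := by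
          rw [← hexp3]; ring
      _ = Real.exp (3 * (A * κ)) * mΔ *
          (wt (y i) * |cov (y i) ⬝ᵥ Δ'| * (wt (y i) * |cov (y i) ⬝ᵥ δ|)) := by
          congr 1
          nth_rewrite 1 [← wt_sq (y i)]
          ring
  have hb5 : |avg fun i => wt (x i) * Real.exp (-(cov (x i) ⬝ᵥ θ)) *
        (Real.exp (-(cov (x i) ⬝ᵥ Δ)) - 1 + cov (x i) ⬝ᵥ Δ) * (cov (x i) ⬝ᵥ δ)| ≤
      Real.exp (3 * (A * κ)) * mδ * avg fun i => wt (x i) * (cov (x i) ⬝ᵥ Δ) ^ 2 := by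
    rw [← avg_const_mul]
    refine (abs_avg_le _).trans (avg_mono fun i => ?_)
    rw [abs_mul, abs_mul, abs_mul, abs_of_nonneg (wt_nonneg _), Real.abs_exp,
      abs_of_nonneg (exp_neg_sub_one_add_nonneg _)]
    have h2 := exp_neg_sub_one_add_le (cov (x i) ⬝ᵥ Δ)
    have h3 := hexpθ _ (hx i)
    have h4 := hexpΔ _ (hx i) t ht
    have h5 := wt_nonneg (x i)
    have h6 := hmδ i
    have h7 := exp_neg_sub_one_add_nonneg (cov (x i) ⬝ᵥ Δ)
    calc wt (x i) * Real.exp (-(cov (x i) ⬝ᵥ θ)) *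
          (Real.exp (-(cov (x i) ⬝ᵥ Δ)) - 1 + cov (x i) ⬝ᵥ Δ) * |cov (x i) ⬝ᵥ δ|
        ≤ wt (x i) * Real.exp (A * κ) * ((cov (x i) ⬝ᵥ Δ) ^ 2 * Real.exp (2 * (A * κ))) * mδ := by
          gcongr
          exact h2.trans (by gcongr)
      _ = _ := by rw [← hexp3]; ring
  rw [hsplit]
  refine (abs_sub _ _).trans (add_le_add ((abs_add_le _ _).trans (add_le_add
    ((abs_add_le _ _).trans (add_le_add ((abs_sub _ _).trans (add_le_add hb1 hb2)) hb3)) hb4)) hb5)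

theorem Model.sum_mul_hessian_comm {B : Bounds} {P : Measure (FullUnit p)}
    [IsProbabilityMeasure P] {θ β : Fin p → ℝ} (h : Model B P θ β) (u v : Fin p → ℝ) :
    ∑ j, v j * hessian P θ u j = ∑ j, u j * hessian P θ v j := by
  have hm : ∀ u : Fin p → ℝ, ∀ j, Measurable fun o : FullUnit p =>
      wt o * Real.exp (-(cov o ⬝ᵥ θ)) * (cov o ⬝ᵥ u) * cov o j := fun u j =>
    ((measurable_wt.mul (measurable_cov_dot θ).neg.exp).mul (measurable_cov_dot u)).mul
      (measurable_cov_apply j)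
  have hi : ∀ u : Fin p → ℝ, ∀ j, Integrable (fun o : FullUnit p =>
      wt o * Real.exp (-(cov o ⬝ᵥ θ)) * (cov o ⬝ᵥ u) * cov o j) P := fun u j =>
    h.integrable_of_bound (c := 1 * Real.exp (B.radius * l1 θ) * (B.radius * l1 u) * B.radius)
      (hm u j) fun o ho => by
        have hr := B.one_le_radius
        have hu := l1_nonneg u
        rw [abs_mul, abs_mul, abs_mul, abs_of_nonneg (wt_nonneg o), Real.abs_exp]
        have h1 := wt_le_one o
        have h2 := abs_dotProduct_le (v := u) ho
        have h3 : Real.exp (-(cov o ⬝ᵥ θ)) ≤ Real.exp (B.radius * l1 θ) :=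
          Real.exp_le_exp.2 ((neg_le_abs _).trans (abs_dotProduct_le ho))
        have h4 := ho j
        gcongr
  have key : ∀ u v : Fin p → ℝ, ∑ j, v j * hessian P θ u j =
      ∫ o, wt o * Real.exp (-(cov o ⬝ᵥ θ)) * (cov o ⬝ᵥ u) * (cov o ⬝ᵥ v) ∂P := by
    intro u v
    unfold hessian
    simp_rw [← integral_const_mul]
    rw [← integral_finsetSum _ fun j _ => (hi u j).const_mul _]
    refine integral_congr_ae (Eventually.of_forall fun o => ?_)
    simp only
    rw [show cov o ⬝ᵥ v = ∑ j, cov o j * v j from rfl, Finset.mul_sum]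
    exact Finset.sum_congr rfl fun j _ => by ring
  rw [key, key]
  refine integral_congr_ae (Eventually.of_forall fun o => ?_)
  simp only; ring

end Decomposition

/-! ### Probabilities of the exceptional events on one fold -/

section OneFold

variable {B : Bounds} {p : ℕ} {P : Measure (FullUnit p)} [IsProbabilityMeasure P]
  {θ β : Fin p → ℝ} {ι : Type*} [Fintype ι]

theorem natCast_mul_two_mul_exp_le {m : ℕ} (hm : 1 ≤ m) {y : ℝ} (hy : 2 * Real.log m ≤ y) :
    (m : ENNReal) * (2 * ENNReal.ofReal (Real.exp (-y))) ≤ ENNReal.ofReal (2 / m) := by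
  have hm0 : (0 : ℝ) < m := by exact_mod_cast hm
  have h1 : Real.exp (-y) ≤ 1 / (m : ℝ) ^ 2 := by
    rw [one_div, ← Real.exp_log (pow_pos hm0 2), ← Real.exp_neg, Real.log_pow]
    exact Real.exp_le_exp.2 (by push_cast; linarith)
  calc (m : ENNReal) * (2 * ENNReal.ofReal (Real.exp (-y)))
      ≤ m * (2 * ENNReal.ofReal (1 / (m : ℝ) ^ 2)) := by gcongr
    _ = ENNReal.ofReal (m * (2 * (1 / (m : ℝ) ^ 2))) := by
        rw [ENNReal.ofReal_mul hm0.le, ENNReal.ofReal_natCast, ENNReal.ofReal_mul (by norm_num),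
          ENNReal.ofReal_ofNat]
    _ = ENNReal.ofReal (2 / m) := by congr 1; field_simp

/-- An almost sure bound on the residuals `(1 - W q(X'θ)) Xⱼ` of the balancing equations. -/
def Bounds.scoreBound (B : Bounds) : ℝ := (1 + Real.exp (B.radius * B.r)) * B.radius

theorem Bounds.scoreBound_pos (B : Bounds) : 0 < B.scoreBound := by
  have := B.one_le_radius
  unfold Bounds.scoreBound; positivity

theorem Model.exp_neg_dot_le (h : Model B P θ β) {z : Fin p → ℝ} (hz : ∀ j, |z j| ≤ B.radius) :
    Real.exp (-(z ⬝ᵥ θ)) ≤ Real.exp (B.radius * B.r) := by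
  have := B.one_le_radius
  refine Real.exp_le_exp.2 ((neg_le_abs _).trans ((abs_dotProduct_le hz).trans ?_))
  gcongr
  exact h.theta_mem

theorem Model.abs_one_sub_wt_mul_q_le (h : Model B P θ β) {o : FullUnit p}
    (ho : ∀ j, |cov o j| ≤ B.radius) :
    |1 - wt o * q (cov o ⬝ᵥ θ)| ≤ 1 + Real.exp (B.radius * B.r) := by
  have h1 := h.exp_neg_dot_le ho
  have h2 := Real.exp_pos (-(cov o ⬝ᵥ θ))
  unfold wt q
  split_ifs
  · rw [abs_le]; constructor <;> linarith
  · rw [zero_mul, sub_zero, abs_one]; linarith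

theorem measurable_one_sub_wt_mul_q (θ : Fin p → ℝ) :
    Measurable fun o : FullUnit p => 1 - wt o * q (cov o ⬝ᵥ θ) := by
  have h1 := measurable_wt (p := p)
  have h2 := measurable_cov_dot θ
  unfold q; fun_prop

theorem abs_avg_lt_iff [Nonempty ι] (f : ι → ℝ) (c : ℝ) :
    c < |avg f| ↔ Fintype.card ι * c < |∑ i, f i| := by
  have hb : (0 : ℝ) < Fintype.card ι := by exact_mod_cast Fintype.card_pos
  unfold avg
  rw [abs_mul, abs_of_pos (by positivity), one_div, ← div_eq_inv_mul, lt_div_iff₀ hb, mul_comm]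

/-- The balancing equations hold approximately at `θ`. -/
theorem Model.measure_balanceGrad_gt_le (h : Model B P θ β) [Nonempty ι] (hp : 1 ≤ p) {lam : ℝ}
    (hlam : 0 ≤ lam)
    (hlog : 640 * B.scoreBound ^ 2 * Real.log p ≤ Fintype.card ι * lam ^ 2) :
    Measure.pi (fun _ : ι => P) {x | CovBounded B.radius x ∧
      ∃ j, lam / 2 < |balanceGrad x θ j|} ≤
      ENNReal.ofReal (2 / p) + ENNReal.ofReal ((2 / Real.exp 1) ^ Fintype.card ι) := by
  have hb : (0 : ℝ) < Fintype.card ι := by exact_mod_cast Fintype.card_pos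
  have hpsi : Psi2LE P (fun _ => (1 : ℝ)) 2 := by
    unfold Psi2LE
    rw [lintegral_const, measure_univ, mul_one]
    have h1 : Real.exp (1 ^ 2 / 2 ^ 2) ≤ 2 := by
      have h2 : Real.exp (1 / 2) ≤ 2 := by
        have h3 := Real.exp_one_lt_d9
        have h4 : Real.exp (1 / 2) ^ 2 = Real.exp 1 := by rw [← Real.exp_nat_mul]; norm_num
        nlinarith [Real.exp_pos (1 / 2)]
      refine le_trans (Real.exp_le_exp.2 (by norm_num)) h2
    calc ENNReal.ofReal _ ≤ ENNReal.ofReal 2 := ENNReal.ofReal_le_ofReal h1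
      _ = 2 := by simp
  have hα := B.scoreBound_pos
  have key := h.measure_exists_abs_sum_sub_ge_le (ι := ι) (J := Fin p) (Y := fun _ => (1 : ℝ))
    measurable_const two_pos hpsi
    (g := fun j o => (1 - wt o * q (cov o ⬝ᵥ θ)) * cov o j)
    (fun j => (measurable_one_sub_wt_mul_q θ).mul (measurable_cov_apply j)) hα
    (fun j o ho => by
      rw [abs_one, mul_one, abs_mul]
      exact mul_le_mul (h.abs_one_sub_wt_mul_q_le ho) (ho j) (abs_nonneg _) (by positivity))
    (t := Fintype.card ι * (lam / 2)) (by positivity)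
  have hzero : ∀ j, ∫ o, (1 - wt o * q (cov o ⬝ᵥ θ)) * cov o j ∂P = 0 := fun j =>
    h.integral_one_sub_wt_mul_q (g := fun x => x j) (measurable_pi_apply j) fun x hx => hx j
  simp only [hzero, sub_zero, Fintype.card_fin] at key
  refine (measure_mono ?_).trans (key.trans (add_le_add ?_ le_rfl))
  · rintro x ⟨hx, j, hj⟩
    refine ⟨hx, j, ?_⟩
    exact ((abs_avg_lt_iff _ _).1 hj).le
  · refine natCast_mul_two_mul_exp_le hp ?_
    rw [le_div_iff₀ (by positivity)]
    nlinarith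

/-- The constant in the bounds for statistics of one fold that involve an estimate from the
other. -/
def Bounds.crossConst (B : Bounds) : ℝ := 9 * B.scoreBound * B.KX

/-- The bounds that hold with high probability on a fold `x` for a vector `u` that does not depend on
the fold: on the empirical Hessian applied to `u`, on the linear combinations `X'u` and on the balancing
equation in the direction `u`. -/
structure CrossGood (B : Bounds) (P : Measure (FullUnit p)) (θ : Fin p → ℝ) (ρ τ : ℝ)
    (x : ι → FullUnit p) (u : Fin p → ℝ) : Prop where
  hessian : ∀ j, |avg (fun i => wt (x i) * Real.exp (-(cov (x i) ⬝ᵥ θ)) * (cov (x i) ⬝ᵥ u) *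
      cov (x i) j) - hessian P θ u j| ≤ B.crossConst * ρ * l2 u
  max : ∀ i, |cov (x i) ⬝ᵥ u| ≤ B.KX * l2 u * τ
  score : |avg fun i => (1 - wt (x i) * q (cov (x i) ⬝ᵥ θ)) * (cov (x i) ⬝ᵥ u)| ≤
    B.crossConst * τ * l2 u / √(Fintype.card ι)

theorem CrossGood.of_zero {P : Measure (FullUnit p)} {ρ τ : ℝ} (x : ι → FullUnit p)
    {u : Fin p → ℝ} (hu : l2 u = 0) : CrossGood B P θ ρ τ x u := by
  have := eq_zero_of_l2_eq_zero hu
  subst this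
  constructor
  · intro j; simp [SparseDR.hessian, avg, hu]
  · intro i; simp [hu]
  · simp [avg, hu]

theorem avg_sub_const [Nonempty ι] (f : ι → ℝ) (c : ℝ) :
    avg f - c = avg fun i => f i - c := by
  have hb : (Fintype.card ι : ℝ) ≠ 0 := by exact_mod_cast Fintype.card_ne_zero
  rw [avg_sub]
  congr 1
  unfold avg
  simp [hb]

theorem Model.measure_not_crossGood_le (h : Model B P θ β) [Nonempty ι] (hp : 1 ≤ p) {ρ τ : ℝ}
    (hρ : 0 ≤ ρ) (hτ : 0 ≤ τ) (hρ2 : Real.log p ≤ 2 * (Fintype.card ι * ρ ^ 2))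
    (hτ2 : 2 * Real.log (Fintype.card ι) ≤ τ ^ 2) (u : Fin p → ℝ) :
    Measure.pi (fun _ : ι => P) {x | CovBounded B.radius x ∧ ¬ CrossGood B P θ ρ τ x u} ≤
      ENNReal.ofReal (2 / p) + ENNReal.ofReal (4 / Fintype.card ι) +
        2 * ENNReal.ofReal ((2 / Real.exp 1) ^ Fintype.card ι) := by
  rcases (l2_nonneg u).eq_or_lt with hu | hu
  · have h1 : {x : ι → FullUnit p | CovBounded B.radius x ∧ ¬ CrossGood B P θ ρ τ x u} = ∅ := by
      rw [Set.eq_empty_iff_forall_notMem]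
      rintro x ⟨-, hx⟩
      exact hx (CrossGood.of_zero x hu.symm)
    rw [h1]; simp
  have hb : (0 : ℝ) < Fintype.card ι := by exact_mod_cast Fintype.card_pos
  have hb1 : 1 ≤ Fintype.card ι := Fintype.card_pos
  set b : ℝ := (Fintype.card ι : ℝ) with hbd
  have hA := B.one_le_radius
  have hK : 0 < B.KX * l2 u := mul_pos B.KX_pos hu
  have hKX := B.KX_pos
  have hsc := B.scoreBound_pos
  have hcc : 0 < B.crossConst := by unfold Bounds.crossConst; positivity
  have hpsi := h.psi2LE_cov_dot hu
  set T1 : Set (ι → FullUnit p) := {x | CovBounded B.radius x ∧ ∃ j, b * (B.crossConst * ρ * l2 u) ≤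
    |∑ i, (wt (x i) * Real.exp (-(cov (x i) ⬝ᵥ θ)) * (cov (x i) ⬝ᵥ u) * cov (x i) j -
      SparseDR.hessian P θ u j)|}
  set T2 : Set (ι → FullUnit p) := {x | ∃ i, B.KX * l2 u * τ ≤ |cov (x i) ⬝ᵥ u|}
  set T3 : Set (ι → FullUnit p) := {x | CovBounded B.radius x ∧ ∃ _ : Unit,
    b * (B.crossConst * τ * l2 u / √b) ≤
    |∑ i, ((1 - wt (x i) * q (cov (x i) ⬝ᵥ θ)) * (cov (x i) ⬝ᵥ u) -
      ∫ o, (1 - wt o * q (cov o ⬝ᵥ θ)) * (cov o ⬝ᵥ u) ∂P)|}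
  have hzero : ∫ o, (1 - wt o * q (cov o ⬝ᵥ θ)) * (cov o ⬝ᵥ u) ∂P = 0 :=
    h.integral_one_sub_wt_mul_q (g := fun x => x ⬝ᵥ u) (measurable_dotProduct_const u)
      fun x hx => abs_dotProduct_le hx
  have hsub : {x : ι → FullUnit p | CovBounded B.radius x ∧ ¬ CrossGood B P θ ρ τ x u} ⊆
      T1 ∪ T2 ∪ T3 := by
    rintro x ⟨hx, hng⟩
    by_contra hnot
    simp only [Set.mem_union, not_or] at hnot
    obtain ⟨⟨n1, n2⟩, n3⟩ := hnot
    refine hng ⟨fun j => ?_, fun i => ?_, ?_⟩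
    · by_contra! hc
      refine n1 ⟨hx, j, ?_⟩
      rw [avg_sub_const, abs_avg_lt_iff] at hc
      exact hc.le
    · by_contra! hc
      exact n2 ⟨i, hc.le⟩
    · by_contra! hc
      refine n3 ⟨hx, (), ?_⟩
      rw [abs_avg_lt_iff] at hc
      simp only [hzero, sub_zero]
      exact hc.le
  have hm1 : ∀ j, Measurable fun o : FullUnit p =>
      wt o * Real.exp (-(cov o ⬝ᵥ θ)) * (cov o ⬝ᵥ u) * cov o j := fun j =>
    ((measurable_wt.mul (measurable_cov_dot θ).neg.exp).mul (measurable_cov_dot u)).mul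
      (measurable_cov_apply j)
  have k1 : Measure.pi (fun _ : ι => P) T1 ≤ ENNReal.ofReal (2 / p) +
      ENNReal.ofReal ((2 / Real.exp 1) ^ Fintype.card ι) := by
    have key := h.measure_exists_abs_sum_sub_ge_le (ι := ι) (J := Fin p)
      (measurable_cov_dot u) hK hpsi hm1 hsc (fun j o ho => by
        rw [abs_mul, abs_mul, abs_mul, abs_of_nonneg (wt_nonneg o), Real.abs_exp]
        have h1 := wt_le_one o
        have h2 := h.exp_neg_dot_le ho
        have h4 := ho j
        have h3 : 1 * Real.exp (B.radius * B.r) * |cov o ⬝ᵥ u| * B.radius ≤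
            B.scoreBound * |cov o ⬝ᵥ u| := by
          unfold Bounds.scoreBound
          nlinarith [abs_nonneg (cov o ⬝ᵥ u),
            mul_nonneg (abs_nonneg (cov o ⬝ᵥ u)) (zero_le_one.trans hA)]
        refine le_trans ?_ h3
        gcongr) (t := b * (B.crossConst * ρ * l2 u)) (by positivity)
    rw [Fintype.card_fin] at key
    refine key.trans (add_le_add (natCast_mul_two_mul_exp_le hp ?_) le_rfl)
    rw [le_div_iff₀ (by positivity)]
    have hlog : 0 ≤ Real.log p := Real.log_natCast_nonneg p
    calc 2 * Real.log p * (20 * B.scoreBound ^ 2 * (b * (B.KX * l2 u) ^ 2))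
        = 40 * Real.log p * (B.scoreBound ^ 2 * B.KX ^ 2 * b * l2 u ^ 2) := by ring
      _ ≤ 40 * (2 * (b * ρ ^ 2)) * (B.scoreBound ^ 2 * B.KX ^ 2 * b * l2 u ^ 2) := by gcongr
      _ ≤ 81 * (b * ρ ^ 2) * (B.scoreBound ^ 2 * B.KX ^ 2 * b * l2 u ^ 2) := by
          have : 0 ≤ b * ρ ^ 2 := by positivity
          exact mul_le_mul_of_nonneg_right (by linarith) (by positivity)
      _ = (b * (B.crossConst * ρ * l2 u)) ^ 2 := by unfold Bounds.crossConst; ring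
  have k2 : Measure.pi (fun _ : ι => P) T2 ≤ ENNReal.ofReal (2 / b) :=
    (h.measure_exists_abs_cov_dot_ge_le hu hτ).trans (natCast_mul_two_mul_exp_le hb1 hτ2)
  have k3 : Measure.pi (fun _ : ι => P) T3 ≤ ENNReal.ofReal (2 / b) +
      ENNReal.ofReal ((2 / Real.exp 1) ^ Fintype.card ι) := by
    have key := h.measure_exists_abs_sum_sub_ge_le (ι := ι) (J := Unit)
      (measurable_cov_dot u) hK hpsi
      (g := fun _ o => (1 - wt o * q (cov o ⬝ᵥ θ)) * (cov o ⬝ᵥ u))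
      (fun _ => (measurable_one_sub_wt_mul_q θ).mul (measurable_cov_dot u)) hsc (fun j o ho => by
        rw [abs_mul]
        refine mul_le_mul_of_nonneg_right ((h.abs_one_sub_wt_mul_q_le ho).trans ?_) (abs_nonneg _)
        unfold Bounds.scoreBound
        nlinarith [Real.exp_pos (B.radius * B.r)])
      (t := b * (B.crossConst * τ * l2 u / √b)) (by positivity)
    refine key.trans (add_le_add ?_ le_rfl)
    refine le_trans ?_ (natCast_mul_two_mul_exp_le (y := τ ^ 2) hb1 hτ2)
    rw [Fintype.card_unit]
    have hexp : τ ^ 2 ≤ (b * (B.crossConst * τ * l2 u / √b)) ^ 2 /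
        (20 * B.scoreBound ^ 2 * (b * (B.KX * l2 u) ^ 2)) := by
      rw [le_div_iff₀ (by positivity)]
      have h1 : (b * (B.crossConst * τ * l2 u / √b)) ^ 2 =
          b * (B.crossConst * τ * l2 u) ^ 2 := by
        rw [mul_pow, div_pow, Real.sq_sqrt hb.le]; field_simp
      rw [h1]
      unfold Bounds.crossConst
      have : 0 ≤ τ ^ 2 * B.scoreBound ^ 2 * b * B.KX ^ 2 * l2 u ^ 2 := by positivity
      nlinarith
    gcongr
  refine (measure_mono hsub).trans ((measure_union_le _ _).trans
    ((add_le_add ((measure_union_le _ _).trans (add_le_add k1 k2)) k3).trans (le_of_eq ?_)))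
  have h4 : ENNReal.ofReal (4 / b) = ENNReal.ofReal (2 / b) + ENNReal.ofReal (2 / b) := by
    rw [← ENNReal.ofReal_add (by positivity) (by positivity)]; congr 1; ring
  rw [h4, two_mul]
  abel

theorem Estimator.measurable_thetaHat {lamθ lamβ κ : ℝ} (E : Estimator ι p lamθ lamβ κ) :
    Measurable E.thetaHat := by
  unfold Estimator.thetaHat finalTheta
  have h1 : Measurable fun d => l1 (E.thetaCheck d) :=
    continuous_l1.measurable.comp E.measurable_thetaCheck
  exact Measurable.ite (measurableSet_lt measurable_const h1) E.measurable_thetaTilde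
    E.measurable_thetaCheck

/-- The treatment indicator of an observation without outcomes. -/
def covTreatWt (z : CovTreat p) : ℝ := if z.2 then 1 else 0

theorem covTreatWt_covTreat (o : FullUnit p) : covTreatWt (covTreat o) = wt o := rfl

theorem measurable_covTreatWt : Measurable (covTreatWt : CovTreat p → ℝ) :=
  Measurable.ite (measurable_snd (measurableSet_singleton true)) measurable_const measurable_const

theorem measurable_dotProduct_pair {Ω : Type*} [MeasurableSpace Ω] {f g : Ω → Fin p → ℝ}
    (hf : Measurable f) (hg : Measurable g) : Measurable fun ω => f ω ⬝ᵥ g ω := by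
  unfold dotProduct
  exact Finset.measurable_sum _ fun j _ =>
    ((measurable_pi_apply j).comp hf).mul ((measurable_pi_apply j).comp hg)

/-- The noise in the optimality conditions of the outcome lasso. -/
theorem Model.measure_noise_gt_le (h : Model B P θ β) [Nonempty ι] (hp : 1 ≤ p)
    {lamθ lamβ κ : ℝ} (E : Estimator ι p lamθ lamβ κ) (hlam : 0 ≤ lamβ)
    (hlog : 256 * (B.radius * Real.exp (B.radius * κ)) ^ 2 * B.Keps ^ 2 * Real.log p ≤
      Fintype.card ι * lamβ ^ 2) :
    Measure.pi (fun _ : ι => P) {x | CovBounded B.radius x ∧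
      l1 (E.thetaHat fun i => covTreat (x i)) ≤ κ ∧ ∃ j, lamβ / 4 < |avg fun i => wt (x i) *
      Real.exp (-(cov (x i) ⬝ᵥ E.thetaHat fun i => covTreat (x i))) * eps β (x i) * cov (x i) j|} ≤
      ENNReal.ofReal (2 / p) + 2 * ENNReal.ofReal ((2 / Real.exp 1) ^ Fintype.card ι) := by
  have hA := B.one_le_radius
  have hb : (0 : ℝ) < Fintype.card ι := by exact_mod_cast Fintype.card_pos
  have hK := B.Keps_pos
  set α := B.radius * Real.exp (B.radius * κ) with hα
  have hα0 : 0 < α := by positivity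
  set a : Fin p → ι → (ι → CovTreat p) → ℝ := fun j i z =>
    covTreatWt (z i) * Real.exp (-((z i).1 ⬝ᵥ E.thetaHat z)) * (z i).1 j with ha
  have ham : ∀ j i, Measurable (a j i) := by
    intro j i
    have h1 : Measurable fun z : ι → CovTreat p => (z i).1 :=
      measurable_fst.comp (measurable_pi_apply i)
    exact ((measurable_covTreatWt.comp (measurable_pi_apply i)).mul
      (measurable_dotProduct_pair h1 E.measurable_thetaHat).neg.exp).mul
      ((measurable_pi_apply j).comp h1)
  have key := h.measure_exists_abs_sum_eps_ge_le (ι := ι) ham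
    (t := Fintype.card ι * (lamβ / 4)) (by positivity) hα0
  rw [Fintype.card_fin] at key
  refine (measure_mono ?_).trans (key.trans (add_le_add (natCast_mul_two_mul_exp_le hp ?_) le_rfl))
  · rintro x ⟨hx, hκ, j, hj⟩
    refine ⟨j, fun i => ?_, ?_⟩
    · simp only [ha]
      rw [abs_mul, abs_mul, covTreatWt_covTreat, abs_of_nonneg (wt_nonneg _), Real.abs_exp, hα]
      have h1 := wt_le_one (x i)
      have h2 : Real.exp (-((covTreat (x i)).1 ⬝ᵥ E.thetaHat fun l => covTreat (x l))) ≤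
          Real.exp (B.radius * κ) :=
        Real.exp_le_exp.2 ((neg_le_abs _).trans ((abs_dotProduct_le (hx i)).trans (by gcongr)))
      have h3 := hx i j
      calc _ ≤ 1 * Real.exp (B.radius * κ) * B.radius := by gcongr; exact h3
        _ = _ := by ring
    · rw [abs_avg_lt_iff] at hj
      refine hj.le.trans (le_of_eq ?_)
      congr 1
      refine Finset.sum_congr rfl fun i _ => ?_
      simp only [ha, covTreatWt_covTreat]
      simp only [covTreat]
      ring
  · rw [le_div_iff₀ (by positivity)]
    nlinarith

/-- The term of the error of a fold that is centred given the design. -/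
theorem Model.measure_residual_gt_le (h : Model B P θ β) [Nonempty ι]
    {lamθ lamβ κ : ℝ} (E : Estimator ι p lamθ lamβ κ) {η t : ℝ} (hη : 0 < η) (ht : 0 ≤ t) :
    Measure.pi (fun _ : ι => P) {x |
      (∀ i, |wt (x i) * (q (cov (x i) ⬝ᵥ E.thetaHat fun i => covTreat (x i)) -
        q (cov (x i) ⬝ᵥ θ))| ≤ η) ∧
      t / √(Fintype.card ι) < |avg fun i => wt (x i) *
        (q (cov (x i) ⬝ᵥ E.thetaHat fun i => covTreat (x i)) - q (cov (x i) ⬝ᵥ θ)) *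
          eps β (x i)|} ≤
      2 * ENNReal.ofReal (Real.exp (-(t ^ 2 / (8 * η ^ 2 * B.Keps ^ 2)))) +
        2 * ENNReal.ofReal ((2 / Real.exp 1) ^ Fintype.card ι) := by
  have hb : (0 : ℝ) < Fintype.card ι := by exact_mod_cast Fintype.card_pos
  have hK := B.Keps_pos
  set a : Unit → ι → (ι → CovTreat p) → ℝ := fun _ i z =>
    covTreatWt (z i) * (q ((z i).1 ⬝ᵥ E.thetaHat z) - q ((z i).1 ⬝ᵥ θ)) with ha
  have ham : ∀ j i, Measurable (a j i) := by
    intro j i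
    have h1 : Measurable fun z : ι → CovTreat p => (z i).1 :=
      measurable_fst.comp (measurable_pi_apply i)
    have h2 := measurable_dotProduct_pair h1 E.measurable_thetaHat
    have h3 := measurable_dotProduct_pair h1 (measurable_const (a := θ))
    refine (measurable_covTreatWt.comp (measurable_pi_apply i)).mul ?_
    unfold q
    fun_prop
  have key := h.measure_exists_abs_sum_eps_ge_le (ι := ι) ham
    (t := Fintype.card ι * (t / √(Fintype.card ι))) (by positivity) hη
  have hexp : (Fintype.card ι * (t / √(Fintype.card ι))) ^ 2 /
      (8 * η ^ 2 * (Fintype.card ι * B.Keps ^ 2)) = t ^ 2 / (8 * η ^ 2 * B.Keps ^ 2) := by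
    rw [mul_pow, div_pow, Real.sq_sqrt hb.le]; field_simp
  rw [Fintype.card_unit, Nat.cast_one, one_mul, hexp] at key
  refine (measure_mono ?_).trans key
  rintro x ⟨hx, hj⟩
  refine ⟨(), hx, ?_⟩
  rw [abs_avg_lt_iff] at hj
  exact hj.le

end OneFold

/-! ### Sample splitting -/

section Splitting

variable {n p : ℕ} {P : Measure (FullUnit p)} [IsProbabilityMeasure P]

/-- The units of the fold `F`. -/
def foldSample (F : Finset (Fin n)) (S : Fin n → FullUnit p) : F → FullUnit p := fun i => S i

theorem measurable_foldSample (F : Finset (Fin n)) :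
    Measurable (foldSample F : (Fin n → FullUnit p) → F → FullUnit p) :=
  measurable_pi_lambda _ fun _ => measurable_pi_apply _

theorem iIndepFun_sampleLaw :
    iIndepFun (fun (i : Fin n) (S : Fin n → FullUnit p) => S i) (sampleLaw n P) :=
  iIndepFun_pi (X := fun _ o => o) fun _ => aemeasurable_id

theorem sampleLaw_map_foldSample (F : Finset (Fin n)) :
    (sampleLaw n P).map (foldSample F) = Measure.pi fun _ : F => P := by
  have : IsProbabilityMeasure (sampleLaw n P) := by unfold sampleLaw; infer_instance
  have h1 := (iIndepFun_sampleLaw (P := P) (n := n)).precomp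
    (g := fun i : F => (i : Fin n)) Subtype.val_injective
  have h2 := (iIndepFun_iff_map_fun_eq_pi_map
    (fun i : F => (measurable_pi_apply (i : Fin n)).aemeasurable)).1 h1
  refine h2.trans ?_
  congr 1
  ext1 i
  exact (measurePreserving_eval (fun _ : Fin n => P) (i : Fin n)).map_eq

theorem sampleLaw_map_foldSample_pair {F G : Finset (Fin n)} (hFG : Disjoint F G) :
    (sampleLaw n P).map (fun S => (foldSample G S, foldSample F S)) =
      (Measure.pi fun _ : G => P).prod (Measure.pi fun _ : F => P) := by
  have : IsProbabilityMeasure (sampleLaw n P) := by unfold sampleLaw; infer_instance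
  have h1 := (iIndepFun_sampleLaw (P := P) (n := n)).indepFun_finset G F hFG.symm
    fun i => measurable_pi_apply i
  have h2 := (indepFun_iff_map_prod_eq_prod_map_map (measurable_foldSample G).aemeasurable
    (measurable_foldSample F).aemeasurable).1 h1
  rw [sampleLaw_map_foldSample, sampleLaw_map_foldSample] at h2
  exact h2

theorem sampleLaw_foldSample_le (F : Finset (Fin n)) (s : Set (F → FullUnit p)) :
    sampleLaw n P {S | foldSample F S ∈ s} ≤ Measure.pi (fun _ : F => P) s := by
  rw [← sampleLaw_map_foldSample (P := P) F]
  exact Measure.le_map_apply (measurable_foldSample F).aemeasurable s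

/-- If an event that involves the fold `F` and a fixed parameter has probability at most `η` for each
value of the parameter, then so it does when the parameter is estimated from a disjoint fold. -/
theorem sampleLaw_crossFit_le {F G : Finset (Fin n)} (hFG : Disjoint F G) {V : Type*}
    [MeasurableSpace V] {u : (G → FullUnit p) → V} (hu : Measurable u)
    {s : Set ((F → FullUnit p) × V)} (hs : MeasurableSet s) {η : ENNReal}
    (hη : ∀ v, Measure.pi (fun _ : F => P) {x | (x, v) ∈ s} ≤ η) :
    sampleLaw n P {S | (foldSample F S, u (foldSample G S)) ∈ s} ≤ η := by
  set T : Set ((G → FullUnit p) × (F → FullUnit p)) := {z | (z.2, u z.1) ∈ s} with hT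
  have hTm : MeasurableSet T := by
    have : Measurable fun z : (G → FullUnit p) × (F → FullUnit p) => (z.2, u z.1) :=
      measurable_snd.prodMk (hu.comp measurable_fst)
    exact this hs
  have h1 : sampleLaw n P {S | (foldSample F S, u (foldSample G S)) ∈ s} =
      ((sampleLaw n P).map fun S => (foldSample G S, foldSample F S)) T :=
    (Measure.map_apply ((measurable_foldSample G).prodMk (measurable_foldSample F)) hTm).symm
  rw [h1, sampleLaw_map_foldSample_pair hFG, Measure.prod_apply hTm]
  calc ∫⁻ y, Measure.pi (fun _ : F => P) (Prod.mk y ⁻¹' T) ∂(Measure.pi fun _ : G => P)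
      ≤ ∫⁻ _, η ∂(Measure.pi fun _ : G => P) := lintegral_mono fun y => hη (u y)
    _ = η := by rw [lintegral_const, measure_univ, mul_one]

end Splitting

section Measurability

variable {p : ℕ} {ι : Type*} [Fintype ι]

theorem measurable_l2 : Measurable (l2 : (Fin p → ℝ) → ℝ) := by
  unfold l2
  fun_prop

theorem measurable_hessian (P : Measure (FullUnit p)) [IsProbabilityMeasure P] (θ : Fin p → ℝ)
    (j : Fin p) : Measurable fun u => hessian P θ u j := by
  unfold hessian
  refine (StronglyMeasurable.integral_prod_right
    (f := fun (u : Fin p → ℝ) (o : FullUnit p) =>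
      wt o * Real.exp (-(cov o ⬝ᵥ θ)) * (cov o ⬝ᵥ u) * cov o j) ?_).measurable
  refine Measurable.stronglyMeasurable ?_
  refine Measurable.mul (Measurable.mul (Measurable.mul (measurable_wt.comp measurable_snd)
    ((measurable_cov_dot θ).comp measurable_snd).neg.exp) ?_)
    ((measurable_cov_apply j).comp measurable_snd)
  exact measurable_dotProduct_pair (measurable_cov.comp measurable_snd) measurable_fst

theorem measurable_avg {Ω : Type*} [MeasurableSpace Ω] {f : ι → Ω → ℝ}
    (hf : ∀ i, Measurable (f i)) : Measurable fun ω => avg fun i => f i ω := by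
  unfold avg
  exact (Finset.measurable_sum _ fun i _ => hf i).const_mul _

theorem measurableSet_not_crossGood (B : Bounds) (P : Measure (FullUnit p)) [IsProbabilityMeasure P]
    (θ : Fin p → ℝ) (ρ τ : ℝ) :
    MeasurableSet {z : (ι → FullUnit p) × (Fin p → ℝ) |
      CovBounded B.radius z.1 ∧ ¬ CrossGood B P θ ρ τ z.1 z.2} := by
  have hx : ∀ i, Measurable fun z : (ι → FullUnit p) × (Fin p → ℝ) => z.1 i := fun i =>
    (measurable_pi_apply i).comp measurable_fst
  have hw : ∀ i, Measurable fun z : (ι → FullUnit p) × (Fin p → ℝ) => wt (z.1 i) := fun i =>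
    measurable_wt.comp (hx i)
  have hc : ∀ i j, Measurable fun z : (ι → FullUnit p) × (Fin p → ℝ) => cov (z.1 i) j :=
    fun i j => (measurable_cov_apply j).comp (hx i)
  have hθ : ∀ i, Measurable fun z : (ι → FullUnit p) × (Fin p → ℝ) => cov (z.1 i) ⬝ᵥ θ :=
    fun i => (measurable_cov_dot θ).comp (hx i)
  have hu : ∀ i, Measurable fun z : (ι → FullUnit p) × (Fin p → ℝ) => cov (z.1 i) ⬝ᵥ z.2 :=
    fun i => measurable_dotProduct_pair (measurable_cov.comp (hx i)) measurable_snd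
  have hl : Measurable fun z : (ι → FullUnit p) × (Fin p → ℝ) => l2 z.2 :=
    measurable_l2.comp measurable_snd
  have hH : ∀ j, Measurable fun z : (ι → FullUnit p) × (Fin p → ℝ) => hessian P θ z.2 j :=
    fun j => (measurable_hessian P θ j).comp measurable_snd
  refine MeasurableSet.inter ?_ (MeasurableSet.compl ?_)
  · have : {z : (ι → FullUnit p) × (Fin p → ℝ) | CovBounded B.radius z.1} =
        ⋂ i, ⋂ j, {z | |cov (z.1 i) j| ≤ B.radius} := by
      ext z; simp [CovBounded]
    change MeasurableSet {z : (ι → FullUnit p) × (Fin p → ℝ) | CovBounded B.radius z.1}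
    rw [this]
    exact MeasurableSet.iInter fun i => MeasurableSet.iInter fun j =>
      measurableSet_le (measurable_abs.comp (hc i j)) measurable_const
  · have : {z : (ι → FullUnit p) × (Fin p → ℝ) | CrossGood B P θ ρ τ z.1 z.2} =
        (⋂ j, {z | |avg (fun i => wt (z.1 i) * Real.exp (-(cov (z.1 i) ⬝ᵥ θ)) *
          (cov (z.1 i) ⬝ᵥ z.2) * cov (z.1 i) j) - hessian P θ z.2 j| ≤
            B.crossConst * ρ * l2 z.2}) ∩
        (⋂ i, {z | |cov (z.1 i) ⬝ᵥ z.2| ≤ B.KX * l2 z.2 * τ}) ∩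
        {z | |avg fun i => (1 - wt (z.1 i) * q (cov (z.1 i) ⬝ᵥ θ)) * (cov (z.1 i) ⬝ᵥ z.2)| ≤
          B.crossConst * τ * l2 z.2 / √(Fintype.card ι)} := by
      ext z
      simp only [Set.mem_ofPred_eq, Set.mem_inter_iff, Set.mem_iInter]
      exact ⟨fun h => ⟨⟨h.hessian, h.max⟩, h.score⟩, fun h => ⟨h.1.1, h.1.2, h.2⟩⟩
    change MeasurableSet {z : (ι → FullUnit p) × (Fin p → ℝ) | CrossGood B P θ ρ τ z.1 z.2}
    rw [this]
    refine ((MeasurableSet.iInter fun j => measurableSet_le ?_ ?_).inter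
      (MeasurableSet.iInter fun i => measurableSet_le ?_ ?_)).inter (measurableSet_le ?_ ?_)
    · exact measurable_abs.comp ((measurable_avg fun i =>
        (((hw i).mul (hθ i).neg.exp).mul (hu i)).mul (hc i j)).sub (hH j))
    · exact hl.const_mul _
    · exact measurable_abs.comp (hu i)
    · exact (hl.const_mul _).mul_const _
    · refine measurable_abs.comp (measurable_avg fun i => Measurable.mul ?_ (hu i))
      unfold q
      exact ((hw i).mul ((hθ i).neg.exp.const_add 1)).const_sub 1
    · exact (hl.const_mul _).div_const _

theorem measurable_thetaHat_foldSample {lamθ lamβ κ : ℝ} (E : Estimator ι p lamθ lamβ κ) :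
    Measurable fun x : ι → FullUnit p => E.thetaHat fun i => covTreat (x i) :=
  E.measurable_thetaHat.comp (measurable_pi_lambda _ fun i =>
    measurable_covTreat.comp (measurable_pi_apply i))

theorem measurable_observed : Measurable (observed : FullUnit p → Observed p) :=
  measurable_cov.prodMk (measurable_treat.prodMk
    (Measurable.ite (measurable_treat (measurableSet_singleton true)) measurable_y1
      (measurable_fst.comp (measurable_snd.comp measurable_snd))))

theorem measurable_betaHat_foldSample {lamθ lamβ κ : ℝ} (E : Estimator ι p lamθ lamβ κ) :
    Measurable fun x : ι → FullUnit p => E.betaHat fun i => observed (x i) :=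
  E.measurable_betaHat.comp (measurable_pi_lambda _ fun i =>
    measurable_observed.comp (measurable_pi_apply i))

end Measurability

/-! ### The error of a fold -/

section FoldError

variable {p : ℕ} {ι ι' : Type*} [Fintype ι] [Fintype ι']

/-- The bound on the error of a fold multiplied by the square root `√N` of the fold size. Here `C` is
the constant in the rates of the estimators and `ω` bounds the term that is centred given the design.
With `s` and `s'` the sparsities of `θ` and `β` and `ρ² = log p / n`, the arguments `X`, `a` and `Y`
stand for `√N s ρ²`, `s' ρ²` and `N^{1/4} s' ρ²`. -/
def errorBound (B : Bounds) (κ C τ ω X a Y : ℝ) : ℝ :=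
  B.crossConst * (τ * √(C * a)) + ω + B.crossConst * √(C * a) * (C * X) +
    B.crossConst * (C * √(C * X)) * Y + C ^ 2 * X +
    2 * (Real.exp (3 * (B.radius * κ)) * B.KX) * (τ * √(C * a)) * (C * X)

theorem Bounds.crossConst_nonneg (B : Bounds) : 0 ≤ B.crossConst := by
  have := B.scoreBound_pos
  have := B.KX_pos
  unfold Bounds.crossConst; positivity

/-- The error of a fold is small when the estimators attain their rates and the bounds that come from
sample splitting hold. -/
theorem abs_foldError_le {B : Bounds} {P : Measure (FullUnit p)} [IsProbabilityMeasure P]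
    {θ β t t' b : Fin p → ℝ} (h : Model B P θ β) [Nonempty ι] {x : ι → FullUnit p}
    {y : ι' → FullUnit p} {κ ρ τ C s s' ω : ℝ} (hC : 0 ≤ C) (hρ : 0 ≤ ρ) (hτ : 0 ≤ τ)
    (hs : 0 ≤ s) (hs' : 0 ≤ s') (hx : CovBounded B.radius x) (hy : CovBounded B.radius y)
    (hθ : l1 θ ≤ κ) (ht : l1 t ≤ κ) (ht' : l1 t' ≤ κ)
    (hΔ1 : l1 (t - θ) ≤ C * (s * ρ)) (hΔ2 : l2 (t - θ) ^ 2 ≤ C * (s * ρ ^ 2))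
    (hΔx : (avg fun i => wt (x i) * (cov (x i) ⬝ᵥ (t - θ)) ^ 2) ≤ C * (s * ρ ^ 2))
    (hΔy : (avg fun i => wt (y i) * (cov (y i) ⬝ᵥ (t' - θ)) ^ 2) ≤ C * (s * ρ ^ 2))
    (hδ1 : l1 (b - β) ≤ C * (s' * ρ)) (hδ2 : l2 (b - β) ^ 2 ≤ C * (s' * ρ ^ 2))
    (hδy : (avg fun i => wt (y i) * (cov (y i) ⬝ᵥ (b - β)) ^ 2) ≤ C * (s' * ρ ^ 2))
    (hKKT : ∀ j, |avg fun i => wt (y i) * Real.exp (-(cov (y i) ⬝ᵥ t')) *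
      (cov (y i) ⬝ᵥ (b - β)) * cov (y i) j| ≤ C * ρ)
    (hcx : CrossGood B P θ ρ τ x (b - β)) (hcy : CrossGood B P θ ρ τ y (t - θ))
    (hω : |avg fun i => wt (x i) * (q (cov (x i) ⬝ᵥ t) - q (cov (x i) ⬝ᵥ θ)) *
      eps β (x i)| ≤ ω / √(Fintype.card ι)) :
    √(Fintype.card ι) * |foldError x θ β t b| ≤
      errorBound B κ C τ ω (√(Fintype.card ι) * (s * ρ ^ 2)) (s' * ρ ^ 2)
        (√(√(Fintype.card ι)) * (s' * ρ ^ 2)) := by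
  have hN : (0 : ℝ) < √(Fintype.card ι) := Real.sqrt_pos.2 (by exact_mod_cast Fintype.card_pos)
  set N : ℝ := √(Fintype.card ι) with hNdef
  have hKX := B.KX_pos
  have hcc := B.crossConst_nonneg
  have hA := B.one_le_radius
  have hlΔ := l2_nonneg (t - θ)
  have hlδ := l2_nonneg (b - β)
  have hlΔ1 := l1_nonneg (t - θ)
  have hlδ1 := l1_nonneg (b - β)
  set a : ℝ := s * ρ ^ 2 with ha
  set a' : ℝ := s' * ρ ^ 2 with ha'
  have ha0 : 0 ≤ a := by positivity
  have ha0' : 0 ≤ a' := by positivity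
  have hΔr : l2 (t - θ) ≤ √(C * a) := Real.le_sqrt_of_sq_le hΔ2
  have hδr : l2 (b - β) ≤ √(C * a') := Real.le_sqrt_of_sq_le hδ2
  set g : ℝ := √(C * a) with hg
  set g' : ℝ := √(C * a') with hg'
  have hg0 : 0 ≤ g := Real.sqrt_nonneg _
  have hg0' : 0 ≤ g' := Real.sqrt_nonneg _
  have hgg : g * g = C * a := Real.mul_self_sqrt (by positivity)
  have hNN : √N * √N = N := Real.mul_self_sqrt hN.le
  have hgN : √(C * (N * a)) = g * √N := by
    rw [hg, ← Real.sqrt_mul (by positivity)]; congr 1; ring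
  set e : ℝ := Real.exp (3 * (B.radius * κ)) with he
  have he0 : 0 < e := Real.exp_pos _
  have hint := abs_interaction_le (by linarith) hx hy hθ ht ht' hcx.max hcy.max (by positivity)
    hcx.hessian hcy.hessian (h.sum_mul_hessian_comm _ _) hKKT
  have hscore := hcx.score
  rw [foldError_eq]
  refine (mul_le_mul_of_nonneg_left ((abs_add_le _ _).trans (add_le_add ((abs_add_le _ _).trans
    (add_le_add hscore hω)) hint)) hN.le).trans ?_
  rw [← he, ← hNdef]
  have k1 : N * (B.crossConst * τ * l2 (b - β) / N) ≤ B.crossConst * (τ * g') := by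
    rw [mul_div_cancel₀ _ hN.ne', mul_assoc]; gcongr
  have k2 : N * (ω / N) = ω := mul_div_cancel₀ _ hN.ne'
  have k3 : N * (B.crossConst * ρ * l2 (b - β) * l1 (t - θ)) ≤
      B.crossConst * g' * (C * (N * a)) := by
    calc N * (B.crossConst * ρ * l2 (b - β) * l1 (t - θ))
        ≤ N * (B.crossConst * ρ * g' * (C * (s * ρ))) := by gcongr
      _ = _ := by rw [ha]; ring
  have k4 : N * (B.crossConst * ρ * l2 (t - θ) * l1 (b - β)) ≤
      B.crossConst * (C * √(C * (N * a))) * (√N * a') := by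
    calc N * (B.crossConst * ρ * l2 (t - θ) * l1 (b - β))
        ≤ N * (B.crossConst * ρ * g * (C * (s' * ρ))) := by gcongr
      _ = (√N * √N) * (B.crossConst * ρ * g * (C * (s' * ρ))) := by rw [hNN]
      _ = _ := by rw [hgN, ha']; ring
  have k5 : N * (C * ρ * l1 (t - θ)) ≤ C ^ 2 * (N * a) := by
    calc N * (C * ρ * l1 (t - θ)) ≤ N * (C * ρ * (C * (s * ρ))) := by gcongr
      _ = _ := by rw [ha]; ring
  have k6 : N * (e * (B.KX * l2 (t - θ) * τ) *
      (√(avg fun i => wt (y i) * (cov (y i) ⬝ᵥ (t' - θ)) ^ 2) *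
        √(avg fun i => wt (y i) * (cov (y i) ⬝ᵥ (b - β)) ^ 2))) ≤
      (e * B.KX) * (τ * g') * (C * (N * a)) := by
    have hr1 := Real.sqrt_le_sqrt hΔy
    have hr2 := Real.sqrt_le_sqrt hδy
    rw [← hg] at hr1
    rw [← hg'] at hr2
    calc _ ≤ N * (e * (B.KX * g * τ) * (g * g')) := by
          gcongr
      _ = N * (e * (B.KX * τ) * g') * (g * g) := by ring
      _ = _ := by rw [hgg]; ring
  have k7 : N * (e * (B.KX * l2 (b - β) * τ) *
      avg fun i => wt (x i) * (cov (x i) ⬝ᵥ (t - θ)) ^ 2) ≤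
      (e * B.KX) * (τ * g') * (C * (N * a)) := by
    have hq : 0 ≤ avg fun i => wt (x i) * (cov (x i) ⬝ᵥ (t - θ)) ^ 2 :=
      avg_nonneg fun i => mul_nonneg (wt_nonneg _) (sq_nonneg _)
    calc _ ≤ N * (e * (B.KX * g' * τ) * (C * a)) := by
          gcongr
      _ = _ := by ring
  unfold errorBound
  rw [← he, ← hg']
  linarith

/-- The constant in the rates of the estimators of both parameters, when the tuning parameters are
at most `C₀ √(log p / n)`. -/
def rateBound (B : Bounds) (κ C₀ : ℝ) : ℝ :=
  (rateConst B.curv (6 * Real.exp (B.radius * B.r)) +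
    rateConst B.curv (3 / 2 * Real.exp (B.radius * κ)) + 1) * (C₀ + C₀ ^ 2)

theorem rateBound_nonneg (B : Bounds) (κ : ℝ) {C₀ : ℝ} (hC : 0 ≤ C₀) : 0 ≤ rateBound B κ C₀ := by
  have h1 := rateConst_nonneg B.curv_pos (M := 6 * Real.exp (B.radius * B.r)) (by positivity)
  have h2 := rateConst_nonneg B.curv_pos (M := 3 / 2 * Real.exp (B.radius * κ)) (by positivity)
  unfold rateBound; positivity

theorem mul_lam_le {K K' C₀ lam ρ s : ℝ} (hK : 0 ≤ K) (hK' : 0 ≤ K') (hC : 0 ≤ C₀) (hs : 0 ≤ s)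
    (hρ : 0 ≤ ρ) (hlam0 : 0 ≤ lam) (hlam : lam ≤ C₀ * ρ) :
    K * s * lam ≤ (K + K' + 1) * (C₀ + C₀ ^ 2) * (s * ρ) ∧
      K * s * lam ^ 2 ≤ (K + K' + 1) * (C₀ + C₀ ^ 2) * (s * ρ ^ 2) := by
  constructor
  · calc K * s * lam ≤ K * s * (C₀ * ρ) := by gcongr
      _ = K * C₀ * (s * ρ) := by ring
      _ ≤ (K + K' + 1) * (C₀ + C₀ ^ 2) * (s * ρ) := by gcongr <;> nlinarith [sq_nonneg C₀]
  · calc K * s * lam ^ 2 ≤ K * s * (C₀ * ρ) ^ 2 := by gcongr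
      _ = K * C₀ ^ 2 * (s * ρ ^ 2) := by ring
      _ ≤ (K + K' + 1) * (C₀ + C₀ ^ 2) * (s * ρ ^ 2) := by gcongr <;> nlinarith [sq_nonneg C₀]

/-- The events on a fold that give the rates of the propensity estimator. -/
structure DesignGood (B : Bounds) (θ : Fin p → ℝ) (lam d : ℝ) (x : ι → FullUnit p) : Prop where
  bounded : CovBounded B.radius x
  grad : ∀ j, |balanceGrad x θ j| ≤ lam / 2
  restrictedEig : RestrictedEig B.curv d x

theorem abs_wt_mul_q_sub_q_le {o : FullUnit p} {A κ : ℝ} {t θ : Fin p → ℝ} (hA : 0 ≤ A)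
    (ho : ∀ j, |cov o j| ≤ A) (hθ : l1 θ ≤ κ) (ht : l1 t ≤ κ) :
    |wt o * (q (cov o ⬝ᵥ t) - q (cov o ⬝ᵥ θ))| ≤ Real.exp (3 * (A * κ)) * A * l1 (t - θ) := by
  have h1 : q (cov o ⬝ᵥ t) - q (cov o ⬝ᵥ θ) =
      Real.exp (-(cov o ⬝ᵥ θ)) * (Real.exp (-(cov o ⬝ᵥ (t - θ))) - 1) := by
    unfold q
    rw [mul_sub, ← Real.exp_add, dotProduct_sub]
    ring_nf
  have h2 : Real.exp (-(cov o ⬝ᵥ θ)) ≤ Real.exp (A * κ) :=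
    Real.exp_le_exp.2 ((neg_le_abs _).trans ((abs_dotProduct_le ho).trans (by gcongr)))
  have h3 : |cov o ⬝ᵥ (t - θ)| ≤ A * l1 (t - θ) := abs_dotProduct_le ho
  have h4 : l1 (t - θ) ≤ 2 * κ := by linarith [l1_sub_le t θ]
  have h5 : Real.exp |cov o ⬝ᵥ (t - θ)| ≤ Real.exp (2 * (A * κ)) :=
    Real.exp_le_exp.2 (h3.trans (by nlinarith))
  have h6 := wt_le_one o
  have h7 := l1_nonneg (t - θ)
  rw [h1, abs_mul, abs_mul, abs_of_nonneg (wt_nonneg o), Real.abs_exp]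
  calc wt o * (Real.exp (-(cov o ⬝ᵥ θ)) * |Real.exp (-(cov o ⬝ᵥ (t - θ))) - 1|)
      ≤ 1 * (Real.exp (A * κ) * (A * l1 (t - θ) * Real.exp (2 * (A * κ)))) := by
        gcongr
        exact (abs_exp_neg_sub_one_le _).trans (by gcongr)
    _ = (Real.exp (A * κ) * Real.exp (2 * (A * κ))) * A * l1 (t - θ) := by ring
    _ = _ := by rw [← Real.exp_add]; ring_nf

/-- The error of a fold on the intersection of all the good events. -/
theorem abs_foldError_le_of_good {B : Bounds} {P : Measure (FullUnit p)} [IsProbabilityMeasure P]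
    {θ β : Fin p → ℝ} (h : Model B P θ β) [Nonempty ι] {lamθ lamβ κ : ℝ}
    (E : Estimator ι p lamθ lamβ κ) (E' : Estimator ι' p lamθ lamβ κ) {x : ι → FullUnit p}
    {y : ι' → FullUnit p} {ρ τ C₀ d ω η : ℝ} (hC : 0 ≤ C₀) (hρ : 0 ≤ ρ) (hτ : 0 ≤ τ) (hd : 0 ≤ d)
    (hκ : l1 θ < κ) (hlamθ0 : 0 < lamθ) (hlamβ0 : 0 < lamβ) (hlamθ : lamθ ≤ C₀ * ρ)
    (hlamβ : lamβ ≤ C₀ * ρ) (hsd : 16 * l0 θ * d ≤ B.curv / 2) (hsd' : 16 * l0 β * d ≤ B.curv / 2)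
    (hsm : 64 / B.curv * (6 * Real.exp (B.radius * B.r)) * l0 θ * lamθ * B.radius ≤ 1)
    (hη : Real.exp (3 * (B.radius * κ)) * B.radius * (rateBound B κ C₀ * (l0 θ * ρ)) ≤ η)
    (hx : DesignGood B θ lamθ d x) (hy : DesignGood B θ lamθ d y)
    (hnoise : l1 (E'.thetaHat fun i => covTreat (y i)) ≤ κ → ∀ j, |avg fun i => wt (y i) *
      Real.exp (-(cov (y i) ⬝ᵥ E'.thetaHat fun i => covTreat (y i))) * eps β (y i) * cov (y i) j| ≤
        lamβ / 4)
    (hcx : CrossGood B P θ ρ τ x ((E'.betaHat fun i => observed (y i)) - β))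
    (hcy : CrossGood B P θ ρ τ y ((E.thetaHat fun i => covTreat (x i)) - θ))
    (hω : (∀ i, |wt (x i) * (q (cov (x i) ⬝ᵥ E.thetaHat fun i => covTreat (x i)) -
        q (cov (x i) ⬝ᵥ θ))| ≤ η) →
      |avg fun i => wt (x i) * (q (cov (x i) ⬝ᵥ E.thetaHat fun i => covTreat (x i)) -
        q (cov (x i) ⬝ᵥ θ)) * eps β (x i)| ≤ ω / √(Fintype.card ι)) :
    √(Fintype.card ι) * |foldError x θ β (E.thetaHat fun i => covTreat (x i))
      (E'.betaHat fun i => observed (y i))| ≤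
      errorBound B κ (rateBound B κ C₀) τ ω (√(Fintype.card ι) * (l0 θ * ρ ^ 2)) (l0 β * ρ ^ 2)
        (√(√(Fintype.card ι)) * (l0 β * ρ ^ 2)) := by
  have hA : 0 ≤ B.radius := zero_le_one.trans B.one_le_radius
  have hc := B.curv_pos
  have hK1 := rateConst_nonneg hc (M := 6 * Real.exp (B.radius * B.r)) (by positivity)
  have hK2 := rateConst_nonneg hc (M := 3 / 2 * Real.exp (B.radius * κ)) (by positivity)
  obtain ⟨a1, a2, a3, a4⟩ := E.thetaHat_rates x hA hx.bounded h.theta_mem hκ hlamθ0 hx.grad hc hd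
    hx.restrictedEig hsd hsm
  obtain ⟨b1, b2, b3, b4⟩ := E'.thetaHat_rates y hA hy.bounded h.theta_mem hκ hlamθ0 hy.grad hc hd
    hy.restrictedEig hsd hsm
  obtain ⟨c2, c3, c4, c5⟩ := E'.betaHat_rates y hA hy.bounded hlamβ0 b1 (hnoise b1) hc hd
    hy.restrictedEig hsd'
  obtain ⟨m1, m2⟩ := mul_lam_le hK1 hK2 hC (Nat.cast_nonneg (l0 θ)) hρ hlamθ0.le hlamθ
  obtain ⟨m3, m4⟩ := mul_lam_le hK2 hK1 hC (Nat.cast_nonneg (l0 β)) hρ hlamβ0.le hlamβ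
  rw [add_comm (rateConst B.curv (3 / 2 * Real.exp (B.radius * κ)))] at m3 m4
  have hK : C₀ * ρ ≤ rateBound B κ C₀ * ρ := by
    refine mul_le_mul_of_nonneg_right ?_ hρ
    unfold rateBound
    nlinarith [sq_nonneg C₀, mul_nonneg (add_nonneg hK1 hK2) (add_nonneg hC (sq_nonneg C₀))]
  refine abs_foldError_le h (rateBound_nonneg B κ hC) hρ hτ (Nat.cast_nonneg _) (Nat.cast_nonneg _)
    hx.bounded hy.bounded hκ.le a1 b1 (a2.trans m1) (a4.trans m2) (a3.trans m2) (b3.trans m2)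
    (c2.trans m3) (c4.trans m4) (c3.trans m4) (fun j => (c5 j).trans (hlamβ.trans hK)) hcx hcy
    (hω fun i => ?_)
  refine (abs_wt_mul_q_sub_q_le hA (hx.bounded i) hκ.le a1).trans (le_trans ?_ hη)
  have := a2.trans m1
  unfold rateBound
  gcongr

end FoldError

section FoldProbability

variable {B : Bounds} {n p : ℕ} {P : Measure (FullUnit p)} [IsProbabilityMeasure P]
  {θ β : Fin p → ℝ}

/-- The probability that one of the good events for the error of a fold fails, for folds of size
`N`. -/
def failureBound (B : Bounds) (p N : ℕ) (ω η : ℝ) : ENNReal :=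
  5 * ENNReal.ofReal (2 / p) + 2 * ENNReal.ofReal (4 / N) +
    10 * ENNReal.ofReal ((2 / Real.exp 1) ^ N) +
    2 * ENNReal.ofReal (Real.exp (-(B.lowerTailRate / 2 * N))) +
    2 * ENNReal.ofReal (Real.exp (-(ω ^ 2 / (8 * η ^ 2 * B.Keps ^ 2))))

theorem Model.measure_not_covBounded_eq_zero (h : Model B P θ β) {ι : Type*} [Fintype ι] :
    Measure.pi (fun _ : ι => P) {x | ¬ CovBounded B.radius x} = 0 :=
  ae_iff.1 h.ae_covBounded

/-- The failure probability of the good events that involve one fold only. -/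
theorem Model.measure_not_designGood_le (h : Model B P θ β) {ι : Type*} [Fintype ι] [Nonempty ι]
    (hp : 2 ≤ p) {lam : ℝ} (hlam : 0 ≤ lam)
    (hlog : 640 * B.scoreBound ^ 2 * Real.log p ≤ Fintype.card ι * lam ^ 2) :
    Measure.pi (fun _ : ι => P)
      {x | ¬ DesignGood B θ lam (B.tol * (Real.log p / Fintype.card ι)) x} ≤
      ENNReal.ofReal (2 / p) + ENNReal.ofReal ((2 / Real.exp 1) ^ Fintype.card ι) +
        ENNReal.ofReal (Real.exp (-(B.lowerTailRate / 2 * Fintype.card ι))) := by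
  have hsub : {x : ι → FullUnit p |
      ¬ DesignGood B θ lam (B.tol * (Real.log p / Fintype.card ι)) x} ⊆
      {x | ¬ CovBounded B.radius x} ∪ ({x | CovBounded B.radius x ∧
        ∃ j, lam / 2 < |balanceGrad x θ j|} ∪ {x | CovBounded B.radius x ∧
          ¬ RestrictedEig B.curv (B.tol * (Real.log p / Fintype.card ι)) x}) := by
    intro x hx
    by_contra hne
    simp only [Set.mem_union, Set.mem_ofPred_eq, not_or, not_and, not_exists, not_not,
      not_lt] at hne
    obtain ⟨h1, h2, h3⟩ := hne
    exact hx ⟨h1, h2 h1, h3 h1⟩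
  refine (measure_mono hsub).trans ((measure_union_le _ _).trans ?_)
  rw [h.measure_not_covBounded_eq_zero, zero_add]
  exact (measure_union_le _ _).trans (add_le_add
    (h.measure_balanceGrad_gt_le (by omega) hlam hlog) (h.measure_not_restrictedEig_le hp))

/-- With high probability the error of the fold `F` satisfies the deterministic bound. The outcome
estimate comes from the complement of `F`, and the propensity estimate from `F` itself; the cross
bounds are used for `β̂ - β` on `F` and for `θ̂ - θ` on the complement. -/
theorem Model.measure_foldError_gt_le (h : Model B P θ β) {lamθ lamβ κ : ℝ}
    (E : ∀ F : Finset (Fin n), Estimator F p lamθ lamβ κ) {F : Finset (Fin n)} {N : ℕ} (hN : 1 ≤ N)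
    (hF : F.card = N) (hFc : Fᶜ.card = N) (hp : 2 ≤ p) {ρ τ C₀ ω η : ℝ} (hC : 0 ≤ C₀)
    (hρ : 0 ≤ ρ) (hτ : 0 ≤ τ) (hω : 0 ≤ ω) (hη0 : 0 < η) (hρ2 : 2 * (N * ρ ^ 2) = Real.log p)
    (hτ2 : 2 * Real.log N ≤ τ ^ 2) (hκ : l1 θ < κ) (hlamθ0 : 0 < lamθ) (hlamβ0 : 0 < lamβ)
    (hlamθ : lamθ ≤ C₀ * ρ) (hlamβ : lamβ ≤ C₀ * ρ) (hlamθ' : 36 * B.scoreBound * ρ ≤ lamθ)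
    (hlamβ' : 23 * (B.radius * Real.exp (B.radius * κ)) * B.Keps * ρ ≤ lamβ)
    (hsd : 16 * l0 θ * (B.tol * (Real.log p / N)) ≤ B.curv / 2)
    (hsd' : 16 * l0 β * (B.tol * (Real.log p / N)) ≤ B.curv / 2)
    (hsm : 64 / B.curv * (6 * Real.exp (B.radius * B.r)) * l0 θ * lamθ * B.radius ≤ 1)
    (hη : Real.exp (3 * (B.radius * κ)) * B.radius * (rateBound B κ C₀ * (l0 θ * ρ)) ≤ η) :
    sampleLaw n P {S | errorBound B κ (rateBound B κ C₀) τ ω (√N * (l0 θ * ρ ^ 2)) (l0 β * ρ ^ 2)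
        (√√N * (l0 β * ρ ^ 2)) <
      √N * |foldError (foldSample F S) θ β ((E F).thetaHat fun i => covTreat (S i))
        ((E Fᶜ).betaHat fun i => observed (S i))|} ≤ failureBound B p N ω η := by
  have hcF : Fintype.card F = N := by rw [Fintype.card_coe, hF]
  have hcG : Fintype.card (Fᶜ : Finset (Fin n)) = N := by rw [Fintype.card_coe, hFc]
  have : Nonempty F := Fintype.card_pos_iff.1 (by omega)
  have : Nonempty (Fᶜ : Finset (Fin n)) := Fintype.card_pos_iff.1 (by omega)
  have hA := B.one_le_radius
  have hK := B.Keps_pos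
  have hsc := B.scoreBound_pos
  have hlogp : 0 ≤ Real.log p := Real.log_natCast_nonneg p
  set d : ℝ := B.tol * (Real.log p / N) with hd
  have hd0 : 0 ≤ d := mul_nonneg B.tol_pos.le (by positivity)
  -- `36² ≥ 2 * 640` and `23² ≥ 2 * 256`, where the factor two is that of `2 N ρ² = log p`.
  have hgrad : 640 * B.scoreBound ^ 2 * Real.log p ≤ N * lamθ ^ 2 := by
    calc 640 * B.scoreBound ^ 2 * Real.log p
        ≤ N * (36 * B.scoreBound * ρ) ^ 2 := by
          rw [← hρ2]
          have : 0 ≤ B.scoreBound ^ 2 * (N * ρ ^ 2) := by positivity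
          nlinarith
      _ ≤ N * lamθ ^ 2 := by gcongr
  have hnoise : 256 * (B.radius * Real.exp (B.radius * κ)) ^ 2 * B.Keps ^ 2 * Real.log p ≤
      N * lamβ ^ 2 := by
    calc 256 * (B.radius * Real.exp (B.radius * κ)) ^ 2 * B.Keps ^ 2 * Real.log p
        ≤ N * (23 * (B.radius * Real.exp (B.radius * κ)) * B.Keps * ρ) ^ 2 := by
          rw [← hρ2]
          have : 0 ≤ (B.radius * Real.exp (B.radius * κ)) ^ 2 * B.Keps ^ 2 * (N * ρ ^ 2) := by
            positivity
          nlinarith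
      _ ≤ N * lamβ ^ 2 := by gcongr
  set V1 : Set (F → FullUnit p) := {x | ¬ DesignGood B θ lamθ d x} with hV1
  set V2 : Set ((Fᶜ : Finset (Fin n)) → FullUnit p) := {x | ¬ DesignGood B θ lamθ d x} with hV2
  set V3 : Set ((Fᶜ : Finset (Fin n)) → FullUnit p) := {x | CovBounded B.radius x ∧
    l1 ((E Fᶜ).thetaHat fun i => covTreat (x i)) ≤ κ ∧ ∃ j, lamβ / 4 < |avg fun i => wt (x i) *
      Real.exp (-(cov (x i) ⬝ᵥ (E Fᶜ).thetaHat fun i => covTreat (x i))) * eps β (x i) *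
        cov (x i) j|} with hV3
  set V4 : Set (F → FullUnit p) := {x |
      (∀ i, |wt (x i) * (q (cov (x i) ⬝ᵥ (E F).thetaHat fun i => covTreat (x i)) -
        q (cov (x i) ⬝ᵥ θ))| ≤ η) ∧
      ω / √(Fintype.card F) < |avg fun i => wt (x i) *
        (q (cov (x i) ⬝ᵥ (E F).thetaHat fun i => covTreat (x i)) - q (cov (x i) ⬝ᵥ θ)) *
          eps β (x i)|} with hV4
  set V5 : Set ((F → FullUnit p) × (Fin p → ℝ)) := {z |
      CovBounded B.radius z.1 ∧ ¬ CrossGood B P θ ρ τ z.1 z.2} with hV5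
  set V6 : Set (((Fᶜ : Finset (Fin n)) → FullUnit p) × (Fin p → ℝ)) := {z |
      CovBounded B.radius z.1 ∧ ¬ CrossGood B P θ ρ τ z.1 z.2} with hV6
  set β' : ((Fᶜ : Finset (Fin n)) → FullUnit p) → Fin p → ℝ :=
    fun y => ((E Fᶜ).betaHat fun i => observed (y i)) - β with hβ'
  set θ' : (F → FullUnit p) → Fin p → ℝ :=
    fun x => ((E F).thetaHat fun i => covTreat (x i)) - θ with hθ'
  have hsub : {S | errorBound B κ (rateBound B κ C₀) τ ω (√N * (l0 θ * ρ ^ 2)) (l0 β * ρ ^ 2)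
        (√√N * (l0 β * ρ ^ 2)) <
      √N * |foldError (foldSample F S) θ β ((E F).thetaHat fun i => covTreat (S i))
        ((E Fᶜ).betaHat fun i => observed (S i))|} ⊆
      ((({S | foldSample F S ∈ V1} ∪ {S | foldSample Fᶜ S ∈ V2}) ∪
        {S | foldSample Fᶜ S ∈ V3}) ∪ {S | foldSample F S ∈ V4}) ∪
      ({S | (foldSample F S, β' (foldSample Fᶜ S)) ∈ V5} ∪
        {S | (foldSample Fᶜ S, θ' (foldSample F S)) ∈ V6}) := by
    intro S hS
    by_contra hne
    simp only [hV1, hV2, hV3, hV4, hV5, hV6, Set.mem_union, Set.mem_ofPred_eq, not_or, not_and,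
      not_exists, not_not, not_lt] at hne
    obtain ⟨⟨⟨⟨g1, g2⟩, g3⟩, g4⟩, g5, g6⟩ := hne
    have key := abs_foldError_le_of_good h (E F) (E Fᶜ) hC hρ hτ hd0 hκ hlamθ0 hlamβ0 hlamθ hlamβ
      hsd hsd' hsm hη g1 g2 (g3 g2.bounded) (g5 g1.bounded) (g6 g2.bounded) g4
    rw [hcF] at key
    exact absurd hS (not_lt.2 key)
  have k1 : sampleLaw n P {S | foldSample F S ∈ V1} ≤
      ENNReal.ofReal (2 / p) + ENNReal.ofReal ((2 / Real.exp 1) ^ N) +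
        ENNReal.ofReal (Real.exp (-(B.lowerTailRate / 2 * N))) := by
    have := h.measure_not_designGood_le (ι := F) hp hlamθ0.le (by rw [hcF]; exact hgrad)
    rw [hcF] at this
    exact (sampleLaw_foldSample_le F V1).trans this
  have k2 : sampleLaw n P {S | foldSample Fᶜ S ∈ V2} ≤
      ENNReal.ofReal (2 / p) + ENNReal.ofReal ((2 / Real.exp 1) ^ N) +
        ENNReal.ofReal (Real.exp (-(B.lowerTailRate / 2 * N))) := by
    have := h.measure_not_designGood_le (ι := (Fᶜ : Finset (Fin n))) hp hlamθ0.le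
      (by rw [hcG]; exact hgrad)
    rw [hcG] at this
    exact (sampleLaw_foldSample_le Fᶜ V2).trans this
  have k3 : sampleLaw n P {S | foldSample Fᶜ S ∈ V3} ≤
      ENNReal.ofReal (2 / p) + 2 * ENNReal.ofReal ((2 / Real.exp 1) ^ N) := by
    have := h.measure_noise_gt_le (by omega) (E Fᶜ) hlamβ0.le (by rw [hcG]; exact hnoise)
    rw [hcG] at this
    exact (sampleLaw_foldSample_le Fᶜ V3).trans this
  have k4 : sampleLaw n P {S | foldSample F S ∈ V4} ≤
      2 * ENNReal.ofReal (Real.exp (-(ω ^ 2 / (8 * η ^ 2 * B.Keps ^ 2)))) +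
        2 * ENNReal.ofReal ((2 / Real.exp 1) ^ N) := by
    have := h.measure_residual_gt_le (E F) hη0 hω
    rw [hcF] at this
    refine (sampleLaw_foldSample_le F V4).trans ?_
    rw [hV4, hcF]
    exact this
  have k5 : sampleLaw n P {S | (foldSample F S, β' (foldSample Fᶜ S)) ∈ V5} ≤
      ENNReal.ofReal (2 / p) + ENNReal.ofReal (4 / N) +
        2 * ENNReal.ofReal ((2 / Real.exp 1) ^ N) := by
    refine sampleLaw_crossFit_le disjoint_compl_right
      ((measurable_betaHat_foldSample (E Fᶜ)).sub_const β)
      (measurableSet_not_crossGood B P θ ρ τ) fun v => ?_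
    have := h.measure_not_crossGood_le (ι := F) (by omega) hρ hτ (by rw [hcF, hρ2])
      (by rw [hcF]; exact hτ2) v
    rw [hcF] at this
    exact this
  have k6 : sampleLaw n P {S | (foldSample Fᶜ S, θ' (foldSample F S)) ∈ V6} ≤
      ENNReal.ofReal (2 / p) + ENNReal.ofReal (4 / N) +
        2 * ENNReal.ofReal ((2 / Real.exp 1) ^ N) := by
    refine sampleLaw_crossFit_le disjoint_compl_left
      ((measurable_thetaHat_foldSample (E F)).sub_const θ)
      (measurableSet_not_crossGood B P θ ρ τ) fun v => ?_
    have := h.measure_not_crossGood_le (ι := (Fᶜ : Finset (Fin n))) (by omega) hρ hτ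
      (by rw [hcG, hρ2]) (by rw [hcG]; exact hτ2) v
    rw [hcG] at this
    exact this
  refine (measure_mono hsub).trans ((measure_union_le _ _).trans ((add_le_add
    ((measure_union_le _ _).trans (add_le_add ((measure_union_le _ _).trans (add_le_add
      ((measure_union_le _ _).trans (add_le_add k1 k2)) k3)) k4))
    ((measure_union_le _ _).trans (add_le_add k5 k6))).trans (le_of_eq ?_)))
  unfold failureBound
  ring

end FoldProbability

/-! ### Orders of magnitude -/

section Orders

variable {p s : ℕ → ℕ}

theorem log_natCast_tendsto_atTop (hp : Tendsto p atTop atTop) :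
    Tendsto (fun b => Real.log (p b)) atTop atTop :=
  Real.tendsto_log_atTop.comp (tendsto_natCast_atTop_atTop.comp hp)

theorem sq_sqrt_log_div (m b : ℕ) : √(Real.log m / (2 * b : ℕ)) ^ 2 = Real.log m / (2 * b : ℕ) :=
  Real.sq_sqrt (div_nonneg (Real.log_natCast_nonneg m) (Nat.cast_nonneg _))

/-- With `ρ² = log p / n`, the assumption on `‖θ‖₀` says that `√n ‖θ‖₀ ρ²` vanishes. -/
theorem tendsto_sqrt_mul_sparsity (hp : Tendsto p atTop atTop)
    (hs : (fun b => (s b : ℝ)) =o[atTop] (fun b : ℕ => √((2 * b : ℕ) : ℝ) / Real.log (p b))) :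
    Tendsto (fun b : ℕ => √b * (s b * √(Real.log (p b) / (2 * b : ℕ)) ^ 2)) atTop (𝓝 0) := by
  have h1 := (hs.tendsto_div_nhds_zero).mul_const (√2 / 2)
  rw [zero_mul] at h1
  refine h1.congr' ?_
  filter_upwards [eventually_ge_atTop 1, (log_natCast_tendsto_atTop hp).eventually_gt_atTop 0]
    with b hb hl
  have hb0 : (0 : ℝ) < b := by exact_mod_cast hb
  rw [sq_sqrt_log_div]
  push_cast
  rw [Real.sqrt_mul (by norm_num)]
  have h2 : √(b : ℝ) * √b = b := Real.mul_self_sqrt hb0.le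
  have h3 : √(b : ℝ) ≠ 0 := (Real.sqrt_pos.2 hb0).ne'
  field_simp
  rw [sq, h2]

/-- The `ℓ₁` rate of the propensity estimator vanishes. -/
theorem tendsto_mul_rate (hp : Tendsto p atTop atTop)
    (hs : (fun b => (s b : ℝ)) =o[atTop] (fun b : ℕ => √((2 * b : ℕ) : ℝ) / Real.log (p b))) :
    Tendsto (fun b : ℕ => s b * √(Real.log (p b) / (2 * b : ℕ))) atTop (𝓝 0) := by
  refine tendsto_of_tendsto_of_tendsto_of_le_of_le' tendsto_const_nhds
    (tendsto_sqrt_mul_sparsity hp hs) (Eventually.of_forall fun b => by positivity) ?_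
  filter_upwards [eventually_ge_atTop 1, (log_natCast_tendsto_atTop hp).eventually_ge_atTop 2]
    with b hb hl
  have hb0 : (0 : ℝ) < b := by exact_mod_cast hb
  have h1 : 1 ≤ √b * √(Real.log (p b) / (2 * b : ℕ)) := by
    rw [← Real.sqrt_mul hb0.le, Real.one_le_sqrt]
    push_cast
    rw [mul_div_assoc', le_div_iff₀ (by positivity)]
    nlinarith
  calc s b * √(Real.log (p b) / (2 * b : ℕ))
      = s b * √(Real.log (p b) / (2 * b : ℕ)) * 1 := (mul_one _).symm
    _ ≤ s b * √(Real.log (p b) / (2 * b : ℕ)) * (√b * √(Real.log (p b) / (2 * b : ℕ))) := by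
        gcongr
    _ = _ := by ring

theorem tendsto_mul_rate_sq (hp : Tendsto p atTop atTop)
    (hs : (fun b => (s b : ℝ)) =o[atTop] (fun b : ℕ => √((2 * b : ℕ) : ℝ) / Real.log (p b))) :
    Tendsto (fun b : ℕ => s b * √(Real.log (p b) / (2 * b : ℕ)) ^ 2) atTop (𝓝 0) := by
  refine tendsto_of_tendsto_of_tendsto_of_le_of_le' tendsto_const_nhds
    (tendsto_sqrt_mul_sparsity hp hs) (Eventually.of_forall fun b => by positivity) ?_
  filter_upwards [eventually_ge_atTop 1] with b hb
  have h1 : 1 ≤ √(b : ℝ) := Real.one_le_sqrt.2 (by exact_mod_cast hb)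
  exact le_mul_of_one_le_left (by positivity) h1

theorem sqrt_sqrt_eq_rpow {x : ℝ} (hx : 0 ≤ x) : √√x = x ^ (1 / 4 : ℝ) := by
  rw [Real.sqrt_eq_rpow, Real.sqrt_eq_rpow, ← Real.rpow_mul hx]
  norm_num

/-- With `ρ² = log p / n`, the assumption on `‖β‖₀` says that `n^{1/4} ‖β‖₀ ρ²` is bounded. -/
theorem exists_sqrt_sqrt_mul_sparsity_le (hp : Tendsto p atTop atTop)
    (hs : (fun b => (s b : ℝ)) =O[atTop]
      (fun b : ℕ => ((2 * b : ℕ) : ℝ) ^ (3 / 4 : ℝ) / Real.log (p b))) :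
    ∃ K : ℝ, ∀ᶠ b : ℕ in atTop, √√b * (s b * √(Real.log (p b) / (2 * b : ℕ)) ^ 2) ≤ K := by
  obtain ⟨K, hK⟩ := hs.bound
  refine ⟨K, ?_⟩
  filter_upwards [hK, eventually_ge_atTop 1,
    (log_natCast_tendsto_atTop hp).eventually_gt_atTop 0] with b hb1 hb hl
  have hb0 : (0 : ℝ) < b := by exact_mod_cast hb
  have hn : (0 : ℝ) < ((2 * b : ℕ) : ℝ) := by push_cast; positivity
  have hbn : (b : ℝ) ≤ ((2 * b : ℕ) : ℝ) := by push_cast; linarith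
  rw [sq_sqrt_log_div]
  rw [Real.norm_of_nonneg (by positivity), Real.norm_of_nonneg (by positivity)] at hb1
  set x : ℝ := ((2 * b : ℕ) : ℝ) with hx
  have h1 : x ^ (1 / 4 : ℝ) * x ^ (3 / 4 : ℝ) = x := by
    rw [← Real.rpow_add hn]; norm_num
  calc √√b * (s b * (Real.log (p b) / x))
      ≤ √√x * (K * (x ^ (3 / 4 : ℝ) / Real.log (p b)) * (Real.log (p b) / x)) := by gcongr
    _ = K * (x ^ (1 / 4 : ℝ) * x ^ (3 / 4 : ℝ)) / x := by
        rw [sqrt_sqrt_eq_rpow hn.le]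
        field_simp
    _ = K := by rw [h1]; field_simp

/-- The squared Euclidean rate of the outcome estimator absorbs the logarithm from the maximal
inequality, since it is at most of order `n^{-1/4}`. -/
theorem tendsto_log_mul_sparsity (hp : Tendsto p atTop atTop)
    (hs : (fun b => (s b : ℝ)) =O[atTop]
      (fun b : ℕ => ((2 * b : ℕ) : ℝ) ^ (3 / 4 : ℝ) / Real.log (p b))) :
    Tendsto (fun b : ℕ => 2 * Real.log b * (s b * √(Real.log (p b) / (2 * b : ℕ)) ^ 2))
      atTop (𝓝 0) := by
  obtain ⟨K, hK⟩ := exists_sqrt_sqrt_mul_sparsity_le hp hs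
  have h1 : Tendsto (fun b : ℕ => 2 * K * (Real.log b / (b : ℝ) ^ (1 / 4 : ℝ))) atTop (𝓝 0) := by
    have := ((isLittleO_log_rpow_atTop (r := 1 / 4) (by norm_num)).tendsto_div_nhds_zero.comp
      tendsto_natCast_atTop_atTop).const_mul (2 * K)
    rw [mul_zero] at this
    exact this
  refine tendsto_of_tendsto_of_tendsto_of_le_of_le' tendsto_const_nhds h1
    (Eventually.of_forall fun b => ?_) ?_
  · have := Real.log_natCast_nonneg b
    positivity
  filter_upwards [hK, eventually_ge_atTop 1] with b hKb hb
  have hb0 : (0 : ℝ) < b := by exact_mod_cast hb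
  have h2 : 0 < √√(b : ℝ) := Real.sqrt_pos.2 (Real.sqrt_pos.2 hb0)
  have h3 := Real.log_natCast_nonneg b
  rw [← sqrt_sqrt_eq_rpow hb0.le]
  calc 2 * Real.log b * (s b * √(Real.log (p b) / (2 * b : ℕ)) ^ 2)
      = 2 * (Real.log b / √√b) * (√√b * (s b * √(Real.log (p b) / (2 * b : ℕ)) ^ 2)) := by
        field_simp
    _ ≤ 2 * (Real.log b / √√b) * K := by gcongr
    _ = _ := by ring

theorem tendsto_mul_rate_sq_of_isBigO (hp : Tendsto p atTop atTop)
    (hs : (fun b => (s b : ℝ)) =O[atTop]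
      (fun b : ℕ => ((2 * b : ℕ) : ℝ) ^ (3 / 4 : ℝ) / Real.log (p b))) :
    Tendsto (fun b : ℕ => s b * √(Real.log (p b) / (2 * b : ℕ)) ^ 2) atTop (𝓝 0) := by
  refine tendsto_of_tendsto_of_tendsto_of_le_of_le' tendsto_const_nhds
    (tendsto_log_mul_sparsity hp hs) (Eventually.of_forall fun b => by positivity) ?_
  filter_upwards [(Real.tendsto_log_atTop.comp tendsto_natCast_atTop_atTop).eventually_ge_atTop
    (1 : ℝ)] with b hb
  simp only [Function.comp_apply] at hb
  exact le_mul_of_one_le_left (by positivity) (by linarith)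

/-- The deterministic bound vanishes up to `ω`. The interaction of the two estimation errors is of order
`√X * Y`, where `X` vanishes and `Y` is bounded. -/
theorem tendsto_errorBound (B : Bounds) (κ ω : ℝ) {C : ℝ} (hC : 0 ≤ C) {τ X a Y : ℕ → ℝ} {K : ℝ}
    (hX : Tendsto X atTop (𝓝 0)) (ha : Tendsto a atTop (𝓝 0))
    (hτ0 : ∀ b, 0 ≤ τ b)
    (hτ : Tendsto (fun b => τ b ^ 2 * a b) atTop (𝓝 0)) (hY0 : ∀ b, 0 ≤ Y b)
    (hY : ∀ᶠ b in atTop, Y b ≤ K) :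
    Tendsto (fun b => errorBound B κ C (τ b) ω (X b) (a b) (Y b)) atTop (𝓝 ω) := by
  have h1 : Tendsto (fun b => τ b * √(C * a b)) atTop (𝓝 0) := by
    have : Tendsto (fun b => √(C * (τ b ^ 2 * a b))) atTop (𝓝 0) := by
      have := (hτ.const_mul C).sqrt
      rwa [mul_zero, Real.sqrt_zero] at this
    refine this.congr fun b => ?_
    rw [show C * (τ b ^ 2 * a b) = τ b ^ 2 * (C * a b) by ring, Real.sqrt_mul (sq_nonneg _),
      Real.sqrt_sq (hτ0 b)]
  have h2 : Tendsto (fun b => √(C * a b)) atTop (𝓝 0) := by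
    have := (ha.const_mul C).sqrt
    rwa [mul_zero, Real.sqrt_zero] at this
  have h3 : Tendsto (fun b => C * X b) atTop (𝓝 0) := by
    have := hX.const_mul C
    rwa [mul_zero] at this
  have h4 : Tendsto (fun b => C * √(C * X b) * Y b) atTop (𝓝 0) := by
    have h5 : Tendsto (fun b => C * √(C * X b)) atTop (𝓝 0) := by
      have := h3.sqrt.const_mul C
      rwa [Real.sqrt_zero, mul_zero] at this
    have h6 : Tendsto (fun b => C * √(C * X b) * K) atTop (𝓝 0) := by
      have := h5.mul_const K
      rwa [zero_mul] at this
    refine tendsto_of_tendsto_of_tendsto_of_le_of_le' tendsto_const_nhds h6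
      (Eventually.of_forall fun b => mul_nonneg (by positivity) (hY0 b)) ?_
    filter_upwards [hY] with b hb
    gcongr
  have key := ((((h1.const_mul B.crossConst).add_const ω).add
    ((h2.mul h3).const_mul B.crossConst)).add (h4.const_mul B.crossConst)).add
    (hX.const_mul (C ^ 2)) |>.add
    ((h1.mul h3).const_mul (2 * (Real.exp (3 * (B.radius * κ)) * B.KX)))
  simp only [mul_zero, add_zero, zero_add] at key
  refine key.congr fun b => ?_
  unfold errorBound
  ring

theorem tendsto_failureBound (B : Bounds) (hp : Tendsto p atTop atTop) {ω : ℝ} (hω : 0 < ω)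
    {η : ℕ → ℝ} (hη : Tendsto η atTop (𝓝 0)) (hη0 : ∀ᶠ b in atTop, 0 < η b) :
    Tendsto (fun b => failureBound B (p b) b ω (η b)) atTop (𝓝 0) := by
  have hK := B.Keps_pos
  have aux : ∀ (c : ENNReal) (f : ℕ → ℝ), c ≠ ⊤ → Tendsto f atTop (𝓝 0) →
      Tendsto (fun b => c * ENNReal.ofReal (f b)) atTop (𝓝 0) := by
    intro c f hc hf
    have := ENNReal.Tendsto.const_mul (ENNReal.tendsto_ofReal hf) (Or.inr hc)
    rwa [ENNReal.ofReal_zero, mul_zero] at this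
  have h1 : Tendsto (fun b => (2 : ℝ) / p b) atTop (𝓝 0) :=
    tendsto_const_nhds.div_atTop (tendsto_natCast_atTop_atTop.comp hp)
  have h2 : Tendsto (fun b : ℕ => (4 : ℝ) / b) atTop (𝓝 0) :=
    tendsto_const_nhds.div_atTop tendsto_natCast_atTop_atTop
  have h3 : Tendsto (fun b : ℕ => (2 / Real.exp 1) ^ b) atTop (𝓝 0) := by
    refine tendsto_pow_atTop_nhds_zero_of_lt_one (by positivity) ?_
    rw [div_lt_one (Real.exp_pos _)]
    linarith [Real.exp_one_gt_d9]
  have h4 : Tendsto (fun b : ℕ => Real.exp (-(B.lowerTailRate / 2 * b))) atTop (𝓝 0) :=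
    Real.tendsto_exp_neg_atTop_nhds_zero.comp
      (tendsto_natCast_atTop_atTop.const_mul_atTop (half_pos B.lowerTailRate_pos))
  have h5 : Tendsto (fun b => Real.exp (-(ω ^ 2 / (8 * η b ^ 2 * B.Keps ^ 2)))) atTop (𝓝 0) := by
    refine Real.tendsto_exp_neg_atTop_nhds_zero.comp ?_
    have h6 : Tendsto (fun b => 8 * η b ^ 2 * B.Keps ^ 2) atTop (𝓝[>] 0) := by
      refine tendsto_nhdsWithin_iff.2 ⟨?_, ?_⟩
      · have := ((hη.pow 2).const_mul 8).mul_const (B.Keps ^ 2)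
        simpa using this
      · filter_upwards [hη0] with b hb
        exact Set.mem_Ioi.2 (by positivity)
    have := h6.inv_tendsto_nhdsGT_zero.const_mul_atTop (pow_pos hω 2)
    exact this.congr fun b => by simp [div_eq_mul_inv]
  have key := ((((aux 5 _ (by simp) h1).add (aux 2 _ (by simp) h2)).add
    (aux 10 _ (by simp) h3)).add (aux 2 _ (by simp) h4)).add (aux 2 _ (by simp) h5)
  unfold failureBound
  simpa only [add_zero] using key

end Orders

/-! ### The cross-fitted estimator -/

/-- The constant in the lower bound on the tuning parameters: they have to dominate the gradients of
the two losses at the true parameters. -/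
def penaltyConst (B : Bounds) (κ : ℝ) : ℝ :=
  36 * B.scoreBound + 23 * (B.radius * Real.exp (B.radius * κ)) * B.Keps

theorem penaltyConst_pos (B : Bounds) (κ : ℝ) : 0 < penaltyConst B κ := by
  have := B.scoreBound_pos
  have := B.Keps_pos
  have := B.one_le_radius
  unfold penaltyConst
  positivity

/-- The error of a fold is of smaller order than `n^{-1/2}` in probability. -/
theorem tendsto_foldError (B : Bounds) (κ : ℝ) {p : ℕ → ℕ} {P : ∀ b, Measure (FullUnit (p b))}
    [∀ b, IsProbabilityMeasure (P b)] {θ β : ∀ b, Fin (p b) → ℝ} {lamθ lamβ : ℕ → ℝ}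
    (E : ∀ (b : ℕ) (F : Finset (Fin (2 * b))), Estimator F (p b) (lamθ b) (lamβ b) κ)
    {F : ∀ b, Finset (Fin (2 * b))} (hp : Tendsto p atTop atTop)
    (hM : ∀ b, Model B (P b) (θ b) (β b)) (hκ : ∀ b, l1 (θ b) < κ) (hF : ∀ b, (F b).card = b)
    {C₀ : ℝ} (hC : 0 ≤ C₀)
    (hlamθ : ∀ᶠ b : ℕ in atTop, lamθ b ∈ Set.Icc
      (penaltyConst B κ * √(Real.log (p b) / (2 * b : ℕ))) (C₀ * √(Real.log (p b) / (2 * b : ℕ))))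
    (hlamβ : ∀ᶠ b : ℕ in atTop, lamβ b ∈ Set.Icc
      (penaltyConst B κ * √(Real.log (p b) / (2 * b : ℕ))) (C₀ * √(Real.log (p b) / (2 * b : ℕ))))
    (hs : (fun b => (l0 (θ b) : ℝ)) =o[atTop]
      (fun b : ℕ => √((2 * b : ℕ) : ℝ) / Real.log (p b)))
    (hs' : (fun b => (l0 (β b) : ℝ)) =O[atTop]
      (fun b : ℕ => ((2 * b : ℕ) : ℝ) ^ (3 / 4 : ℝ) / Real.log (p b))) {δ : ℝ} (hδ : 0 < δ) :
    Tendsto (fun b : ℕ => sampleLaw (2 * b) (P b) {S | δ ≤ √b *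
      |foldError (foldSample (F b) S) (θ b) (β b) ((E b (F b)).thetaHat fun i => covTreat (S i))
        ((E b (F b)ᶜ).betaHat fun i => observed (S i))|}) atTop (𝓝 0) := by
  have hA := B.one_le_radius
  have hc := B.curv_pos
  have hsc := B.scoreBound_pos
  have hKe := B.Keps_pos
  set ρ : ℕ → ℝ := fun b => √(Real.log (p b) / (2 * b : ℕ)) with hρ
  have hρ0 : ∀ b, 0 ≤ ρ b := fun b => Real.sqrt_nonneg _
  set τ : ℕ → ℝ := fun b => √(2 * Real.log b) with hτ
  have hτ2 : ∀ b, τ b ^ 2 = 2 * Real.log b := fun b =>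
    Real.sq_sqrt (mul_nonneg zero_le_two (Real.log_natCast_nonneg b))
  -- A vanishing bound on `W (q(X'θ̂) - q(X'θ))`; the summand `1 / b` keeps it positive if `θ = 0`.
  set η : ℕ → ℝ := fun b =>
    Real.exp (3 * (B.radius * κ)) * B.radius * (rateBound B κ C₀ * (l0 (θ b) * ρ b)) + 1 / b with hη
  have hrate := tendsto_mul_rate hp hs
  have hX := tendsto_sqrt_mul_sparsity hp hs
  have ha := tendsto_mul_rate_sq_of_isBigO hp hs'
  have hθ2 := tendsto_mul_rate_sq hp hs
  obtain ⟨K, hK⟩ := exists_sqrt_sqrt_mul_sparsity_le hp hs'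
  have hη0 : Tendsto η atTop (𝓝 0) := by
    have := ((hrate.const_mul (rateBound B κ C₀)).const_mul
      (Real.exp (3 * (B.radius * κ)) * B.radius)).add tendsto_one_div_atTop_nhds_zero_nat
    simpa only [mul_zero, add_zero] using this
  have hηpos : ∀ᶠ b : ℕ in atTop, 0 < η b := by
    filter_upwards [eventually_ge_atTop 1] with b hb
    have hb0 : (0 : ℝ) < b := by exact_mod_cast hb
    have := rateBound_nonneg B κ hC
    have := hρ0 b
    positivity
  have herr := tendsto_errorBound B κ (δ / 2) (rateBound_nonneg B κ hC) (τ := τ) (K := K) hX ha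
    (fun b => Real.sqrt_nonneg _) ((tendsto_log_mul_sparsity hp hs').congr fun b => by rw [hτ2])
    (fun b => by positivity) hK
  have hfail := tendsto_failureBound B hp (half_pos hδ) hη0 hηpos
  have hsd : ∀ {s : ℕ → ℕ}, Tendsto (fun b : ℕ => s b * √(Real.log (p b) / (2 * b : ℕ)) ^ 2) atTop
      (𝓝 0) → ∀ᶠ b : ℕ in atTop, 16 * s b * (B.tol * (Real.log (p b) / b)) ≤ B.curv / 2 := by
    intro s hs0
    have h1 := hs0.const_mul (32 * B.tol)
    rw [mul_zero] at h1
    filter_upwards [h1.eventually_lt_const (half_pos hc), eventually_ge_atTop 1] with b hb hb1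
    have hb0 : (0 : ℝ) < b := by exact_mod_cast hb1
    rw [sq_sqrt_log_div] at hb
    refine le_trans (le_of_eq ?_) hb.le
    push_cast
    field_simp
    ring
  have hsm : ∀ᶠ b : ℕ in atTop, 64 / B.curv * (6 * Real.exp (B.radius * B.r)) * l0 (θ b) * lamθ b *
      B.radius ≤ 1 := by
    have h1 := hrate.const_mul (64 / B.curv * (6 * Real.exp (B.radius * B.r)) * C₀ * B.radius)
    rw [mul_zero] at h1
    filter_upwards [h1.eventually_lt_const one_pos, hlamθ] with b hb hl
    calc 64 / B.curv * (6 * Real.exp (B.radius * B.r)) * l0 (θ b) * lamθ b * B.radius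
        ≤ 64 / B.curv * (6 * Real.exp (B.radius * B.r)) * l0 (θ b) *
          (C₀ * √(Real.log (p b) / (2 * b : ℕ))) * B.radius := by
          gcongr
          exact hl.2
      _ ≤ 1 := by refine le_trans (le_of_eq ?_) hb.le; ring
  refine tendsto_of_tendsto_of_tendsto_of_le_of_le' tendsto_const_nhds hfail
    (Eventually.of_forall fun b => zero_le) ?_
  filter_upwards [eventually_ge_atTop 1, hp.eventually_ge_atTop 2, hsd hθ2, hsd ha, hsm, hηpos,
    hlamθ, hlamβ, herr.eventually_lt_const (half_lt_self hδ)]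
    with b hb hpb hsd1 hsd2 hsm1 hη1 hl1 hl2 herr1
  have hb0 : (0 : ℝ) < b := by exact_mod_cast hb
  have hlog : 0 < Real.log (p b) := Real.log_pos (by exact_mod_cast hpb)
  have hρpos : 0 < ρ b := Real.sqrt_pos.2 (div_pos hlog (by push_cast; positivity))
  have hpen := penaltyConst_pos B κ
  have hFc : (F b)ᶜ.card = b := by
    rw [Finset.card_compl, Fintype.card_fin, hF]; omega
  have key := (hM b).measure_foldError_gt_le (E b) hb (hF b) hFc hpb (τ := τ b) (ω := δ / 2)
    (η := η b) hC (hρ0 b) (Real.sqrt_nonneg _) (half_pos hδ).le hη1 (by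
      rw [hρ]
      simp only
      rw [sq_sqrt_log_div]
      push_cast
      field_simp) (hτ2 b).ge (hκ b)
    ((mul_pos hpen hρpos).trans_le hl1.1) ((mul_pos hpen hρpos).trans_le hl2.1) hl1.2 hl2.2
    (le_trans (mul_le_mul_of_nonneg_right (by
      unfold penaltyConst
      exact le_add_of_nonneg_right (by positivity)) hρpos.le) hl1.1)
    (le_trans (mul_le_mul_of_nonneg_right (by
      unfold penaltyConst
      exact le_add_of_nonneg_left (by positivity)) hρpos.le) hl2.1)
    hsd1 hsd2 hsm1 (by
      rw [hη]
      exact le_add_of_nonneg_right (by positivity))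
  exact (measure_mono fun S hS => lt_of_lt_of_le herr1 hS).trans key

/-- The estimate on a fold is the fold average of the linear terms plus the error of the fold. -/
theorem muHatFold_eq {n p : ℕ} {lamθ lamβ κ : ℝ}
    (E : ∀ F : Finset (Fin n), Estimator F p lamθ lamβ κ) (F : Finset (Fin n))
    (S : Fin n → FullUnit p) (θ β : Fin p → ℝ) :
    muHatFold E F S = foldError (foldSample F S) θ β ((E F).thetaHat fun i => covTreat (S i))
        ((E Fᶜ).betaHat fun i => observed (S i)) +
      1 / (F.card : ℝ) *
        ∑ i ∈ F, (wt (S i) * eps β (S i) * q (cov (S i) ⬝ᵥ θ) + cov (S i) ⬝ᵥ β) := by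
  unfold foldError avg muHatFold foldSample
  simp only [Fintype.card_coe]
  rw [Finset.sum_coe_sort F fun i =>
    (wt (S i) * eps β (S i) * q (cov (S i) ⬝ᵥ θ) + cov (S i) ⬝ᵥ β), sub_add_cancel]
  exact congrArg _ (Finset.sum_coe_sort F fun i => cov (S i) ⬝ᵥ _ +
    (1 + Real.exp (-(cov (S i) ⬝ᵥ _))) * wt (S i) * (yObs (S i) - cov (S i) ⬝ᵥ _)).symm

theorem sqrt_mul_muHat_sub_linearTerm {b p : ℕ} (hb : 1 ≤ b) {lamθ lamβ κ : ℝ}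
    (E : ∀ F : Finset (Fin (2 * b)), Estimator F p lamθ lamβ κ) {J : Finset (Fin (2 * b))}
    (hJ : J.card = b) (P : Measure (FullUnit p)) (θ β : Fin p → ℝ)
    (S : Fin (2 * b) → FullUnit p) :
    √((2 * b : ℕ) : ℝ) * (muHat E J S - mu1 P) - linearTerm P θ β S = √((2 * b : ℕ) : ℝ) / 2 *
      (foldError (foldSample J S) θ β ((E J).thetaHat fun i => covTreat (S i))
        ((E Jᶜ).betaHat fun i => observed (S i)) +
      foldError (foldSample Jᶜ S) θ β ((E Jᶜ).thetaHat fun i => covTreat (S i))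
        ((E Jᶜᶜ).betaHat fun i => observed (S i))) := by
  have hb0 : (0 : ℝ) < b := by exact_mod_cast hb
  have hJc : Jᶜ.card = b := by rw [Finset.card_compl, Fintype.card_fin, hJ]; omega
  have hsum := Finset.sum_add_sum_compl J fun i =>
    (wt (S i) * eps β (S i) * q (cov (S i) ⬝ᵥ θ) + cov (S i) ⬝ᵥ β)
  unfold muHat
  rw [muHatFold_eq E J S θ β, muHatFold_eq E Jᶜ S θ β, hJ, hJc]
  set D := foldError (foldSample J S) θ β ((E J).thetaHat fun i => covTreat (S i))
        ((E Jᶜ).betaHat fun i => observed (S i))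
  set D' := foldError (foldSample Jᶜ S) θ β ((E Jᶜ).thetaHat fun i => covTreat (S i))
        ((E Jᶜᶜ).betaHat fun i => observed (S i))
  have hlin : linearTerm P θ β S = 1 / √((2 * b : ℕ) : ℝ) *
      (∑ i, (wt (S i) * eps β (S i) * q (cov (S i) ⬝ᵥ θ) + cov (S i) ⬝ᵥ β) -
        ((2 * b : ℕ) : ℝ) * mu1 P) := by
    unfold linearTerm
    congr 1
    simp_rw [← add_sub_assoc]
    rw [Finset.sum_sub_distrib]
    simp
  rw [hlin, ← hsum]
  set T := ∑ i ∈ J, (wt (S i) * eps β (S i) * q (cov (S i) ⬝ᵥ θ) + cov (S i) ⬝ᵥ β)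
  set T' := ∑ i ∈ Jᶜ, (wt (S i) * eps β (S i) * q (cov (S i) ⬝ᵥ θ) + cov (S i) ⬝ᵥ β)
  have hn : ((2 * b : ℕ) : ℝ) = √((2 * b : ℕ) : ℝ) * √((2 * b : ℕ) : ℝ) :=
    (Real.mul_self_sqrt (Nat.cast_nonneg _)).symm
  have hr : 0 < √((2 * b : ℕ) : ℝ) := Real.sqrt_pos.2 (by push_cast; positivity)
  have hbr : (b : ℝ) = √((2 * b : ℕ) : ℝ) * √((2 * b : ℕ) : ℝ) / 2 := by
    rw [← hn]; push_cast; ring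
  rw [hn, Real.sqrt_mul_self hr.le, hbr]
  generalize √((2 * b : ℕ) : ℝ) = r at hr
  field_simp
  ring

end SparseDR

end

theorem theorem3 (B : SparseDR.Bounds) (κ : ℝ) :
    ∃ c₀ : ℝ, 0 < c₀ ∧
      ∀ (p : ℕ → ℕ)
        (P : ∀ b, Measure (SparseDR.FullUnit (p b))) [∀ b, IsProbabilityMeasure (P b)]
        (θ β : ∀ b, Fin (p b) → ℝ)
        (lamθ lamβ : ℕ → ℝ)
        (E : ∀ (b : ℕ) (F : Finset (Fin (2 * b))),
          SparseDR.Estimator F (p b) (lamθ b) (lamβ b) κ)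
        (J : ∀ b, Finset (Fin (2 * b))),
        Tendsto p atTop atTop →
        (∀ b, SparseDR.Model B (P b) (θ b) (β b)) →
        (∀ b, SparseDR.l1 (θ b) < κ) →
        (∀ b, (J b).card = b) →
        (∃ C : ℝ, ∀ᶠ b : ℕ in atTop,
          lamθ b ∈ Set.Icc (c₀ * √(Real.log (p b) / (2 * b : ℕ)))
            (C * √(Real.log (p b) / (2 * b : ℕ)))) →
        (∃ C : ℝ, ∀ᶠ b : ℕ in atTop,
          lamβ b ∈ Set.Icc (c₀ * √(Real.log (p b) / (2 * b : ℕ)))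
            (C * √(Real.log (p b) / (2 * b : ℕ)))) →
        (fun b => (SparseDR.l0 (θ b) : ℝ)) =o[atTop]
          (fun b : ℕ => √((2 * b : ℕ) : ℝ) / Real.log (p b)) →
        (fun b => (SparseDR.l0 (β b) : ℝ)) =O[atTop]
          (fun b : ℕ => ((2 * b : ℕ) : ℝ) ^ (3 / 4 : ℝ) / Real.log (p b)) →
        ∀ δ : ℝ, 0 < δ →
          Tendsto (fun b : ℕ => SparseDR.sampleLaw (2 * b) (P b)
            {S | δ ≤ |√((2 * b : ℕ) : ℝ) *
                  (SparseDR.muHat (E b) (J b) S - SparseDR.mu1 (P b))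
                - SparseDR.linearTerm (P b) (θ b) (β b) S|}) atTop (𝓝 0) := by
  refine ⟨SparseDR.penaltyConst B κ, SparseDR.penaltyConst_pos B κ, ?_⟩
  intro p P _ θ β lamθ lamβ E J hp hM hκ hJ ⟨C₁, hC₁⟩ ⟨C₂, hC₂⟩ hs hs' δ hδ
  have hJc : ∀ b, (J b)ᶜ.card = b := fun b => by
    rw [Finset.card_compl, Fintype.card_fin, hJ]; omega
  have hC : 0 ≤ max |C₁| |C₂| := (abs_nonneg C₁).trans (le_max_left _ _)
  have hlamθ := hC₁.mono fun b hb => Set.Icc_subset_Icc_right (mul_le_mul_of_nonneg_right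
    ((le_abs_self C₁).trans (le_max_left _ |C₂|)) (Real.sqrt_nonneg _)) hb
  have hlamβ := hC₂.mono fun b hb => Set.Icc_subset_Icc_right (mul_le_mul_of_nonneg_right
    ((le_abs_self C₂).trans (le_max_right |C₁| _)) (Real.sqrt_nonneg _)) hb
  have h1 := SparseDR.tendsto_foldError B κ E hp hM hκ hJ hC hlamθ hlamβ hs hs' (half_pos hδ)
  have h2 := SparseDR.tendsto_foldError B κ E hp hM hκ hJc hC hlamθ hlamβ hs hs' (half_pos hδ)
  have h3 := h1.add h2
  rw [add_zero] at h3
  refine tendsto_of_tendsto_of_tendsto_of_le_of_le' tendsto_const_nhds h3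
    (Eventually.of_forall fun b => zero_le) ?_
  filter_upwards [eventually_ge_atTop 1] with b hb
  refine (measure_mono fun S hS => ?_).trans (measure_union_le _ _)
  rw [Set.mem_ofPred_eq, SparseDR.sqrt_mul_muHat_sub_linearTerm hb (E b) (hJ b)] at hS
  by_contra hne
  simp only [Set.mem_union, Set.mem_ofPred_eq, not_or, not_le] at hne
  obtain ⟨g1, g2⟩ := hne
  have hr : √((2 * b : ℕ) : ℝ) / 2 ≤ √b := by
    rw [div_le_iff₀ two_pos]
    refine (Real.sqrt_le_sqrt (y := b * 2 ^ 2) (by push_cast; nlinarith)).trans (le_of_eq ?_)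
    rw [Real.sqrt_mul (Nat.cast_nonneg b), Real.sqrt_sq zero_le_two]
  rw [abs_mul, abs_of_nonneg (by positivity)] at hS
  have := hS.trans (mul_le_mul hr (abs_add_le _ _) (abs_nonneg _) (Real.sqrt_nonneg _))
  rw [mul_add] at this
  linarith
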